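/- **Setting.** Let $\Omega\subset\mathbb R^2$ be a bounded open polygonal set, exactly triangulated by a conforming mesh $\mathcal T_h$ of nondegenerate triangles (two triangles meet at most in a common vertex or a common edge). Let $h_K$ be the diameter of $K\in\mathcal T_h$ and $\rho_K$ the diameter of the largest disk contained in $K$; the mesh is regular in the sense that $h_K/\rho_K\le\gamma_0$ for all $K\in\mathcal T_h$. The boundary edges of the mesh are divided into a nonempty set of Dirichlet edges, with union $\Gamma_D$, and the Neumann edges, with union $\Gamma_N$. Let $\mathbb A$ be a measurable symmetric matrix field on $\Omega$ with $a_{\min}|\xi|^2\le \mathbb A(x)\xi\cdot\xi\le a_{\max}|\xi|^2$ for all $\xi\in\mathbb R^2$ and a.e. $x\in\Omega$, where $0<a_{\min}\le a_{\max}$. Put $V=\{v\in H^1(\Omega):\ v=0\text{ on }\Gamma_D\}$, and let $u\in V$ satisfy $$\int_\Omega \mathbb A\nabla u\cdot\nabla v=\int_\Omega f\,v+\int_{\Gamma_N} g\,v\qquad\text{for all } v\in V .$$ Let $V_h\subset V$ be the space of the continuous functions that are affine on each triangle and vanish on $\Gamma_D$, let $u_h\in V_h$ satisfy the same equation for all $v\in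 V_h$, and put $\boldsymbol q_h=\mathbb A\nabla u_h$. Write $\phi_i$ for the P1 (hat) function of the vertex $i$ and $\boldsymbol n_K$ for the outer unit normal of $K$. **Assumptions.** On each triangle $K$: $\operatorname{div}(\mathbb A\nabla u_h)=0$; on each edge of $K$ the normal flux $\boldsymbol q_{h|K}\cdot\boldsymbol n_K$ is constant; $f$ is constant on $K$. On each Neumann edge, $g$ is affine. **Construction of $\widehat{\boldsymbol q}_h$ (hybrid-flux technique).** 1. For each vertex $i$, each edge $\Gamma$ having $i$ as an endpoint, and each triangle $K$ having $\Gamma$ as an edge, a number $\widehat b_{K,\Gamma}(i)$ is determined as follows. The constraints are: $\widehat b_{K,\Gamma}(i)=-\widehat b_{J,\Gamma}(i)$ if $\Gamma$ separates $K$ and $J$; $\widehat b_{K,\Gamma}(i)=\int_\Gamma g\,\phi_i$ if $\Gamma\subset\Gamma_N$; and, for each triangle $K$ having $i$ as a vertex, $$\sum_{\Gamma\subset\partial K,\ i\in\Gamma}\widehat b_{K,\Gamma}(i)=\int_K\big(\boldsymbol q_h\cdot\nabla\phi_i-f\,\phi_i\big).$$ Among all solutions of these constraints, $\widehat b(i)$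 is the one that minimizes $\sum_{\Gamma\ni i}|\Gamma|^{-2}\big(\widehat b_{K,\Gamma}(i)-b^m_{K,\Gamma}(i)\big)^2$, with one term per edge $\Gamma$, for either choice of the triangle $K$ containing $\Gamma$. Here $b^m_{K,\Gamma}(i)=\frac12\int_\Gamma\phi_i\,(\boldsymbol q_{h|K}+\boldsymbol q_{h|J})\cdot\boldsymbol n_K$ if $\Gamma$ separates $K$ and $J$, and $b^m_{K,\Gamma}(i)=\int_\Gamma\phi_i\,\boldsymbol q_{h|K}\cdot\boldsymbol n_K$ if $\Gamma$ is a boundary edge. 2. For each triangle $K$ and each edge $\Gamma$ of $K$, with endpoints $\ell,m$: $\widehat g_K=g$ on $\Gamma$ if $\Gamma\subset\Gamma_N$; otherwise $\widehat g_K$ is, on $\Gamma$, the linear combination of $\phi_\ell,\phi_m$ such that $\int_\Gamma\widehat g_K\,\phi_i=\widehat b_{K,\Gamma}(i)$ for $i=\ell,m$. 3. On each triangle $K$, $\widehat{\boldsymbol q}_{h|K}$ minimizes $\int_K\mathbb A^{-1}(\boldsymbol p-\boldsymbol q_h)\cdot(\boldsymbol p-\boldsymbol q_h)$ among the $\boldsymbol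 p\in L^2(K)^2$ with $-\operatorname{div}\boldsymbol p=f$ in $K$ and $\boldsymbol p\cdot\boldsymbol n_K=\widehat g_K$ on $\partial K$. **Theorem.** There is a constant $C$ that depends only on $\gamma_0$, $a_{\min}$ and $a_{\max}$ (in particular, not on $h$) such that, for every such problem, mesh and equilibrated flux $\widehat{\boldsymbol q}_h$, $$E^2_{\rm CRE}(u_h,\widehat{\boldsymbol q}_h):=\frac12\int_\Omega\mathbb A^{-1}(\widehat{\boldsymbol q}_h-\mathbb A\nabla u_h)\cdot(\widehat{\boldsymbol q}_h-\mathbb A\nabla u_h)\ \le\ C\int_\Omega\mathbb A\nabla(u-u_h)\cdot\nabla(u-u_h)=C\,|||u-u_h|||^2 .$$ -/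

import Mathlib

open MeasureTheory
open scoped ContDiff RealInnerProductSpace

noncomputable section

namespace HybridFlux

/-- The Euclidean plane. -/
abbrev Plane := EuclideanSpace ℝ (Fin 2)

/-! ### Triangles, edges, affine shape functions, normals

A (closed) triangle or edge is represented by the finite set of its vertices; the point set is the
convex hull of the vertices. -/

/-- The closed triangle or edge with the given vertices. -/
def hull (s : Finset Plane) : Set Plane := convexHull ℝ (s : Set Plane)

/-- The three edges of a triangle. -/
def edgesOf (K : Finset Plane) : Finset (Finset Plane) := K.powersetCard 2

/-- The length of an edge. -/
def edgeLength (e : Finset Plane) : ℝ := Metric.diam (e : Set Plane)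

/-- The arc length measure on an edge. -/
def edgeMeasure (e : Finset Plane) : Measure Plane := (Measure.hausdorffMeasure 1).restrict (hull e)

open Classical in
/-- The affine function equal to `1` at the vertex `i` of `K` and to `0` at the other vertices. On
the triangle `K` it is the P1 basis function of the node `i`. -/
def shape (K : Finset Plane) (i : Plane) : Plane →ᵃ[ℝ] ℝ :=
  if h : ∃ ℓ : Plane →ᵃ[ℝ] ℝ, ∀ j ∈ K, ℓ j = if j = i then 1 else 0 then h.choose else 0

/-- The (constant) gradient of `shape K i`. -/
def shapeGrad (K : Finset Plane) (i : Plane) : Plane := gradient (fun x => shape K i x) 0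

open Classical in
/-- The unit normal on the edge `e` of the triangle `K`, pointing out of `K`: the normalized opposite
of the gradient of the affine function that vanishes on `e` and is `1` at the opposite vertex. -/
def outerNormal (K e : Finset Plane) : Plane :=
  -((‖∑ i ∈ K \ e, shapeGrad K i‖)⁻¹ • ∑ i ∈ K \ e, shapeGrad K i)

open Classical in
theorem shape_apply {K : Finset Plane} (hK : AffineIndependent ℝ ((↑) : K → Plane))
    (i : Plane) {j : Plane} (hj : j ∈ K) : shape K i j = if j = i then 1 else 0 := by
  have h : ∃ ℓ : Plane →ᵃ[ℝ] ℝ, ∀ j ∈ K, ℓ j = if j = i then 1 else 0 := by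
    by_cases hi : i ∈ K
    · obtain ⟨t, hst, ht, htop⟩ := exists_subset_affineIndependent_affineSpan_eq_top
        (k := ℝ) (V := Plane) (P := Plane) (s := (K : Set Plane)) hK
      let b : AffineBasis t ℝ Plane := ⟨(↑), ht, by simpa using htop⟩
      refine ⟨b.coord ⟨i, hst hi⟩, fun k hk => ?_⟩
      have := b.coord_apply ⟨i, hst hi⟩ ⟨k, hst hk⟩
      have hb : b ⟨k, hst hk⟩ = k := rfl
      rw [hb] at this
      rw [this]
      by_cases hki : k = i
      · simp [hki]
      · have : i ≠ k := fun h => hki h.symm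
        simp [hki, this]
    · refine ⟨0, fun k hk => ?_⟩
      have : k ≠ i := fun h => hi (h ▸ hk)
      simp [this]
  unfold shape
  rw [dif_pos h]
  exact h.choose_spec j hj

theorem inner_shapeGrad (K : Finset Plane) (i x y : Plane) :
    ⟪shapeGrad K i, x - y⟫ = shape K i x - shape K i y := by
  have hd : HasFDerivAt (fun x => shape K i x)
      ((shape K i).linear.toContinuousLinearMap) (0 : Plane) := by
    have := ((shape K i).linear.toContinuousLinearMap).hasFDerivAt (x := (0 : Plane))
    have h2 := this.add_const (shape K i 0)
    refine h2.congr_of_eventuallyEq (Filter.Eventually.of_forall fun z => ?_)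
    have := (shape K i).linearMap_vsub z 0
    simp only [vsub_eq_sub, sub_zero] at this
    simp [this]
  rw [shapeGrad, inner_gradient_left, hd.fderiv]
  have := (shape K i).linearMap_vsub x y
  simpa using this

/-- `outerNormal K e` has norm one, is orthogonal to the edge, and points away from the third
vertex. -/
theorem outerNormal_spec {a b c : Plane} (hab : a ≠ b) (hac : a ≠ c) (hbc : b ≠ c)
    (K e : Finset Plane) (hKe : ∀ x, x ∈ K ↔ x = a ∨ x = b ∨ x = c)
    (he : ∀ x, x ∈ e ↔ x = a ∨ x = b) (hK : AffineIndependent ℝ ((↑) : K → Plane)) :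
    ‖outerNormal K e‖ = 1 ∧ ⟪outerNormal K e, b - a⟫ = 0 ∧ ⟪outerNormal K e, c - a⟫ < 0 := by
  classical
  have hs : K \ e = {c} := by
    ext x
    simp only [Finset.mem_sdiff, hKe, he, Finset.mem_singleton]
    constructor
    · rintro ⟨h | h | h, h'⟩ <;> simp_all
    · rintro rfl
      exact ⟨Or.inr (Or.inr rfl), fun h => h.elim (fun h => hac h.symm) (fun h => hbc h.symm)⟩
  have hn : outerNormal K e = -((‖shapeGrad K c‖)⁻¹ • shapeGrad K c) := by
    unfold outerNormal
    rw [hs, Finset.sum_singleton]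
  have h1 : shape K c a = 0 := by
    rw [shape_apply hK c ((hKe a).2 (Or.inl rfl)), if_neg hac]
  have h2 : shape K c b = 0 := by
    rw [shape_apply hK c ((hKe b).2 (Or.inr (Or.inl rfl))), if_neg hbc]
  have h3 : shape K c c = 1 := by
    rw [shape_apply hK c ((hKe c).2 (Or.inr (Or.inr rfl))), if_pos rfl]
  have hca := inner_shapeGrad K c c a
  have hba := inner_shapeGrad K c b a
  rw [h3, h1] at hca
  rw [h2, h1] at hba
  have hne : shapeGrad K c ≠ 0 := by
    intro h
    rw [h] at hca
    simp at hca
  have hpos : 0 < ‖shapeGrad K c‖ := norm_pos_iff.2 hne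
  rw [hn]
  refine ⟨?_, ?_, ?_⟩
  · rw [norm_neg, norm_smul, norm_inv, norm_norm, inv_mul_cancel₀ hpos.ne']
  · rw [inner_neg_left, real_inner_smul_left, hba]
    simp
  · rw [inner_neg_left, real_inner_smul_left, hca]
    have := inv_pos.2 hpos
    linarith

/-! ### Triangular meshes -/

/-- A conforming triangular mesh: a finite set of nondegenerate triangles, two of which meet at most
in a common vertex or a common edge. -/
structure TriMesh where
  /-- the elements of the mesh -/
  elems : Finset (Finset Plane)
  card_eq : ∀ K ∈ elems, K.card = 3
  indep : ∀ K ∈ elems, AffineIndependent ℝ ((↑) : K → Plane)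
  conforming : ∀ K ∈ elems, ∀ J ∈ elems,
    hull K ∩ hull J ⊆ convexHull ℝ ((K : Set Plane) ∩ (J : Set Plane))

/-- The open set that is partitioned by the mesh. -/
def TriMesh.domain (T : TriMesh) : Set Plane := interior (⋃ K ∈ T.elems, hull K)

open Classical in
/-- The edges of the mesh. -/
def TriMesh.edges (T : TriMesh) : Finset (Finset Plane) := T.elems.biUnion edgesOf

open Classical in
/-- The elements that have `e` as an edge. -/
def TriMesh.adj (T : TriMesh) (e : Finset Plane) : Finset (Finset Plane) :=
  {K ∈ T.elems | e ∈ edgesOf K}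

open Classical in
/-- The edges on the boundary of the domain: those that belong to a single element. -/
def TriMesh.boundaryEdges (T : TriMesh) : Finset (Finset Plane) :=
  {e ∈ T.edges | (T.adj e).card = 1}

/-- The diameter of the largest disk contained in the triangle `K`. -/
def inDiam (K : Finset Plane) : ℝ :=
  sSup {d : ℝ | 0 ≤ d ∧ ∃ c : Plane, Metric.closedBall c (d / 2) ⊆ hull K}

/-- Mesh regularity: `h_K / ρ_K ≤ γ₀` for every element, `h_K` being the diameter of `K` and `ρ_K`
the diameter of its largest inscribed disk. -/
def TriMesh.IsRegular (T : TriMesh) (γ₀ : ℝ) : Prop :=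
  ∀ K ∈ T.elems, Metric.diam (hull K) ≤ γ₀ * inDiam K

/-! ### Sobolev functions, traces, weak divergence, normal traces -/

/-- `G` is the weak gradient of `v` on the open set `U`. -/
def HasWeakGradient (U : Set Plane) (v : Plane → ℝ) (G : Plane → Plane) : Prop :=
  ∀ ψ : Plane → ℝ, ContDiff ℝ ∞ ψ → HasCompactSupport ψ → tsupport ψ ⊆ U → ∀ c : Plane,
    ∫ x in U, v x * fderiv ℝ ψ x c = -∫ x in U, ⟪G x, c⟫ * ψ x

/-- A function of `H¹(U)` together with its weak gradient. -/
structure H1 (U : Set Plane) where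
  /-- the function -/
  val : Plane → ℝ
  /-- its weak gradient -/
  grad : Plane → Plane
  memLp_val : MemLp val 2 (volume.restrict U)
  memLp_grad : MemLp grad 2 (volume.restrict U)
  weak : HasWeakGradient U val grad

/-- `t ∈ L²(∂Ω)` is the trace on `∂Ω` of `v ∈ H¹(Ω)`, `Ω` being the domain of the mesh. The trace is
characterized by Green's formula
`∫_Ω (v ∂_c ψ + (∇v · c) ψ) = ∫_{∂Ω} t ψ (c · n)` for smooth `ψ` and constant vectors `c`. For a
boundary edge `e`, the inner sum has one term: the element that contains `e`. -/
def IsTrace (T : TriMesh) (v : H1 T.domain) (t : Plane → ℝ) : Prop :=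
  (∀ e ∈ T.boundaryEdges, MemLp t 2 (edgeMeasure e)) ∧
  ∀ ψ : Plane → ℝ, ContDiff ℝ ∞ ψ → ∀ c : Plane,
    ∫ x in T.domain, (v.val x * fderiv ℝ ψ x c + ⟪v.grad x, c⟫ * ψ x) =
      ∑ e ∈ T.boundaryEdges, ∑ K ∈ T.adj e,
        ∫ x, t x * ψ x * ⟪c, outerNormal K e⟫ ∂(edgeMeasure e)

/-- `div q = d` in the interior of the triangle `K`, in the weak sense. -/
def HasWeakDiv (K : Finset Plane) (q : Plane → Plane) (d : Plane → ℝ) : Prop :=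
  ∀ ψ : Plane → ℝ, ContDiff ℝ ∞ ψ → HasCompactSupport ψ → tsupport ψ ⊆ interior (hull K) →
    ∫ x in hull K, ⟪q x, gradient ψ x⟫ = -∫ x in hull K, d x * ψ x

/-- The field `q ∈ H(div, K)` with `div q = d` satisfies `q · n_K = t e` on each edge `e` of the
triangle `K`. The normal trace is characterized by Green's formula
`∫_K (q · ∇ψ + (div q) ψ) = ∫_{∂K} (q · n_K) ψ` for smooth `ψ`. -/
def HasNormalTrace (K : Finset Plane) (q : Plane → Plane) (d : Plane → ℝ)
    (t : Finset Plane → Plane → ℝ) : Prop :=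
  ∀ ψ : Plane → ℝ, ContDiff ℝ ∞ ψ →
    ∫ x in hull K, (⟪q x, gradient ψ x⟫ + d x * ψ x) =
      ∑ e ∈ edgesOf K, ∫ x, t e x * ψ x ∂(edgeMeasure e)

/-! ### The diffusion problem and its P1 approximation

`ΓD` and `ΓN` are sets of boundary edges; their unions are the Dirichlet and Neumann parts of the
boundary. -/

/-- The Neumann edges: the boundary edges that are not Dirichlet edges. -/
def TriMesh.neumannEdges (T : TriMesh) (ΓD : Finset (Finset Plane)) : Finset (Finset Plane) :=
  open Classical in T.boundaryEdges \ ΓD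

/-- `A` is a measurable symmetric matrix field on `U`, with
`a_min |ξ|² ≤ A(x) ξ · ξ ≤ a_max |ξ|²` almost everywhere. -/
structure IsDiffusionTensor (U : Set Plane) (aMin aMax : ℝ) (A : Plane → Plane →L[ℝ] Plane) :
    Prop where
  meas : AEStronglyMeasurable A (volume.restrict U)
  symm : ∀ᵐ x ∂(volume.restrict U), ∀ ξ η : Plane, ⟪A x ξ, η⟫ = ⟪ξ, A x η⟫
  lower : ∀ᵐ x ∂(volume.restrict U), ∀ ξ : Plane, aMin * ‖ξ‖ ^ 2 ≤ ⟪A x ξ, ξ⟫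
  upper : ∀ᵐ x ∂(volume.restrict U), ∀ ξ : Plane, ⟪A x ξ, ξ⟫ ≤ aMax * ‖ξ‖ ^ 2

/-- `f` is constant on each triangle. -/
def IsElementwiseConstant (T : TriMesh) (f : Plane → ℝ) : Prop :=
  ∀ K ∈ T.elems, ∃ c : ℝ, ∀ᵐ x ∂(volume.restrict (hull K)), f x = c

/-- `g` is affine on each edge of the given set. -/
def IsEdgewiseAffine (S : Finset (Finset Plane)) (g : Plane → ℝ) : Prop :=
  ∀ e ∈ S, ∃ ℓ : Plane →ᵃ[ℝ] ℝ, ∀ᵐ x ∂(edgeMeasure e), g x = ℓ x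

/-- `v` belongs to `V = {v ∈ H¹(Ω), v = 0 on ΓD}`, and `t` is its trace. -/
def MemV (T : TriMesh) (ΓD : Finset (Finset Plane)) (v : H1 T.domain) (t : Plane → ℝ) : Prop :=
  IsTrace T v t ∧ ∀ e ∈ ΓD, ∀ᵐ x ∂(edgeMeasure e), t x = 0

/-- `u ∈ V` and `∫_Ω A∇u · ∇v = ∫_Ω f v + ∫_ΓN g v` for all `v ∈ V`. -/
def IsWeakSolution (T : TriMesh) (ΓD : Finset (Finset Plane)) (A : Plane → Plane →L[ℝ] Plane)
    (f g : Plane → ℝ) (u : H1 T.domain) : Prop :=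
  (∃ t, MemV T ΓD u t) ∧
  ∀ (v : H1 T.domain) (t : Plane → ℝ), MemV T ΓD v t →
    ∫ x in T.domain, ⟪A x (u.grad x), v.grad x⟫ =
      (∫ x in T.domain, f x * v.val x) +
        ∑ e ∈ T.neumannEdges ΓD, ∫ x, g x * t x ∂(edgeMeasure e)

/-- `v` belongs to the P1 finite element space: it is affine on each closed triangle (hence continuous
on the closure of the domain) and vanishes on the Dirichlet edges. -/
def MemP1 (T : TriMesh) (ΓD : Finset (Finset Plane)) (v : Plane → ℝ) : Prop :=
  (∀ K ∈ T.elems, ∃ ℓ : Plane →ᵃ[ℝ] ℝ, ∀ x ∈ hull K, v x = ℓ x) ∧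
  ∀ e ∈ ΓD, ∀ x ∈ hull e, v x = 0

/-- `u_h` is the P1 finite element solution. The classical gradient of a P1 function exists at
interior points of the triangles, hence almost everywhere. -/
def IsFESolution (T : TriMesh) (ΓD : Finset (Finset Plane)) (A : Plane → Plane →L[ℝ] Plane)
    (f g : Plane → ℝ) (uh : Plane → ℝ) : Prop :=
  MemP1 T ΓD uh ∧
  ∀ v : Plane → ℝ, MemP1 T ΓD v →
    ∫ x in T.domain, ⟪A x (gradient uh x), gradient v x⟫ =
      (∫ x in T.domain, f x * v x) +
        ∑ e ∈ T.neumannEdges ΓD, ∫ x, g x * v x ∂(edgeMeasure e)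

/-- The finite element flux `q_h = A∇u_h`. -/
def feFlux (A : Plane → Plane →L[ℝ] Plane) (uh : Plane → ℝ) (x : Plane) : Plane :=
  A x (gradient uh x)

/-- `‖|p|‖²_{q,S} = ∫_S A⁻¹ p · p`. -/
def fluxNormSq (A : Plane → Plane →L[ℝ] Plane) (S : Set Plane) (p : Plane → Plane) : ℝ :=
  ∫ x in S, ⟪(A x).inverse (p x), p x⟫

/-- `E²_CRE(u_h, q̂) = ½ ‖|q̂ - A∇u_h|‖²_q`. -/
def creSq (T : TriMesh) (A : Plane → Plane →L[ℝ] Plane) (uh : Plane → ℝ) (qhat : Plane → Plane) :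
    ℝ :=
  (1 / 2) * fluxNormSq A T.domain (fun x => qhat x - feFlux A uh x)

/-- `‖|u - u_h|‖² = ∫_Ω A∇(u - u_h) · ∇(u - u_h)`. -/
def energyErrorSq (T : TriMesh) (A : Plane → Plane →L[ℝ] Plane) (u : H1 T.domain)
    (uh : Plane → ℝ) : ℝ :=
  ∫ x in T.domain, ⟪A x (u.grad x - gradient uh x), u.grad x - gradient uh x⟫

/-! ### The hybrid-flux construction -/

/-- `Q_i^K = ∫_K (q_h · ∇φ_i - f φ_i)`. -/
def nodalLoad (A : Plane → Plane →L[ℝ] Plane) (f uh : Plane → ℝ) (K : Finset Plane) (i : Plane) :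
    ℝ :=
  ∫ x in hull K, (⟪feFlux A uh x, shapeGrad K i⟫ - f x * shape K i x)

open Classical in
/-- The local system at the node `i` for the projections `b K e = ∫_e ĝ_K φ_i` of the tractions, `e`
running over the edges attached to `i` and `K` over the elements that contain `e`. The tractions on
the two sides of an interior edge are opposite, they are equal to `g` on Neumann edges, and in each
element attached to `i` the prolongation condition `∑_{e ⊂ ∂K} ∫_e ĝ_K φ_i = Q_i^K` holds (`φ_i`
vanishes on the edge of `K` opposite to `i`). -/
structure IsNodalSolution (T : TriMesh) (ΓD : Finset (Finset Plane))
    (A : Plane → Plane →L[ℝ] Plane) (f g uh : Plane → ℝ) (i : Plane)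
    (b : Finset Plane → Finset Plane → ℝ) : Prop where
  opposite : ∀ e ∈ T.edges, i ∈ e → ∀ K ∈ T.adj e, ∀ J ∈ T.adj e, K ≠ J → b J e = -b K e
  neumann : ∀ e ∈ T.neumannEdges ΓD, i ∈ e → ∀ K ∈ T.adj e,
    b K e = ∫ x, g x * shape K i x ∂(edgeMeasure e)
  prolongation : ∀ K ∈ T.elems, i ∈ K →
    ∑ e ∈ edgesOf K with i ∈ e, b K e = nodalLoad A f uh K i

/-- `b^m_{K,e}(i) = ∫_e φ_i m`, where `m` is the finite element normal flux on `e`, oriented by the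
outer normal of `K`, averaged over the elements that contain `e`: the half sum of the values from the
two sides on an interior edge, the value from `K` on a boundary edge. Here `qn J e` is the
(constant) value of `q_{h|J} · n_J` on `e`; note `n_J = -n_K` for `J ≠ K`. -/
def meanFlux (T : TriMesh) (qn : Finset Plane → Finset Plane → ℝ) (i : Plane)
    (K e : Finset Plane) : ℝ :=
  open Classical in
  ∫ x, shape K i x *
    (((T.adj e).card : ℝ)⁻¹ * ∑ J ∈ T.adj e, if J = K then qn J e else -qn J e) ∂(edgeMeasure e)

open Classical in
/-- The cost `∑_e (b_e - b^m_e(i))² / |e|²`, over the edges attached to the node `i`. For an interior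
edge, the values of `(b K e - b^m_{K,e}(i))²` from the two sides coincide for solutions of the local
system, and the average over the two sides is this common value. -/
def nodalCost (T : TriMesh) (qn : Finset Plane → Finset Plane → ℝ) (i : Plane)
    (b : Finset Plane → Finset Plane → ℝ) : ℝ :=
  ∑ e ∈ T.edges with i ∈ e,
    ((T.adj e).card : ℝ)⁻¹ * ∑ K ∈ T.adj e, (b K e - meanFlux T qn i K e) ^ 2 / edgeLength e ^ 2

/-- The tractions `ghat K e = ĝ_K` on the edges `e` of the elements `K` are the equilibrated tractions
of the hybrid-flux technique: at each node `i`, their projections are the solution of the local system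
that minimizes the cost; `ĝ_K` is equal to `g` on Neumann edges; on the other edges it is the linear
combination of the basis functions of the two endpoints that has the prescribed projections. -/
def IsEquilibratedTraction (T : TriMesh) (ΓD : Finset (Finset Plane))
    (A : Plane → Plane →L[ℝ] Plane) (f g uh : Plane → ℝ) (qn : Finset Plane → Finset Plane → ℝ)
    (ghat : Finset Plane → Finset Plane → Plane → ℝ) : Prop :=
  ∃ b : Plane → Finset Plane → Finset Plane → ℝ,
    (∀ K ∈ T.elems, ∀ i ∈ K, IsNodalSolution T ΓD A f g uh i (b i) ∧
      ∀ b' : Finset Plane → Finset Plane → ℝ, IsNodalSolution T ΓD A f g uh i b' →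
        nodalCost T qn i (b i) ≤ nodalCost T qn i b') ∧
    (∀ e ∈ T.neumannEdges ΓD, ∀ K ∈ T.adj e, ∀ x ∈ hull e, ghat K e x = g x) ∧
    (∀ e ∈ T.edges, e ∉ T.neumannEdges ΓD → ∀ K ∈ T.adj e,
      (∃ c : Plane → ℝ, ∀ x ∈ hull e, ghat K e x = ∑ j ∈ e, c j * shape K j x) ∧
      ∀ i ∈ e, ∫ x, ghat K e x * shape K i x ∂(edgeMeasure e) = b i K e)

/-- The field `p ∈ L²(K)²` solves the local Neumann problem
`-div p = f` in `K`, `p · n_K = ĝ_K` on `∂K`. -/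
def IsAdmissibleFlux (f : Plane → ℝ) (gK : Finset Plane → Plane → ℝ) (K : Finset Plane)
    (p : Plane → Plane) : Prop :=
  MemLp p 2 (volume.restrict (hull K)) ∧ HasWeakDiv K p (fun x => -f x) ∧
    HasNormalTrace K p (fun x => -f x) gK

/-- `qhat` is an equilibrated flux field constructed with the hybrid-flux technique: for some choice
of equilibrated tractions, it minimizes on each element `K` the distance to `q_h` in the norm
`‖|·|‖_{q,K}` among the solutions of the local Neumann problem. -/
def IsHybridFlux (T : TriMesh) (ΓD : Finset (Finset Plane)) (A : Plane → Plane →L[ℝ] Plane)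
    (f g uh : Plane → ℝ) (qn : Finset Plane → Finset Plane → ℝ) (qhat : Plane → Plane) : Prop :=
  ∃ ghat : Finset Plane → Finset Plane → Plane → ℝ,
    IsEquilibratedTraction T ΓD A f g uh qn ghat ∧
    ∀ K ∈ T.elems, IsAdmissibleFlux f (ghat K) K qhat ∧
      ∀ p : Plane → Plane, IsAdmissibleFlux f (ghat K) K p →
        fluxNormSq A (hull K) (fun x => qhat x - feFlux A uh x) ≤
          fluxNormSq A (hull K) (fun x => p x - feFlux A uh x)

end HybridFlux

end

open HybridFlux

namespace HybridFlux

/-! ### Barycentric coordinates and areas -/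

/-! The estimate is proved element by element. On an element `K`, `qhat` is the admissible field
closest to `q_h`, so it suffices to exhibit one admissible field close to `q_h`. Such a field is
`q_h + r`, where `r` is affine (`edgeField`), has divergence `-f` and normal component `ĝ_K - q_h ·
n_K`. In a shape regular triangle its norm is controlled by the differences between the traction
moments `b i K e` and the moments `qn K e * (edgeLength e / 2)` of the finite element flux
(`isAdmissibleFlux`, `fluxNormSq_edgeField_le`).

These moments are compared through the mean fluxes `b^m`. Around a vertex, `b - b^m` solves a linear
system whose left-hand sides are plain sums over sets of unknowns and whose right-hand sides are
residuals of `u_h`: flux jumps, Neumann residuals and `f |K|`. Shape regularity bounds the number of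
elements around a vertex (`card_vertex_le`), so up to numbering only finitely many systems occur.
Each is solvable, since `b - b^m` solves it, and hence has a solution bounded by its right-hand
sides (`exists_bounded_solution`). The minimizer costs no more than this competitor. To handle the
weights `|e|⁻²`, the replacement is made in a single edge-connected component of the patch, where
all lengths are comparable (`exists_nodal_bound`).

The residuals are bounded by the energy error with bubble functions (`volume_mul_abs_le`,
`abs_jump_le`, `abs_neumann_le`). The edge bubble has the same moments against affine functions as a
hat function, so affine Neumann data create no oscillation term. The test functions are given
piecewise; Green's formula on each triangle shows that they belong to `H¹` and identifies their
traces (`exists_H1_of_broken`). In the final sum each element error is counted a bounded number of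
times (`sum_patchError_le`). -/

theorem isCompact_hull (K : Finset Plane) : IsCompact (hull K) :=
  K.finite_toSet.isCompact_convexHull (𝕜 := ℝ)

theorem inner_plane (x y : Plane) : ⟪x, y⟫ = x 0 * y 0 + x 1 * y 1 := by
  simp [PiLp.inner_apply, Fin.sum_univ_two]
  ring

theorem norm_sq_plane (x : Plane) : ‖x‖ ^ 2 = x 0 ^ 2 + x 1 ^ 2 := by
  rw [← real_inner_self_eq_norm_sq, inner_plane]
  ring

/-- The determinant of two vectors of the plane. -/
def cross (u v : Plane) : ℝ := u 0 * v 1 - u 1 * v 0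

/-- `K` is a nondegenerate triangle with vertices `a`, `b`, `c`. -/
structure IsTri (K : Finset Plane) (a b c : Plane) : Prop where
  mem : ∀ x, x ∈ K ↔ x = a ∨ x = b ∨ x = c
  indep : AffineIndependent ℝ ((↑) : K → Plane)
  ab : a ≠ b
  ac : a ≠ c
  bc : b ≠ c

theorem exists_isTri {K : Finset Plane} (h3 : K.card = 3)
    (hK : AffineIndependent ℝ ((↑) : K → Plane)) : ∃ a b c, IsTri K a b c := by
  classical
  obtain ⟨a, b, c, hab, hac, hbc, rfl⟩ := Finset.card_eq_three.1 h3
  exact ⟨a, b, c, by simp, hK, hab, hac, hbc⟩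

/-- The point with barycentric coordinates `(1 - s - t, s, t)`. -/
def baryPoint (a b c : Plane) (s t : ℝ) : Plane := a + s • (b - a) + t • (c - a)

theorem affine_baryPoint (l : Plane →ᵃ[ℝ] ℝ) (a b c : Plane) (s t : ℝ) :
    l (baryPoint a b c s t) = (1 - s - t) * l a + s * l b + t * l c := by
  have h (x : Plane) : l x = l.linear x + l 0 := by
    have := l.linearMap_vsub x 0
    simp only [vsub_eq_sub, sub_zero] at this
    rw [this]; ring
  rw [h, h a, h b, h c, baryPoint]
  simp only [map_add, map_smul, map_sub, smul_eq_mul]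
  ring

namespace IsTri

variable {K : Finset Plane} {a b c : Plane}

theorem rotate (h : IsTri K a b c) : IsTri K b c a :=
  ⟨fun x => by rw [h.mem x]; tauto, h.indep, h.bc, h.ab.symm, h.ac.symm⟩

theorem swap (h : IsTri K a b c) : IsTri K b a c :=
  ⟨fun x => by rw [h.mem x]; tauto, h.indep, h.ab.symm, h.bc, h.ac⟩

theorem flip (h : IsTri K a b c) : IsTri K a c b := h.rotate.swap.rotate.rotate

theorem mem_a (h : IsTri K a b c) : a ∈ K := (h.mem a).2 (Or.inl rfl)

theorem mem_b (h : IsTri K a b c) : b ∈ K := h.rotate.mem_a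

theorem mem_c (h : IsTri K a b c) : c ∈ K := h.rotate.rotate.mem_a

open Classical in
theorem eq (h : IsTri K a b c) : K = {a, b, c} := by
  ext x; simp [h.mem x]

open Classical in
theorem sum_eq {M : Type*} [AddCommMonoid M] (h : IsTri K a b c) (F : Plane → M) :
    ∑ i ∈ K, F i = F a + (F b + F c) := by
  rw [h.eq, Finset.sum_insert (by simp [h.ab, h.ac]), Finset.sum_pair h.bc]

theorem shape_aa (h : IsTri K a b c) : shape K a a = 1 := by
  rw [shape_apply h.indep a h.mem_a, if_pos rfl]

theorem shape_ab (h : IsTri K a b c) : shape K a b = 0 := by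
  rw [shape_apply h.indep a h.mem_b, if_neg h.ab.symm]

theorem shape_ac (h : IsTri K a b c) : shape K a c = 0 := by
  rw [shape_apply h.indep a h.mem_c, if_neg h.ac.symm]

theorem shape_a_bary (h : IsTri K a b c) (s t : ℝ) :
    shape K a (baryPoint a b c s t) = 1 - s - t := by
  rw [affine_baryPoint, h.shape_aa, h.shape_ab, h.shape_ac]; ring

theorem shape_b_bary (h : IsTri K a b c) (s t : ℝ) :
    shape K b (baryPoint a b c s t) = s := by
  rw [affine_baryPoint, h.rotate.shape_aa, h.rotate.shape_ac, h.rotate.shape_ab]; ring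

theorem shape_c_bary (h : IsTri K a b c) (s t : ℝ) :
    shape K c (baryPoint a b c s t) = t := by
  have h' := h.rotate.rotate
  rw [affine_baryPoint, h'.shape_aa, h'.shape_ab, h'.shape_ac]; ring

/-- Cramer's rule: the gradient is orthogonal to `b - a` and has product `1` with `c - a`, so it is
`b - a` turned by a right angle and divided by the determinant. -/
theorem cross_shapeGrad (h : IsTri K a b c) :
    shapeGrad K c 0 * cross (b - a) (c - a) = -(b - a) 1 ∧
      shapeGrad K c 1 * cross (b - a) (c - a) = (b - a) 0 := by
  have h' := h.rotate.rotate
  have h1 := inner_shapeGrad K c b a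
  have h2 := inner_shapeGrad K c c a
  rw [h'.shape_aa, h'.shape_ab] at h2
  rw [h'.shape_ac, h'.shape_ab, inner_plane] at h1
  rw [inner_plane] at h2
  unfold cross
  constructor
  · linear_combination (c - a) 1 * h1 - (b - a) 1 * h2
  · linear_combination -(c - a) 0 * h1 + (b - a) 0 * h2

theorem cross_ne_zero (h : IsTri K a b c) : cross (b - a) (c - a) ≠ 0 := by
  intro h0
  obtain ⟨h1, h2⟩ := h.cross_shapeGrad
  rw [h0, mul_zero] at h1 h2
  apply h.ab
  have : b - a = 0 := by
    ext i; fin_cases i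
    · simpa using h2.symm
    · have h1' : (b - a) 1 = 0 := by linarith
      simpa using h1'
  exact (sub_eq_zero.1 this).symm

theorem norm_shapeGrad (h : IsTri K a b c) :
    ‖shapeGrad K c‖ * |cross (b - a) (c - a)| = ‖b - a‖ := by
  obtain ⟨h1, h2⟩ := h.cross_shapeGrad
  have : (‖shapeGrad K c‖ * |cross (b - a) (c - a)|) ^ 2 = ‖b - a‖ ^ 2 := by
    rw [mul_pow, sq_abs, norm_sq_plane, norm_sq_plane, add_mul, ← mul_pow, ← mul_pow, h1, h2]
    ring
  exact (pow_left_inj₀ (by positivity) (by positivity) two_ne_zero).1 this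

theorem mem_hull_iff (h : IsTri K a b c) {x : Plane} :
    x ∈ hull K ↔ ∃ s t : ℝ, 0 ≤ s ∧ 0 ≤ t ∧ s + t ≤ 1 ∧ baryPoint a b c s t = x := by
  unfold hull
  rw [Finset.mem_convexHull']
  constructor
  · rintro ⟨w, hw, h1, rfl⟩
    rw [h.sum_eq] at h1
    refine ⟨w b, w c, hw b h.mem_b, hw c h.mem_c, ?_, ?_⟩
    · linarith [hw a h.mem_a]
    · rw [h.sum_eq, baryPoint]
      have : w a = 1 - w b - w c := by linarith
      rw [this]; module
  · rintro ⟨s, t, hs, ht, hst, rfl⟩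
    classical
    have hb := h.ab.symm
    have hc := h.ac.symm
    have hcb := h.bc.symm
    refine ⟨fun x => if x = a then 1 - s - t else if x = b then s else t, ?_, ?_, ?_⟩
    · intro y _
      dsimp only
      split_ifs <;> linarith
    · rw [h.sum_eq]; simp [hb, hc, hcb]
    · rw [h.sum_eq]; simp only [hb, hc, hcb, if_true, if_false, baryPoint]; module

theorem exists_bary (h : IsTri K a b c) (x : Plane) : ∃ s t : ℝ, baryPoint a b c s t = x := by
  have hc := h.cross_ne_zero
  set D := cross (b - a) (c - a) with hD
  refine ⟨cross (x - a) (c - a) / D, cross (b - a) (x - a) / D, ?_⟩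
  have key : ∀ i : Fin 2, (x - a) i * D = cross (x - a) (c - a) * (b - a) i +
      cross (b - a) (x - a) * (c - a) i := by
    intro i
    fin_cases i <;> simp only [hD, cross, Fin.zero_eta, Fin.mk_one] <;> ring
  ext i
  have hk := key i
  simp only [baryPoint, PiLp.add_apply, PiLp.smul_apply, smul_eq_mul]
  have hxi : x i = a i + (x - a) i := by simp
  rw [hxi, add_assoc]
  congr 1
  field_simp
  linarith [key i]

end IsTri

/-! ### Integration on triangles -/

/-- The reference triangle. -/
def refTri : Set (ℝ × ℝ) := {p | 0 ≤ p.1 ∧ 0 ≤ p.2 ∧ p.1 + p.2 ≤ 1}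

theorem isClosed_refTri : IsClosed refTri :=
  (isClosed_le continuous_const continuous_fst).inter
    ((isClosed_le continuous_const continuous_snd).inter
      (isClosed_le (continuous_fst.add continuous_snd) continuous_const))

theorem isCompact_refTri : IsCompact refTri := by
  refine (isCompact_Icc (a := ((0 : ℝ), (0 : ℝ))) (b := (1, 1))).of_isClosed_subset
    isClosed_refTri ?_
  rintro ⟨s, t⟩ ⟨h1, h2, h3⟩
  simp only at h1 h2 h3
  exact ⟨⟨h1, h2⟩, ⟨by simp only; linarith, by simp only; linarith⟩⟩

theorem integral_refTri {H : ℝ × ℝ → ℝ} (hH : Continuous H) :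
    ∫ p in refTri, H p = ∫ s in (0 : ℝ)..1, ∫ t in (0 : ℝ)..(1 - s), H (s, t) := by
  have hintg : IntegrableOn H refTri := hH.continuousOn.integrableOn_compact isCompact_refTri
  rw [← integral_indicator isClosed_refTri.measurableSet, Measure.volume_eq_prod, integral_prod]
  · rw [intervalIntegral.integral_of_le zero_le_one, ← integral_Icc_eq_integral_Ioc,
      ← integral_indicator measurableSet_Icc]
    congr 1
    ext s
    by_cases hs : s ∈ Set.Icc (0 : ℝ) 1
    · rw [Set.indicator_of_mem hs, intervalIntegral.integral_of_le (by linarith [hs.2]),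
        ← integral_Icc_eq_integral_Ioc, ← integral_indicator measurableSet_Icc]
      congr 1
      ext t
      by_cases ht : t ∈ Set.Icc 0 (1 - s)
      · rw [Set.indicator_of_mem ht, Set.indicator_of_mem]
        exact ⟨hs.1, ht.1, by simp only; linarith [ht.2]⟩
      · rw [Set.indicator_of_notMem ht, Set.indicator_of_notMem]
        rintro ⟨_, h2, h3⟩
        exact ht ⟨h2, by simp only at h3; linarith⟩
    · rw [Set.indicator_of_notMem hs]
      have : (fun t => refTri.indicator H (s, t)) = 0 := by
        ext t
        rw [Set.indicator_of_notMem]; rfl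
        rintro ⟨h1, h2, h3⟩
        exact hs ⟨h1, by simp only at h2 h3; linarith⟩
      rw [this]; simp
  · rw [← Measure.volume_eq_prod]
    exact (integrable_indicator_iff isClosed_refTri.measurableSet).2 hintg

theorem measurePreserving_toPlane :
    MeasurePreserving (fun p : ℝ × ℝ => (WithLp.toLp 2 ![p.1, p.2] : Plane)) := by
  have h1 := (volume_preserving_finTwoArrow ℝ).symm
  have h2 := (EuclideanSpace.volume_preserving_symm_measurableEquiv_toLp (Fin 2)).symm
  exact h2.comp h1

theorem measurableEmbedding_toPlane :
    MeasurableEmbedding (fun p : ℝ × ℝ => (WithLp.toLp 2 ![p.1, p.2] : Plane)) :=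
  ((MeasurableEquiv.finTwoArrow (α := ℝ)).symm.trans
    (MeasurableEquiv.toLp 2 (Fin 2 → ℝ))).measurableEmbedding

/-- The linear map that sends the canonical basis to `u`, `v`. -/
noncomputable def frameMap (u v : Plane) : Plane →L[ℝ] Plane :=
  (EuclideanSpace.proj (0 : Fin 2) : Plane →L[ℝ] ℝ).smulRight u +
    (EuclideanSpace.proj (1 : Fin 2) : Plane →L[ℝ] ℝ).smulRight v

theorem det_frameMap (u v : Plane) : (frameMap u v).det = cross u v := by
  have : (frameMap u v : Plane →ₗ[ℝ] Plane) =
      Matrix.toLin (EuclideanSpace.basisFun (Fin 2) ℝ).toBasis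
        (EuclideanSpace.basisFun (Fin 2) ℝ).toBasis !![u 0, v 0; u 1, v 1] := by
    apply (EuclideanSpace.basisFun (Fin 2) ℝ).toBasis.ext
    intro i
    rw [Matrix.toLin_self]
    ext j
    fin_cases i <;> fin_cases j <;> simp [frameMap]
  rw [ContinuousLinearMap.det, this, LinearMap.det_toLin, Matrix.det_fin_two_of, cross]
  ring

namespace IsTri

variable {K : Finset Plane} {a b c : Plane}

/-- Affine change of variables from the reference triangle, followed by Fubini; the Jacobian is the
constant `cross (b - a) (c - a)`. -/
theorem integral_hull (h : IsTri K a b c) {F : Plane → ℝ} (hF : Continuous F) :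
    ∫ x in hull K, F x = |cross (b - a) (c - a)| *
      ∫ s in (0 : ℝ)..1, ∫ t in (0 : ℝ)..(1 - s), F (baryPoint a b c s t) := by
  set R : Set Plane := {p | 0 ≤ p 0 ∧ 0 ≤ p 1 ∧ p 0 + p 1 ≤ 1} with hR
  set Φ : Plane → Plane := fun p => baryPoint a b c (p 0) (p 1) with hΦ
  have hc0 : Continuous fun p : Plane => p 0 := by fun_prop
  have hc1 : Continuous fun p : Plane => p 1 := by fun_prop
  have hRc : IsClosed R := (isClosed_le continuous_const hc0).inter
    ((isClosed_le continuous_const hc1).inter (isClosed_le (hc0.add hc1) continuous_const))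
  have him : hull K = Φ '' R := by
    ext x
    rw [h.mem_hull_iff]
    constructor
    · rintro ⟨s, t, hs, ht, hst, rfl⟩
      exact ⟨WithLp.toLp 2 ![s, t], ⟨by simpa using hs, by simpa using ht, by simpa using hst⟩,
        by simp [hΦ]⟩
    · rintro ⟨p, ⟨h1, h2, h3⟩, rfl⟩
      exact ⟨p 0, p 1, h1, h2, h3, rfl⟩
  have hder : ∀ x ∈ R, HasFDerivWithinAt Φ (frameMap (b - a) (c - a)) R x := by
    intro x _
    have h1 := ((frameMap (b - a) (c - a)).hasFDerivAt (x := x)).const_add a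
    refine HasFDerivAt.hasFDerivWithinAt (h1.congr_of_eventuallyEq ?_)
    refine Filter.Eventually.of_forall fun z => ?_
    simp [hΦ, baryPoint, frameMap, add_assoc]
  have hinj : Set.InjOn Φ R := by
    intro p _ q _ hpq
    have h1 := congrArg (shape K b) hpq
    have h2 := congrArg (shape K c) hpq
    simp only [hΦ, h.shape_b_bary, h.shape_c_bary] at h1 h2
    ext i; fin_cases i
    · exact h1
    · exact h2
  rw [him, integral_image_eq_integral_abs_det_fderiv_smul volume hRc.measurableSet hder hinj]
  simp only [det_frameMap, smul_eq_mul]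
  rw [integral_const_mul]
  congr 1
  rw [← measurePreserving_toPlane.setIntegral_preimage_emb measurableEmbedding_toPlane]
  have hpre : (fun p : ℝ × ℝ => (WithLp.toLp 2 ![p.1, p.2] : Plane)) ⁻¹' R = refTri := by
    ext p; simp [hR, refTri]
  rw [hpre]
  simp only [hΦ]
  have : Continuous fun p : ℝ × ℝ => F (baryPoint a b c p.1 p.2) := by
    unfold baryPoint; fun_prop
  rw [← integral_refTri this]
  simp

theorem volume_hull (h : IsTri K a b c) :
    2 * volume.real (hull K) = |cross (b - a) (c - a)| := by
  have := h.integral_hull (F := fun _ => (1 : ℝ)) continuous_const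
  simp only [setIntegral_const, smul_eq_mul, mul_one, intervalIntegral.integral_const,
    sub_zero] at this
  rw [this]
  have : ∫ s in (0 : ℝ)..1, (1 - s) = 1 / 2 := by
    rw [intervalIntegral.integral_sub (by simp) (by simp)]
    simp; norm_num
  rw [this]; ring

theorem volume_pos (h : IsTri K a b c) : 0 < volume.real (hull K) := by
  have h1 := h.volume_hull
  have h2 := abs_pos.2 h.cross_ne_zero
  linarith

end IsTri

/-! ### Integration on edges -/

open Classical in
-- The arc length parametrization is an isometry, and the one-dimensional Hausdorff measure of the
-- real line is Lebesgue measure.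
theorem edgeMeasure_pair {a b : Plane} (hab : a ≠ b) :
    edgeMeasure {a, b} = Measure.map (fun s : ℝ => a + s • (‖b - a‖⁻¹ • (b - a)))
      (volume.restrict (Set.Icc 0 ‖b - a‖)) := by
  set L := ‖b - a‖ with hL
  have hL0 : 0 < L := norm_pos_iff.2 (sub_ne_zero.2 hab.symm)
  set ι : ℝ → Plane := fun s : ℝ => a + s • (L⁻¹ • (b - a)) with hι
  have hiso : Isometry ι := by
    refine Isometry.of_dist_eq fun s t => ?_
    rw [dist_eq_norm, hι]
    have : a + s • (L⁻¹ • (b - a)) - (a + t • (L⁻¹ • (b - a))) = (s - t) • (L⁻¹ • (b - a)) := by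
      module
    simp only [this]
    rw [norm_smul, norm_smul, norm_inv, norm_norm, ← hL, inv_mul_cancel₀ hL0.ne', mul_one,
      Real.dist_eq, Real.norm_eq_abs]
  have himg : hull {a, b} = ι '' Set.Icc 0 L := by
    unfold hull
    rw [Finset.coe_pair, convexHull_pair, segment_eq_image']
    ext x
    constructor
    · rintro ⟨θ, ⟨h0, h1⟩, rfl⟩
      refine ⟨θ * L, ⟨by positivity, by nlinarith⟩, ?_⟩
      simp only [hι, smul_smul]
      rw [mul_assoc, mul_inv_cancel₀ hL0.ne', mul_one]
    · rintro ⟨s, ⟨h0, h1⟩, rfl⟩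
      refine ⟨s / L, ⟨by positivity, by rwa [div_le_one hL0]⟩, ?_⟩
      simp only [hι, smul_smul, div_eq_mul_inv]
  have hmeas : MeasurableSet (hull {a, b}) := (isCompact_hull _).isClosed.measurableSet
  have hpre : ι ⁻¹' hull {a, b} = Set.Icc 0 L := by
    rw [himg, Set.preimage_image_eq _ hiso.injective]
  rw [← hpre, ← Measure.restrict_map hiso.continuous.measurable hmeas, ← hausdorffMeasure_real,
    hiso.map_hausdorffMeasure (Or.inl zero_le_one), Measure.restrict_restrict hmeas,
    Set.inter_eq_left.2]
  · rfl
  · rw [himg]; exact Set.image_subset_range _ _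

open Classical in
theorem isFiniteMeasure_edgeMeasure_pair {a b : Plane} (hab : a ≠ b) :
    IsFiniteMeasure (edgeMeasure {a, b}) := by
  rw [edgeMeasure_pair hab]
  infer_instance

theorem exists_pair_of_mem_edgesOf {K e : Finset Plane} (he : e ∈ edgesOf K) :
    ∃ a b, a ∈ K ∧ b ∈ K ∧ a ≠ b ∧ e = (open Classical in {a, b}) := by
  classical
  rw [edgesOf, Finset.mem_powersetCard] at he
  obtain ⟨a, b, hab, rfl⟩ := Finset.card_eq_two.1 he.2
  exact ⟨a, b, he.1 (by simp), he.1 (by simp), hab, by congr!⟩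

theorem isFiniteMeasure_edgeMeasure {K e : Finset Plane} (he : e ∈ edgesOf K) :
    IsFiniteMeasure (edgeMeasure e) := by
  obtain ⟨a, b, _, _, hab, rfl⟩ := exists_pair_of_mem_edgesOf he
  exact isFiniteMeasure_edgeMeasure_pair hab

theorem integrable_edgeMeasure {K e : Finset Plane} (he : e ∈ edgesOf K) {F : Plane → ℝ}
    (hF : Continuous F) : Integrable F (edgeMeasure e) := by
  have := isFiniteMeasure_edgeMeasure he
  have h := hF.continuousOn.integrableOn_compact (μ := edgeMeasure e) (isCompact_hull e)
  rw [IntegrableOn, edgeMeasure, Measure.restrict_restrict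
    (isCompact_hull e).isClosed.measurableSet, Set.inter_self] at h
  exact h

theorem ae_edgeMeasure_mem (e : Finset Plane) : ∀ᵐ x ∂(edgeMeasure e), x ∈ hull e :=
  ae_restrict_mem (isCompact_hull e).isClosed.measurableSet

open Classical in
theorem integral_edge {a b : Plane} (hab : a ≠ b) (F : Plane → ℝ) :
    ∫ x, F x ∂(edgeMeasure {a, b}) = ‖b - a‖ * ∫ s in (0 : ℝ)..1, F (a + s • (b - a)) := by
  have hL0 : 0 < ‖b - a‖ := norm_pos_iff.2 (sub_ne_zero.2 hab.symm)
  rw [edgeMeasure_pair hab]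
  set L := ‖b - a‖ with hL
  have hemb : MeasurableEmbedding fun s : ℝ => a + s • (L⁻¹ • (b - a)) := by
    have hu : L⁻¹ • (b - a) ≠ 0 := smul_ne_zero (inv_pos.2 hL0).ne' (sub_ne_zero.2 hab.symm)
    refine Continuous.measurableEmbedding (by fun_prop) fun s t hst => ?_
    have := add_left_cancel hst
    exact smul_left_injective ℝ hu this
  rw [hemb.integral_map, integral_Icc_eq_integral_Ioc, ← intervalIntegral.integral_of_le hL0.le]
  have := intervalIntegral.mul_integral_comp_mul_right
    (f := fun s => F (a + s • (L⁻¹ • (b - a)))) (a := 0) (b := 1) L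
  rw [zero_mul, one_mul] at this
  rw [← this]
  congr 2
  ext s
  rw [smul_smul, mul_assoc, mul_inv_cancel₀ hL0.ne', mul_one]

open Classical in
theorem edgeLength_pair (a b : Plane) : edgeLength {a, b} = ‖b - a‖ := by
  rw [edgeLength, Finset.coe_pair, Metric.diam_pair, dist_comm, dist_eq_norm]

theorem integral_edge_eq_zero {e : Finset Plane} {F : Plane → ℝ} (h : ∀ x ∈ hull e, F x = 0) :
    ∫ x, F x ∂(edgeMeasure e) = 0 := by
  rw [edgeMeasure]
  exact setIntegral_eq_zero_of_forall_eq_zero h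

/-- Degree four covers every explicit integral below: an affine function times the cubic edge bubble
on an edge, and `triBubble` after one integration. -/
theorem integral_quartic (c₀ c₁ c₂ c₃ c₄ x : ℝ) :
    ∫ s in (0 : ℝ)..x, (c₀ + c₁ * s + c₂ * s ^ 2 + c₃ * s ^ 3 + c₄ * s ^ 4) =
      c₀ * x + c₁ / 2 * x ^ 2 + c₂ / 3 * x ^ 3 + c₃ / 4 * x ^ 4 + c₄ / 5 * x ^ 5 := by
  have h : ∀ s ∈ Set.uIcc 0 x, HasDerivAt (fun s : ℝ => c₀ * s + c₁ / 2 * s ^ 2 + c₂ / 3 * s ^ 3 +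
      c₃ / 4 * s ^ 4 + c₄ / 5 * s ^ 5)
      (c₀ + c₁ * s + c₂ * s ^ 2 + c₃ * s ^ 3 + c₄ * s ^ 4) s := by
    intro s _
    have := (((((hasDerivAt_id s).const_mul c₀).add ((hasDerivAt_pow 2 s).const_mul (c₁ / 2))).add
      ((hasDerivAt_pow 3 s).const_mul (c₂ / 3))).add
      ((hasDerivAt_pow 4 s).const_mul (c₃ / 4))).add ((hasDerivAt_pow 5 s).const_mul (c₄ / 5))
    convert! this using 1
    norm_num
    ring
  rw [intervalIntegral.integral_eq_sub_of_hasDerivAt h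
    (Continuous.intervalIntegrable (by fun_prop) _ _)]
  ring

open Classical in
theorem mem_hull_pair_iff {a b : Plane} (c : Plane) {x : Plane} :
    x ∈ hull {a, b} ↔ ∃ s ∈ Set.Icc (0 : ℝ) 1, baryPoint a b c s 0 = x := by
  unfold hull
  rw [Finset.coe_pair, convexHull_pair, segment_eq_image']
  simp [baryPoint]

namespace IsTri

variable {K : Finset Plane} {a b c : Plane}

open Classical in
theorem edgesOf_eq (h : IsTri K a b c) : edgesOf K = {{a, b}, {b, c}, {a, c}} := by
  have h1 := h.ab
  have h2 := h.ac
  have h3 := h.bc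
  rw [edgesOf, h.eq]
  rw [Finset.powersetCard_succ_insert (by simp [h1, h2]),
    Finset.powersetCard_succ_insert (by simp [h3])]
  ext e
  simp [Finset.powersetCard_one, Finset.powersetCard_eq_empty.2]

open Classical in
theorem sum_edgesOf {M : Type*} [AddCommMonoid M] (h : IsTri K a b c) (G : Finset Plane → M) :
    ∑ e ∈ edgesOf K, G e = G {a, b} + (G {b, c} + G {a, c}) := by
  have h1 := h.ab
  have h2 := h.ac
  have h3 := h.bc
  have hc : c ∉ ({a, b} : Finset Plane) := by simp [h2.symm, h3.symm]
  have hb : b ∉ ({a, c} : Finset Plane) := by simp [h1.symm, h3]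
  rw [h.edgesOf_eq, Finset.sum_insert, Finset.sum_pair]
  · intro he
    exact hb (he ▸ by simp)
  · simp only [Finset.mem_insert, Finset.mem_singleton, not_or]
    exact ⟨fun he => hc (he ▸ by simp), fun he => hc (he ▸ by simp)⟩

open Classical in
theorem mem_edgesOf (h : IsTri K a b c) : {a, b} ∈ edgesOf K := by
  rw [h.edgesOf_eq]; simp

open Classical in
theorem shape_edge (h : IsTri K a b c) {x : Plane} (hx : x ∈ hull {a, b}) : shape K c x = 0 := by
  obtain ⟨s, _, rfl⟩ := (mem_hull_pair_iff c).1 hx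
  exact h.shape_c_bary _ _

/-- Gauss' formula on a triangle, in the direction of an edge. -/
theorem integral_fderiv_edge (h : IsTri K a b c) {F : Plane → ℝ} (hF : ContDiff ℝ 1 F) :
    ∫ x in hull K, fderiv ℝ F x (c - a) = 2 * volume.real (hull K) *
      ((∫ s in (0 : ℝ)..1, F (b + s • (c - b))) - ∫ s in (0 : ℝ)..1, F (a + s • (b - a))) := by
  have hFc := hF.continuous
  rw [h.integral_hull (by
    have := hF.continuous_fderiv one_ne_zero
    fun_prop), h.volume_hull]
  congr 1
  -- Integrate first along the segments parallel to `c - a`, which enter the triangle through `{a,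
  -- b}` and leave it through `{b, c}`.
  have hinner : ∀ s : ℝ, ∫ t in (0 : ℝ)..(1 - s), fderiv ℝ F (baryPoint a b c s t) (c - a) =
      F (c + s • (b - c)) - F (a + s • (b - a)) := by
    intro s
    have hd : ∀ t ∈ Set.uIcc 0 (1 - s), HasDerivAt (fun t => F (baryPoint a b c s t))
        (fderiv ℝ F (baryPoint a b c s t) (c - a)) t := by
      intro t _
      have h1 : HasDerivAt (fun t : ℝ => baryPoint a b c s t) (c - a) t := by
        unfold baryPoint
        simpa using ((hasDerivAt_id t).smul_const (c - a)).const_add (a + s • (b - a))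
      exact ((hF.differentiable one_ne_zero _).hasFDerivAt).comp_hasDerivAt t h1
    rw [intervalIntegral.integral_eq_sub_of_hasDerivAt hd]
    · congr 2
      · unfold baryPoint; module
      · unfold baryPoint; module
    · apply Continuous.intervalIntegrable
      have := hF.continuous_fderiv one_ne_zero
      unfold baryPoint
      fun_prop
  simp only [hinner]
  rw [intervalIntegral.integral_sub (Continuous.intervalIntegrable (by fun_prop) _ _)
    (Continuous.intervalIntegrable (by fun_prop) _ _)]
  congr 1
  have := intervalIntegral.integral_comp_sub_left (fun s => F (c + s • (b - c))) (a := 0) (b := 1) 1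
  simp only [sub_zero, sub_self] at this
  rw [← this]
  congr 1
  ext s
  congr 1
  module

open Classical in
theorem integral_fderiv_direction (h : IsTri K a b c) {F : Plane → ℝ} (hF : ContDiff ℝ 1 F) :
    ∫ x in hull K, fderiv ℝ F x (c - a) = 2 * volume.real (hull K) *
      (‖c - b‖⁻¹ * (∫ x, F x ∂(edgeMeasure {b, c})) - ‖b - a‖⁻¹ * ∫ x, F x ∂(edgeMeasure {a, b})) := by
  have h1 : ‖c - b‖ ≠ 0 := (norm_pos_iff.2 (sub_ne_zero.2 h.bc.symm)).ne'
  have h2 : ‖b - a‖ ≠ 0 := (norm_pos_iff.2 (sub_ne_zero.2 h.ab.symm)).ne'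
  rw [h.integral_fderiv_edge hF, integral_edge h.bc, integral_edge h.ab, inv_mul_cancel_left₀ h1,
    inv_mul_cancel_left₀ h2]

open Classical in
theorem outerNormal_eq (h : IsTri K a b c) :
    outerNormal K {a, b} = -((‖shapeGrad K c‖)⁻¹ • shapeGrad K c) := by
  have hs : K \ {a, b} = {c} := by
    ext x
    simp only [Finset.mem_sdiff, h.mem, Finset.mem_insert, Finset.mem_singleton]
    have h1 := h.ac.symm
    have h2 := h.bc.symm
    constructor
    · tauto
    · rintro rfl; tauto
  rw [outerNormal, hs, Finset.sum_singleton]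

open Classical in
theorem inner_outerNormal_edge (h : IsTri K a b c) : ⟪b - a, outerNormal K {a, b}⟫ = 0 := by
  have h' := h.rotate.rotate
  rw [h.outerNormal_eq, inner_neg_right, real_inner_smul_right, real_inner_comm, inner_shapeGrad,
    h'.shape_ac, h'.shape_ab]
  simp

open Classical in
theorem inner_outerNormal (h : IsTri K a b c) :
    ⟪c - a, outerNormal K {a, b}⟫ = -(2 * volume.real (hull K) * ‖b - a‖⁻¹) := by
  have h' := h.rotate.rotate
  have h2 : ‖b - a‖ ≠ 0 := (norm_pos_iff.2 (sub_ne_zero.2 h.ab.symm)).ne'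
  have hn := h.norm_shapeGrad
  have hc := abs_pos.2 h.cross_ne_zero
  rw [h.outerNormal_eq, inner_neg_right, real_inner_smul_right, real_inner_comm, inner_shapeGrad,
    h'.shape_aa, h'.shape_ab, h.volume_hull]
  have : ‖shapeGrad K c‖ = ‖b - a‖ / |cross (b - a) (c - a)| := by
    rw [eq_div_iff hc.ne', hn]
  rw [this]
  field_simp
  ring

open Classical in
-- The edge `{a, c}` is parallel to the direction and drops out; on the two others the product with
-- the normal is, up to sign, twice the area over the edge length.
theorem integral_fderiv_direction_normal (h : IsTri K a b c) {F : Plane → ℝ}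
    (hF : ContDiff ℝ 1 F) :
    ∫ x in hull K, fderiv ℝ F x (c - a) =
      ∑ e ∈ edgesOf K, (∫ x, F x ∂(edgeMeasure e)) * ⟪c - a, outerNormal K e⟫ := by
  have e1 : ⟪c - a, outerNormal K {b, c}⟫ = 2 * volume.real (hull K) * ‖c - b‖⁻¹ := by
    have h1 := h.rotate.inner_outerNormal
    have h2 := h.rotate.inner_outerNormal_edge
    have : c - a = (c - b) - (a - b) := by abel
    rw [this, inner_sub_left, h1, h2]; ring
  have e2 : ⟪c - a, outerNormal K {a, c}⟫ = 0 := by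
    exact h.flip.inner_outerNormal_edge
  rw [h.integral_fderiv_direction hF, h.sum_edgesOf, e1, e2, h.inner_outerNormal]
  ring

end IsTri

/-- Gauss' formula on a triangle. -/
theorem IsTri.integral_fderiv {K : Finset Plane} {a b c : Plane} (h : IsTri K a b c)
    {F : Plane → ℝ} (hF : ContDiff ℝ 1 F) (z : Plane) :
    ∫ x in hull K, fderiv ℝ F x z =
      ∑ e ∈ edgesOf K, ∫ x, F x * ⟪z, outerNormal K e⟫ ∂(edgeMeasure e) := by
  obtain ⟨s, t, hst⟩ := h.exists_bary (a + z)
  have hz : z = s • (b - a) + t • (c - a) := by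
    have : baryPoint a b c s t = a + (s • (b - a) + t • (c - a)) := by
      unfold baryPoint; abel
    rw [this] at hst
    exact (add_left_cancel hst).symm
  have hc := hF.continuous_fderiv one_ne_zero
  have hintg : ∀ w : Plane, IntegrableOn (fun x => fderiv ℝ F x w) (hull K) := fun w =>
    (Continuous.continuousOn (by fun_prop)).integrableOn_compact (isCompact_hull K)
  have h1 := h.integral_fderiv_direction_normal hF
  have h2 := h.flip.integral_fderiv_direction_normal hF
  simp only [integral_mul_const]
  rw [hz]
  simp only [map_add, map_smul, smul_eq_mul, inner_add_left, real_inner_smul_left, mul_add,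
    Finset.sum_add_distrib]
  rw [integral_add ((hintg _).const_mul _) ((hintg _).const_mul _), integral_const_mul,
    integral_const_mul, h1, h2, Finset.mul_sum, Finset.mul_sum]
  congr 1 <;> refine Finset.sum_congr rfl fun e _ => by ring

/-! ### Shape functions and bubbles -/

theorem hasGradientAt_shape (K : Finset Plane) (i x : Plane) :
    HasGradientAt (fun y => shape K i y) (shapeGrad K i) x := by
  rw [hasGradientAt_iff_hasFDerivAt]
  have h := ((InnerProductSpace.toDual ℝ Plane) (shapeGrad K i)).hasFDerivAt (x := x)
  refine (h.add_const (shape K i 0)).congr_of_eventuallyEq (Filter.Eventually.of_forall fun z => ?_)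
  have := inner_shapeGrad K i z 0
  rw [sub_zero] at this
  simp [InnerProductSpace.toDual_apply_apply, this]

theorem gradient_shape (K : Finset Plane) (i x : Plane) :
    gradient (fun y => shape K i y) x = shapeGrad K i :=
  (hasGradientAt_shape K i x).gradient

theorem contDiff_affine (l : Plane →ᵃ[ℝ] ℝ) : ContDiff ℝ ∞ fun x => l x := by
  have : (fun x => l x) = fun x => l.linear.toContinuousLinearMap x + l 0 := by
    ext x
    have := l.linearMap_vsub x 0
    simp only [vsub_eq_sub, sub_zero] at this
    simp [this]
  rw [this]
  fun_prop

theorem contDiff_shape (K : Finset Plane) (i : Plane) : ContDiff ℝ ∞ fun x => shape K i x :=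
  contDiff_affine _

theorem continuous_shape (K : Finset Plane) (i : Plane) : Continuous fun x => shape K i x :=
  (contDiff_shape K i).continuous

theorem HasGradientAt.mul {f g : Plane → ℝ} {f' g' x : Plane} (hf : HasGradientAt f f' x)
    (hg : HasGradientAt g g' x) :
    HasGradientAt (fun y => f y * g y) (f x • g' + g x • f') x := by
  rw [hasGradientAt_iff_hasFDerivAt] at *
  rw [map_add, map_smul, map_smul]
  exact hf.mul hg

/-- A function on the triangle `K` that vanishes on the edges other than `{i, j}`, and acts on the
edge `{i, j}` as the shape function of `i` does when tested against affine functions. -/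
noncomputable def edgeBubble (K : Finset Plane) (i j : Plane) (x : Plane) : ℝ :=
  -- Among the functions `φ_i φ_j (α φ_i + β φ_j)`, only `α = 8`, `β = -2` reproduces on the edge
  -- the moments of `φ_i` against affine functions.
  shape K i x * shape K j x * (8 * shape K i x - 2 * shape K j x)

/-- A function on the triangle with vertices `i`, `j`, `k` that vanishes on the boundary. -/
noncomputable def triBubble (K : Finset Plane) (i j k : Plane) (x : Plane) : ℝ :=
  shape K i x * shape K j x * shape K k x

theorem contDiff_edgeBubble (K : Finset Plane) (i j : Plane) :
    ContDiff ℝ ∞ (edgeBubble K i j) := by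
  have h1 := contDiff_shape K i
  have h2 := contDiff_shape K j
  unfold edgeBubble
  fun_prop

theorem contDiff_triBubble (K : Finset Plane) (i j k : Plane) :
    ContDiff ℝ ∞ (triBubble K i j k) := by
  have h1 := contDiff_shape K i
  have h2 := contDiff_shape K j
  have h3 := contDiff_shape K k
  unfold triBubble
  fun_prop

namespace IsTri

variable {K : Finset Plane} {a b c : Plane}

theorem shape_mem_Icc (h : IsTri K a b c) {x : Plane} (hx : x ∈ hull K) :
    shape K a x ∈ Set.Icc (0 : ℝ) 1 := by
  obtain ⟨s, t, hs, ht, hst, rfl⟩ := h.mem_hull_iff.1 hx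
  rw [h.shape_a_bary]
  constructor <;> linarith

theorem integral_shape (h : IsTri K a b c) :
    ∫ x in hull K, shape K a x = volume.real (hull K) / 3 := by
  rw [h.integral_hull (continuous_shape K a), ← h.volume_hull]
  simp only [h.shape_a_bary]
  have h1 : ∀ s : ℝ, ∫ t in (0 : ℝ)..(1 - s), (1 - s - t) = 1 / 2 + (-1) * s + (1 / 2) * s ^ 2 := by
    intro s
    have := integral_quartic (1 - s) (-1) 0 0 0 (1 - s)
    rw [show (fun t : ℝ => 1 - s - t) =
      fun t => (1 - s) + (-1) * t + 0 * t ^ 2 + 0 * t ^ 3 + 0 * t ^ 4 by ext; ring, this]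
    ring
  simp only [h1]
  have := integral_quartic (1 / 2) (-1) (1 / 2) 0 0 1
  rw [show (fun s : ℝ => 1 / 2 + (-1) * s + (1 / 2) * s ^ 2) =
    fun s => 1 / 2 + (-1) * s + 1 / 2 * s ^ 2 + 0 * s ^ 3 + 0 * s ^ 4 by ext; ring, this]
  ring

theorem integral_triBubble (h : IsTri K a b c) :
    ∫ x in hull K, triBubble K a b c x = volume.real (hull K) / 60 := by
  rw [h.integral_hull (contDiff_triBubble K a b c).continuous, ← h.volume_hull]
  simp only [triBubble, h.shape_a_bary, h.shape_b_bary, h.shape_c_bary]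
  have h1 : ∀ s : ℝ, ∫ t in (0 : ℝ)..(1 - s), (1 - s - t) * s * t =
      0 + (1 / 6) * s + (-1 / 2) * s ^ 2 + (1 / 2) * s ^ 3 + (-1 / 6) * s ^ 4 := by
    intro s
    have := integral_quartic 0 ((1 - s) * s) (-s) 0 0 (1 - s)
    rw [show (fun t : ℝ => (1 - s - t) * s * t) =
      fun t => 0 + (1 - s) * s * t + (-s) * t ^ 2 + 0 * t ^ 3 + 0 * t ^ 4 by ext; ring, this]
    ring
  simp only [h1]
  rw [integral_quartic]
  ring

open Classical in
theorem integral_edge_shape (h : IsTri K a b c) :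
    ∫ x, shape K a x ∂(edgeMeasure {a, b}) = ‖b - a‖ / 2 := by
  rw [integral_edge h.ab]
  have h0 : ∀ s : ℝ, a + s • (b - a) = baryPoint a b c s 0 := by intro s; simp [baryPoint]
  simp only [h0, h.shape_a_bary]
  have := integral_quartic 1 (-1) 0 0 0 1
  rw [show (fun s : ℝ => 1 - s - 0) =
      fun t => 1 + (-1) * t + 0 * t ^ 2 + 0 * t ^ 3 + 0 * t ^ 4 by ext; ring, this]
  ring

open Classical in
theorem integral_edge_affine_shape (h : IsTri K a b c) (l : Plane →ᵃ[ℝ] ℝ) :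
    ∫ x, l x * shape K a x ∂(edgeMeasure {a, b}) = ‖b - a‖ * (l a / 3 + l b / 6) := by
  rw [integral_edge h.ab]
  have h0 : ∀ s : ℝ, a + s • (b - a) = baryPoint a b c s 0 := by intro s; simp [baryPoint]
  simp only [h0, h.shape_a_bary, affine_baryPoint]
  have := integral_quartic (l a) (l b - 2 * l a) (l a - l b) 0 0 1
  rw [show (fun s : ℝ => ((1 - s - 0) * l a + s * l b + 0 * l c) * (1 - s - 0)) =
      fun t => l a + (l b - 2 * l a) * t + (l a - l b) * t ^ 2 + 0 * t ^ 3 + 0 * t ^ 4 by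
    ext; ring, this]
  ring

open Classical in
theorem integral_edge_affine_edgeBubble (h : IsTri K a b c) (l : Plane →ᵃ[ℝ] ℝ) :
    ∫ x, l x * edgeBubble K a b x ∂(edgeMeasure {a, b}) =
      ∫ x, l x * shape K a x ∂(edgeMeasure {a, b}) := by
  rw [h.integral_edge_affine_shape, integral_edge h.ab]
  have h0 : ∀ s : ℝ, a + s • (b - a) = baryPoint a b c s 0 := by intro s; simp [baryPoint]
  simp only [edgeBubble, h0, h.shape_a_bary, h.shape_b_bary, affine_baryPoint]
  have := integral_quartic 0 (8 * l a) (8 * l b - 26 * l a) (28 * l a - 18 * l b)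
    (10 * l b - 10 * l a) 1
  rw [show (fun s : ℝ => ((1 - s - 0) * l a + s * l b + 0 * l c) *
      ((1 - s - 0) * s * (8 * (1 - s - 0) - 2 * s))) =
      fun t => 0 + 8 * l a * t + (8 * l b - 26 * l a) * t ^ 2 + (28 * l a - 18 * l b) * t ^ 3 +
        (10 * l b - 10 * l a) * t ^ 4 by
    ext; ring, this]
  ring

open Classical in
theorem integral_edge_edgeBubble (h : IsTri K a b c) :
    ∫ x, edgeBubble K a b x ∂(edgeMeasure {a, b}) = ‖b - a‖ / 2 := by
  have := h.integral_edge_affine_edgeBubble (AffineMap.const ℝ Plane 1)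
  simpa [h.integral_edge_shape] using this

theorem norm_shapeGrad_volume (h : IsTri K a b c) :
    ‖shapeGrad K c‖ * (2 * volume.real (hull K)) = ‖b - a‖ := by
  rw [h.volume_hull, h.norm_shapeGrad]

theorem norm_sub_le_diam (h : IsTri K a b c) : ‖b - a‖ ≤ Metric.diam (hull K) := by
  rw [← dist_eq_norm]
  exact Metric.dist_le_diam_of_mem (isCompact_hull K).isBounded
    (subset_convexHull ℝ _ h.mem_b) (subset_convexHull ℝ _ h.mem_a)

/-- The determinant is at most the product of the two edge lengths, because its square plus the
square of the scalar product equals the square of that product. -/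
theorem volume_le (h : IsTri K a b c) :
    2 * volume.real (hull K) ≤ ‖b - a‖ * Metric.diam (hull K) := by
  rw [h.volume_hull]
  refine le_trans ?_ (mul_le_mul_of_nonneg_left h.flip.norm_sub_le_diam (norm_nonneg _))
  apply abs_le_of_sq_le_sq _ (by positivity)
  rw [mul_pow, norm_sq_plane, norm_sq_plane, cross]
  nlinarith [sq_nonneg ((b - a) 0 * (c - a) 0 + (b - a) 1 * (c - a) 1)]

/-- From `diam² ≤ M |K|` and `2 |K| ≤ |e| diam`, each edge is comparable to the diameter. This is
the form in which shape regularity is used for lengths. -/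
theorem diam_le (h : IsTri K a b c) {M : ℝ}
    (hM : Metric.diam (hull K) ^ 2 ≤ M * volume.real (hull K)) :
    Metric.diam (hull K) ≤ M / 2 * ‖b - a‖ := by
  have h1 := h.volume_le
  have h2 := h.volume_pos
  have h3 : 0 < ‖b - a‖ := norm_pos_iff.2 (sub_ne_zero.2 h.ab.symm)
  have h4 := h.norm_sub_le_diam
  have h5 : 0 < Metric.diam (hull K) := h3.trans_le h4
  have hM0 : 0 ≤ M := by
    by_contra! hneg
    nlinarith
  by_contra! hlt
  nlinarith [mul_le_mul_of_nonneg_left h1 hM0]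

theorem two_le_of_diam_sq_le (h : IsTri K a b c) {M : ℝ}
    (hM : Metric.diam (hull K) ^ 2 ≤ M * volume.real (hull K)) : 2 ≤ M := by
  have h1 := h.diam_le hM
  have h3 : 0 < ‖b - a‖ := norm_pos_iff.2 (sub_ne_zero.2 h.ab.symm)
  have h4 := h.norm_sub_le_diam
  by_contra! hlt
  nlinarith

/-- The gradient has norm `|e| / (2 |K|)`, and `|e|² ≤ diam² ≤ M |K|`. -/
theorem norm_shapeGrad_le (h : IsTri K a b c) {M : ℝ}
    (hM : Metric.diam (hull K) ^ 2 ≤ M * volume.real (hull K)) :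
    ‖shapeGrad K c‖ ≤ √(M / (4 * volume.real (hull K))) := by
  apply Real.le_sqrt_of_sq_le
  have h1 := h.norm_shapeGrad_volume
  have h2 := h.volume_pos
  have h4 := h.norm_sub_le_diam
  rw [le_div_iff₀ (by positivity)]
  have h5 : ‖b - a‖ ^ 2 ≤ M * volume.real (hull K) :=
    (pow_le_pow_left₀ (norm_nonneg _) h4 2).trans hM
  rw [← h1] at h5
  refine le_of_mul_le_mul_right (a := volume.real (hull K)) ?_ h2
  nlinarith

theorem abs_edgeBubble_le (h : IsTri K a b c) {x : Plane} (hx : x ∈ hull K) :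
    |edgeBubble K a b x| ≤ 8 := by
  obtain ⟨ha0, ha1⟩ := h.shape_mem_Icc hx
  obtain ⟨hb0, hb1⟩ := h.rotate.shape_mem_Icc hx
  have h1 : |8 * shape K a x - 2 * shape K b x| ≤ 8 := by
    rw [abs_le]; constructor <;> linarith
  rw [edgeBubble, abs_mul, abs_mul, abs_of_nonneg ha0, abs_of_nonneg hb0]
  calc shape K a x * shape K b x * |8 * shape K a x - 2 * shape K b x| ≤ 1 * 1 * 8 := by gcongr
    _ = 8 := by norm_num

/-- Product rule, with shape functions in `[0, 1]`: the linear factor contributes `10 G`, the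
quadratic one `8 * (2 G)`. -/
theorem norm_gradient_edgeBubble_le (h : IsTri K a b c) {G : ℝ} (ha : ‖shapeGrad K a‖ ≤ G)
    (hb : ‖shapeGrad K b‖ ≤ G) {x : Plane} (hx : x ∈ hull K) :
    ‖gradient (edgeBubble K a b) x‖ ≤ 26 * G := by
  obtain ⟨ha0, ha1⟩ := h.shape_mem_Icc hx
  obtain ⟨hb0, hb1⟩ := h.rotate.shape_mem_Icc hx
  have hA := hasGradientAt_shape K a x
  have hB := hasGradientAt_shape K b x
  have hC : HasGradientAt (fun y => 8 * shape K a y - 2 * shape K b y)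
      ((8 : ℝ) • shapeGrad K a - (2 : ℝ) • shapeGrad K b) x := by
    rw [hasGradientAt_iff_hasFDerivAt] at *
    rw [map_sub, map_smul, map_smul]
    exact (hA.const_mul 8).sub (hB.const_mul 2)
  have hg := (HasGradientAt.mul (HasGradientAt.mul hA hB) hC).gradient
  have h1 : |8 * shape K a x - 2 * shape K b x| ≤ 8 := by
    rw [abs_le]; constructor <;> linarith
  have hG : 0 ≤ G := (norm_nonneg _).trans ha
  have e1 : ‖(8 : ℝ) • shapeGrad K a - (2 : ℝ) • shapeGrad K b‖ ≤ 10 * G := by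
    refine (norm_sub_le _ _).trans ?_
    rw [norm_smul, norm_smul]
    norm_num
    linarith
  have e2 : ‖shape K a x • shapeGrad K b + shape K b x • shapeGrad K a‖ ≤ 2 * G := by
    refine (norm_add_le _ _).trans ?_
    rw [norm_smul, norm_smul, Real.norm_of_nonneg ha0, Real.norm_of_nonneg hb0]
    nlinarith [norm_nonneg (shapeGrad K a), norm_nonneg (shapeGrad K b)]
  have : gradient (edgeBubble K a b) x = _ := hg
  rw [this]
  refine (norm_add_le _ _).trans ?_
  rw [norm_smul, norm_smul, Real.norm_eq_abs, Real.norm_eq_abs, abs_mul, abs_of_nonneg ha0,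
    abs_of_nonneg hb0]
  calc _ ≤ 1 * 1 * (10 * G) + 8 * (2 * G) := by gcongr
    _ = 26 * G := by ring

theorem norm_gradient_triBubble_le (h : IsTri K a b c) {G : ℝ} (ha : ‖shapeGrad K a‖ ≤ G)
    (hb : ‖shapeGrad K b‖ ≤ G) (hc : ‖shapeGrad K c‖ ≤ G) {x : Plane} (hx : x ∈ hull K) :
    ‖gradient (triBubble K a b c) x‖ ≤ 26 * G := by
  obtain ⟨ha0, ha1⟩ := h.shape_mem_Icc hx
  obtain ⟨hb0, hb1⟩ := h.rotate.shape_mem_Icc hx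
  obtain ⟨hc0, hc1⟩ := h.rotate.rotate.shape_mem_Icc hx
  have hA := hasGradientAt_shape K a x
  have hB := hasGradientAt_shape K b x
  have hC := hasGradientAt_shape K c x
  have hG : 0 ≤ G := (norm_nonneg _).trans ha
  have hg := (HasGradientAt.mul (HasGradientAt.mul hA hB) hC).gradient
  have e2 : ‖shape K a x • shapeGrad K b + shape K b x • shapeGrad K a‖ ≤ 2 * G := by
    refine (norm_add_le _ _).trans ?_
    rw [norm_smul, norm_smul, Real.norm_of_nonneg ha0, Real.norm_of_nonneg hb0]
    nlinarith [norm_nonneg (shapeGrad K a), norm_nonneg (shapeGrad K b)]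
  have : gradient (triBubble K a b c) x = _ := hg
  rw [this]
  refine (norm_add_le _ _).trans ?_
  rw [norm_smul, norm_smul, Real.norm_eq_abs, Real.norm_eq_abs, abs_mul, abs_of_nonneg ha0,
    abs_of_nonneg hb0, abs_of_nonneg hc0]
  calc _ ≤ 1 * 1 * G + 1 * (2 * G) := by gcongr
    -- The value `3 G` is enlarged so that `abs_integral_error_le` serves both bubbles.
    _ ≤ 26 * G := by linarith

end IsTri

/-! ### Shape regularity -/

/-- The shape regularity constant in terms of areas. -/
noncomputable def areaConst (γ₀ : ℝ) : ℝ := 4 * γ₀ ^ 2 / Real.pi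

/-- A disk of diameter `d` contained in `K` has area `π d² / 4 ≤ |K|`. This turns the regularity
condition into a comparison of the diameter with the area. -/
theorem inDiam_sq_le (K : Finset Plane) :
    0 ≤ inDiam K ∧ inDiam K ^ 2 ≤ 4 / Real.pi * volume.real (hull K) := by
  have hpi := Real.pi_pos
  have hv : 0 ≤ 4 / Real.pi * volume.real (hull K) := by positivity
  have hb : ∀ d ∈ {d : ℝ | 0 ≤ d ∧ ∃ c : Plane, Metric.closedBall c (d / 2) ⊆ hull K},
      d ≤ √(4 / Real.pi * volume.real (hull K)) := by
    rintro d ⟨hd, c, hc⟩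
    apply Real.le_sqrt_of_sq_le
    have h1 : volume.real (Metric.closedBall c (d / 2)) ≤ volume.real (hull K) :=
      measureReal_mono hc (isCompact_hull K).measure_lt_top.ne
    have h2 : volume.real (Metric.closedBall c (d / 2)) = (d / 2) ^ 2 * Real.pi := by
      rw [measureReal_def, EuclideanSpace.volume_closedBall_fin_two]
      simp [ENNReal.toReal_ofReal (by positivity : 0 ≤ d / 2), hpi.le]
    rw [h2] at h1
    rw [div_mul_eq_mul_div, le_div_iff₀ hpi]
    nlinarith
  have h0 : 0 ≤ inDiam K := Real.sSup_nonneg fun d hd => hd.1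
  refine ⟨h0, ?_⟩
  have := Real.sSup_le hb (Real.sqrt_nonneg _)
  calc inDiam K ^ 2 ≤ √(4 / Real.pi * volume.real (hull K)) ^ 2 := pow_le_pow_left₀ h0 this 2
    _ = _ := Real.sq_sqrt hv

theorem TriMesh.IsRegular.diam_sq_le {T : TriMesh} {γ₀ : ℝ} (h : T.IsRegular γ₀)
    {K : Finset Plane} (hK : K ∈ T.elems) :
    Metric.diam (hull K) ^ 2 ≤ areaConst γ₀ * volume.real (hull K) := by
  obtain ⟨h0, h1⟩ := inDiam_sq_le K
  calc Metric.diam (hull K) ^ 2 ≤ (γ₀ * inDiam K) ^ 2 :=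
        pow_le_pow_left₀ Metric.diam_nonneg (h K hK) 2
    _ = γ₀ ^ 2 * inDiam K ^ 2 := by ring
    _ ≤ γ₀ ^ 2 * (4 / Real.pi * volume.real (hull K)) := by gcongr
    _ = _ := by unfold areaConst; ring

/-! ### Geometry of conforming meshes -/

theorem measurableSet_hull (K : Finset Plane) : MeasurableSet (hull K) :=
  (isCompact_hull K).isClosed.measurableSet

theorem TriMesh.exists_isTri (T : TriMesh) {K : Finset Plane} (hK : K ∈ T.elems) :
    ∃ a b c, IsTri K a b c :=
  HybridFlux.exists_isTri (T.card_eq K hK) (T.indep K hK)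

theorem exists_isTri_of_pair {K : Finset Plane} (h3 : K.card = 3)
    (hK : AffineIndependent ℝ ((↑) : K → Plane)) {a b : Plane} (ha : a ∈ K) (hb : b ∈ K)
    (hab : a ≠ b) : ∃ c, IsTri K a b c := by
  obtain ⟨x, y, z, h⟩ := exists_isTri h3 hK
  rcases (h.mem a).1 ha with rfl | rfl | rfl <;> rcases (h.mem b).1 hb with rfl | rfl | rfl
  · exact absurd rfl hab
  · exact ⟨_, h⟩
  · exact ⟨_, h.flip⟩
  · exact ⟨_, h.swap⟩
  · exact absurd rfl hab
  · exact ⟨_, h.rotate⟩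
  · exact ⟨_, h.rotate.rotate⟩
  · exact ⟨_, h.rotate.swap⟩
  · exact absurd rfl hab

theorem TriMesh.mem_adj {T : TriMesh} {K e : Finset Plane} :
    K ∈ T.adj e ↔ K ∈ T.elems ∧ e ∈ edgesOf K := by
  classical
  simp [TriMesh.adj]

theorem TriMesh.mem_edges {T : TriMesh} {e : Finset Plane} :
    e ∈ T.edges ↔ ∃ K ∈ T.elems, e ∈ edgesOf K := by
  classical
  simp [TriMesh.edges]

open Classical in
theorem TriMesh.exists_isTri_of_mem_adj {T : TriMesh} {K : Finset Plane} {a b : Plane}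
    (hab : a ≠ b) (hK : K ∈ T.adj {a, b}) : ∃ c, IsTri K a b c := by
  obtain ⟨hK, he⟩ := TriMesh.mem_adj.1 hK
  have := (Finset.mem_powersetCard.1 he).1
  exact exists_isTri_of_pair (T.card_eq K hK) (T.indep K hK) (this (by simp)) (this (by simp)) hab

/-- The interior of an element lies in the domain, and the frontier of a convex set is a null set.
-/
theorem hull_le_domain {T : TriMesh} {K : Finset Plane} (hK : K ∈ T.elems) :
    hull K ≤ᵐ[volume] T.domain := by
  have h0 : volume (frontier (hull K)) = 0 := (convex_convexHull ℝ _).addHaar_frontier volume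
  rw [ae_le_set]
  refine measure_mono_null (fun x hx => ?_) h0
  refine ⟨subset_closure hx.1, fun hi => hx.2 ?_⟩
  exact interior_mono (Set.subset_biUnion_of_mem (u := fun K => hull K) hK) hi

theorem restrict_hull_le {T : TriMesh} {K : Finset Plane} (hK : K ∈ T.elems) :
    volume.restrict (hull K) ≤ volume.restrict T.domain :=
  Measure.restrict_mono_ae (hull_le_domain hK)

theorem domain_ae_eq (T : TriMesh) : (T.domain : Set Plane) =ᵐ[volume] ⋃ K : T.elems, hull K := by
  have h : (⋃ K : T.elems, hull (K : Finset Plane)) = ⋃ K ∈ T.elems, hull K := by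
    rw [Set.iUnion_subtype]
  refine Filter.EventuallyLE.antisymm ?_ ?_
  · rw [h]
    exact LE.le.eventuallyLE (interior_subset (X := Plane))
  · have : ∀ K : T.elems, hull (K : Finset Plane) ≤ᵐ[volume] T.domain :=
      fun K => hull_le_domain K.2
    filter_upwards [ae_all_iff.2 this] with x hx hmem
    obtain ⟨K, hxK⟩ := Set.mem_iUnion.1 hmem
    exact hx K hxK

theorem volume_shape_eq_zero {K : Finset Plane} {a b c : Plane} (h : IsTri K a b c) :
    volume {x | shape K a x = 0} = 0 := by
  have h1 : {x | shape K a x = 0} =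
      (((AffineSubspace.mk' (0 : ℝ) ⊥).comap (shape K a) : AffineSubspace ℝ Plane) : Set Plane) := by
    ext x; simp
  rw [h1]
  apply Measure.addHaar_affineSubspace
  intro htop
  have : a ∈ ((AffineSubspace.mk' (0 : ℝ) ⊥).comap (shape K a) : AffineSubspace ℝ Plane) := by
    rw [htop]; trivial
  simp [h.shape_aa] at this

theorem convex_shape_eq_zero (K : Finset Plane) (a : Plane) :
    Convex ℝ {x | shape K a x = 0} :=
  (convex_singleton (𝕜 := ℝ) (0 : ℝ)).affine_preimage (shape K a)

/-- Some vertex `a` of `K` is not in `J`. The shared vertices, hence by conformity the whole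
intersection, lie on the line where `shape K a` vanishes. -/
theorem TriMesh.volume_inter {T : TriMesh} {K J : Finset Plane} (hK : K ∈ T.elems)
    (hJ : J ∈ T.elems) (hne : K ≠ J) : volume (hull K ∩ hull J) = 0 := by
  have : ¬ K ⊆ J := fun hs => hne (Finset.eq_of_subset_of_card_le hs
    (by rw [T.card_eq K hK, T.card_eq J hJ]))
  obtain ⟨a, haK, haJ⟩ := Finset.not_subset.1 this
  obtain ⟨b, c, h⟩ : ∃ b c, IsTri K a b c := by
    obtain ⟨x, y, z, h⟩ := T.exists_isTri hK
    rcases (h.mem a).1 haK with rfl | rfl | rfl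
    exacts [⟨_, _, h⟩, ⟨_, _, h.rotate⟩, ⟨_, _, h.rotate.rotate⟩]
  refine measure_mono_null ((T.conforming K hK J hJ).trans ?_) (volume_shape_eq_zero h)
  refine convexHull_min ?_ (convex_shape_eq_zero K a)
  rintro x ⟨hxK, hxJ⟩
  have hxa : x ≠ a := fun h => haJ (h ▸ hxJ)
  show shape K a x = 0
  rw [shape_apply h.indep a hxK, if_neg hxa]

theorem integral_domain {T : TriMesh} {F : Plane → ℝ} (hF : IntegrableOn F T.domain) :
    ∫ x in T.domain, F x = ∑ K ∈ T.elems, ∫ x in hull K, F x := by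
  rw [setIntegral_congr_set (domain_ae_eq T), integral_iUnion_ae, tsum_fintype,
    Finset.sum_coe_sort T.elems fun K => ∫ x in hull K, F x]
  · exact fun K => (measurableSet_hull _).nullMeasurableSet
  · intro K J hne
    exact T.volume_inter K.2 J.2 fun h => hne (Subtype.ext h)
  · exact hF.congr_set_ae (domain_ae_eq T).symm

theorem isOpen_domain (T : TriMesh) : IsOpen T.domain := isOpen_interior

theorem integral_domain_indicator {T : TriMesh} {K : Finset Plane} (hK : K ∈ T.elems)
    (F : Plane → ℝ) : ∫ x in T.domain, (hull K).indicator F x = ∫ x in hull K, F x := by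
  rw [setIntegral_indicator (measurableSet_hull K)]
  apply setIntegral_congr_set
  refine Filter.EventuallyLE.antisymm (Filter.Eventually.of_forall fun x hx => hx.2) ?_
  filter_upwards [hull_le_domain hK] with x hx h
  exact ⟨hx h, h⟩

/-! ### Elements sharing an edge, and boundary edges -/

open Classical in
-- Two elements with a common edge lie on opposite sides of it. Otherwise a point just off the
-- midpoint of the edge, on their common side, would lie in both of them, while by conformity they
-- meet only in that edge.
theorem outerNormal_adj_aux {T : TriMesh} {K J : Finset Plane} (hK : K ∈ T.elems)
    (hJ : J ∈ T.elems) (hne : K ≠ J) {a b c d : Plane} (h : IsTri K a b c) (h' : IsTri J a b d) :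
    shape K c d < 0 := by
  have hcd : c ≠ d := by
    rintro rfl
    exact hne (by rw [h.eq, h'.eq])
  obtain ⟨s, t, hd⟩ := h.exists_bary d
  have hcross := h'.cross_ne_zero
  have hct : shape K c d = t := by rw [← hd, h.shape_c_bary]
  rw [hct]
  by_contra! ht
  rcases ht.eq_or_lt with ht | ht
  · apply hcross
    rw [← hd, ← ht]
    simp only [baryPoint, cross, PiLp.sub_apply, PiLp.add_apply, PiLp.smul_apply, smul_eq_mul]
    ring
  -- The point with coordinates `((1 - ε) / 2, ε)` in `J` has coordinates `((1 - ε) / 2 + ε s, ε t)`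
  -- in `K`; this `ε` keeps both pairs in the reference triangle.
  · set ε : ℝ := (2 * (1 + |s| + |t|))⁻¹ with hε
    have hpos : 0 < 1 + |s| + |t| := by positivity
    have hε0 : 0 < ε := by positivity
    have hε1 : ε * (1 + |s| + |t|) = 1 / 2 := by rw [hε]; field_simp
    have hs := abs_le.1 (le_refl |s|)
    have htt := abs_le.1 (le_refl |t|)
    have hxe : baryPoint a b d ((1 - ε) / 2) ε =
        baryPoint a b c ((1 - ε) / 2 + ε * s) (ε * t) := by
      rw [← hd]; unfold baryPoint; module
    have h1 : 0 ≤ (1 - ε) / 2 + ε * s := by nlinarith [abs_nonneg s, abs_nonneg t]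
    have h2 : (1 - ε) / 2 + ε * s + ε * t ≤ 1 := by nlinarith [abs_nonneg s, abs_nonneg t]
    have hle : ε ≤ 1 / 2 := by nlinarith [abs_nonneg s, abs_nonneg t]
    have hx1 : baryPoint a b d ((1 - ε) / 2) ε ∈ hull K := by
      rw [hxe]
      exact h.mem_hull_iff.2 ⟨_, _, h1, by positivity, h2, rfl⟩
    have hx2 : baryPoint a b d ((1 - ε) / 2) ε ∈ hull J :=
      h'.mem_hull_iff.2 ⟨_, _, by linarith, hε0.le, by linarith, rfl⟩
    have hx3 := T.conforming K hK J hJ ⟨hx1, hx2⟩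
    have hx4 : convexHull ℝ ((K : Set Plane) ∩ (J : Set Plane)) ⊆ {x | shape J d x = 0} := by
      refine convexHull_min ?_ (convex_shape_eq_zero J d)
      rintro x ⟨hxK, hxJ⟩
      have hxd : x ≠ d := by
        rintro rfl
        rcases (h.mem x).1 hxK with hh | hh | hh
        · exact h'.ac hh.symm
        · exact h'.bc hh.symm
        · exact hcd hh.symm
      show shape J d x = 0
      rw [shape_apply h'.indep d hxJ, if_neg hxd]
    have hx5 : shape J d (baryPoint a b d ((1 - ε) / 2) ε) = 0 := hx4 hx3
    rw [h'.shape_c_bary] at hx5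
    exact hε0.ne' hx5

/-- The functions `shape K c` and `shape J d` both vanish on the line of the edge, so their
gradients are proportional, with factor `shape K c d < 0`. -/
theorem TriMesh.outerNormal_neg {T : TriMesh} {K J e : Finset Plane} (hK : K ∈ T.adj e)
    (hJ : J ∈ T.adj e) (hne : K ≠ J) : outerNormal J e = -outerNormal K e := by
  classical
  obtain ⟨a, b, _, _, hab, rfl⟩ := exists_pair_of_mem_edgesOf (TriMesh.mem_adj.1 hK).2
  obtain ⟨c, h⟩ := T.exists_isTri_of_mem_adj hab hK
  obtain ⟨d, h'⟩ := T.exists_isTri_of_mem_adj hab hJ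
  have ht := outerNormal_adj_aux (TriMesh.mem_adj.1 hK).1 (TriMesh.mem_adj.1 hJ).1 hne h h'
  have hg : shapeGrad K c = shape K c d • shapeGrad J d := by
    refine ext_inner_right ℝ fun z => ?_
    obtain ⟨s, t, hz⟩ := h'.exists_bary (a + z)
    have hz' : z = baryPoint a b d s t - a := by rw [hz]; abel
    rw [real_inner_smul_left, hz', inner_shapeGrad, inner_shapeGrad, affine_baryPoint,
      affine_baryPoint, h.rotate.rotate.shape_ab, h.rotate.rotate.shape_ac,
      h'.rotate.rotate.shape_aa, h'.rotate.rotate.shape_ab, h'.rotate.rotate.shape_ac]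
    ring
  rw [h.outerNormal_eq, h'.outerNormal_eq, hg, norm_smul, Real.norm_eq_abs, abs_of_neg ht,
    smul_smul]
  have : (-shape K c d * ‖shapeGrad J d‖)⁻¹ * shape K c d = -‖shapeGrad J d‖⁻¹ := by
    have := ht.ne
    by_cases h0 : ‖shapeGrad J d‖ = 0
    · simp [h0]
    · field_simp
  rw [this]
  simp

theorem TriMesh.norm_outerNormal {T : TriMesh} {K e : Finset Plane} (hK : K ∈ T.adj e) :
    ‖outerNormal K e‖ = 1 := by
  classical
  obtain ⟨a, b, _, _, hab, rfl⟩ := exists_pair_of_mem_edgesOf (TriMesh.mem_adj.1 hK).2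
  obtain ⟨c, h⟩ := T.exists_isTri_of_mem_adj hab hK
  exact (outerNormal_spec h.ab h.ac h.bc K _ h.mem (by simp) h.indep).1

/-- Three unit normals cannot be pairwise opposite. -/
theorem TriMesh.card_adj_le (T : TriMesh) (e : Finset Plane) : (T.adj e).card ≤ 2 := by
  by_contra! h
  obtain ⟨K, hK, J, hJ, I, hI, h1, h2, h3⟩ := Finset.two_lt_card.1 h
  have e1 := TriMesh.outerNormal_neg hK hJ h1
  have e2 := TriMesh.outerNormal_neg hK hI h2
  have e3 := TriMesh.outerNormal_neg hJ hI h3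
  rw [e1, neg_neg] at e3
  have : outerNormal I e = 0 := by
    have : outerNormal I e = -outerNormal I e := by rw [← e3] at e2; exact e2
    have h2 : (2 : ℝ) • outerNormal I e = 0 := by
      rw [two_smul]
      nth_rewrite 1 [this]
      exact neg_add_cancel _
    simpa using h2
  have hn := TriMesh.norm_outerNormal hI
  rw [this] at hn
  simp at hn

open Classical in
-- Conformity passes from elements to their faces: for affinely independent points, the hulls of two
-- subsets meet in the hull of the common points. This is used once in `K` and once in `J`.
theorem hull_inter_hull_subset {T : TriMesh} {K J e e' : Finset Plane} (hK : K ∈ T.elems)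
    (hJ : J ∈ T.elems) (he : e ⊆ K) (he' : e' ⊆ J) : hull e ∩ hull e' ⊆ hull (e ∩ e') := by
  rintro x ⟨hx, hx'⟩
  unfold hull at *
  have h1 : x ∈ convexHull ℝ ((K ∩ J : Finset Plane) : Set Plane) := by
    rw [Finset.coe_inter]
    exact T.conforming K hK J hJ ⟨convexHull_mono (Finset.coe_subset.2 he) hx,
      convexHull_mono (Finset.coe_subset.2 he') hx'⟩
  have h2 : x ∈ convexHull ℝ ((e ∩ (K ∩ J) : Finset Plane) : Set Plane) := by
    rw [Finset.coe_inter, (T.indep K hK).convexHull_inter he Finset.inter_subset_left]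
    exact ⟨hx, h1⟩
  have h3 : x ∈ convexHull ℝ (((e ∩ (K ∩ J)) ∩ e' : Finset Plane) : Set Plane) := by
    rw [Finset.coe_inter, (T.indep J hJ).convexHull_inter
      (Finset.inter_subset_right.trans Finset.inter_subset_right) he']
    exact ⟨h2, hx'⟩
  refine convexHull_mono ?_ h3
  intro y hy
  simp only [Finset.coe_inter, Set.mem_inter_iff, Finset.mem_coe] at hy ⊢
  exact ⟨hy.1.1, hy.2⟩

theorem edgeMeasure_singleton (e : Finset Plane) (x : Plane) : edgeMeasure e {x} = 0 := by
  have := Measure.nullSingletonClass_hausdorff Plane (d := 1) zero_lt_one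
  exact measure_mono_null (Set.Subset.refl _)
    (Measure.absolutelyContinuous_of_le Measure.restrict_le_self (measure_singleton x))

/-- Distinct edges share at most one vertex, and arc length has no atoms. -/
theorem TriMesh.ae_notMem_hull {T : TriMesh} {e e' : Finset Plane} (he : e ∈ T.edges)
    (he' : e' ∈ T.edges) (hne : e ≠ e') : ∀ᵐ x ∂(edgeMeasure e'), x ∉ hull e := by
  classical
  obtain ⟨K, hK, heK⟩ := TriMesh.mem_edges.1 he
  obtain ⟨J, hJ, heJ⟩ := TriMesh.mem_edges.1 he'
  rw [edgesOf, Finset.mem_powersetCard] at heK heJ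
  have hcard : (e ∩ e').card ≤ 1 := by
    by_contra! h2
    have h3 : e ∩ e' = e := Finset.eq_of_subset_of_card_le Finset.inter_subset_left (by omega)
    have h4 : e ∩ e' = e' := Finset.eq_of_subset_of_card_le Finset.inter_subset_right (by omega)
    exact hne (h3.symm.trans h4)
  have hz : edgeMeasure e' (hull (e ∩ e')) = 0 := by
    rcases Finset.card_le_one_iff_subset_singleton.1 hcard with ⟨y, hy⟩
    refine measure_mono_null ?_ (edgeMeasure_singleton e' y)
    refine convexHull_min ?_ (convex_singleton y)
    exact_mod_cast hy
  have hsub := hull_inter_hull_subset hK hJ heK.1 heJ.1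
  filter_upwards [ae_edgeMeasure_mem e', measure_eq_zero_iff_ae_notMem.1 hz] with x h1 h2 h3
  exact h2 (hsub ⟨h3, h1⟩)

theorem TriMesh.mem_boundaryEdges {T : TriMesh} {e : Finset Plane} :
    e ∈ T.boundaryEdges ↔ e ∈ T.edges ∧ (T.adj e).card = 1 := by
  classical
  simp [TriMesh.boundaryEdges]

open Classical in
-- Moving from `x` in the direction `-(c - a)` makes `shape K c` negative at once.
theorem IsTri.hull_notMem_nhds {K : Finset Plane} {a b c x : Plane} (h : IsTri K a b c)
    (hx : x ∈ hull {a, b}) : hull K ∉ nhds x := by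
  intro hnhds
  have htend : Filter.Tendsto (fun ε : ℝ => x - ε • (c - a)) (nhdsWithin 0 (Set.Ioi 0))
      (nhds x) := by
    have : Filter.Tendsto (fun ε : ℝ => x - ε • (c - a)) (nhds 0) (nhds (x - (0 : ℝ) • (c - a))) :=
      (Continuous.tendsto (by fun_prop) _)
    rw [zero_smul, sub_zero] at this
    exact this.mono_left nhdsWithin_le_nhds
  obtain ⟨ε, hε1, hε2⟩ := ((htend.eventually hnhds).and self_mem_nhdsWithin).exists
  have h1 := (h.rotate.rotate.shape_mem_Icc hε1).1
  have h2 := inner_shapeGrad K c (x - ε • (c - a)) x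
  have h3 := inner_shapeGrad K c c a
  rw [h.rotate.rotate.shape_aa, h.rotate.rotate.shape_ab] at h3
  rw [h.shape_edge hx, show x - ε • (c - a) - x = -(ε • (c - a)) by abel, inner_neg_right,
    real_inner_smul_right, h3] at h2
  have : (0 : ℝ) < ε := hε2
  linarith

/-- Apart from its endpoints, a boundary edge meets no element but its own `K`. If such a point were
interior to the domain, `K` alone would be a neighbourhood of it. Consequently, test functions
supported in the domain do not see the boundary terms of Green's formula. -/
theorem TriMesh.ae_notMem_domain {T : TriMesh} {e : Finset Plane} (he : e ∈ T.boundaryEdges) :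
    ∀ᵐ x ∂(edgeMeasure e), x ∉ T.domain := by
  classical
  obtain ⟨he, hcard⟩ := TriMesh.mem_boundaryEdges.1 he
  obtain ⟨K, hadj⟩ := Finset.card_eq_one.1 hcard
  have hKadj : K ∈ T.adj e := by rw [hadj]; simp
  obtain ⟨hK, heK⟩ := TriMesh.mem_adj.1 hKadj
  obtain ⟨a, b, _, _, hab, rfl⟩ := exists_pair_of_mem_edgesOf heK
  obtain ⟨c, h⟩ := T.exists_isTri_of_mem_adj hab hKadj
  have heK' := (Finset.mem_powersetCard.1 heK).1
  filter_upwards [ae_edgeMeasure_mem {a, b},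
    measure_eq_zero_iff_ae_notMem.1 (edgeMeasure_singleton {a, b} a),
    measure_eq_zero_iff_ae_notMem.1 (edgeMeasure_singleton {a, b} b)] with x hx hxa hxb hdom
  have hJ : ∀ J ∈ T.elems, J ≠ K → x ∉ hull J := by
    intro J hJ hJK hxJ
    have h1 := hull_inter_hull_subset hK hJ heK' (Finset.Subset.refl J) ⟨hx, hxJ⟩
    by_cases hsub : ({a, b} : Finset Plane) ⊆ J
    · have : J ∈ T.adj {a, b} :=
        TriMesh.mem_adj.2 ⟨hJ, Finset.mem_powersetCard.2 ⟨hsub, Finset.card_pair hab⟩⟩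
      rw [hadj] at this
      exact hJK (Finset.mem_singleton.1 this)
    · have hor : ({a, b} ∩ J ⊆ ({a} : Finset Plane)) ∨ ({a, b} ∩ J ⊆ ({b} : Finset Plane)) := by
        by_cases haJ : a ∈ J
        · left
          intro y hy
          rw [Finset.mem_inter, Finset.mem_insert, Finset.mem_singleton] at hy
          rcases hy.1 with rfl | rfl
          · simp
          · exact absurd (Finset.insert_subset haJ (Finset.singleton_subset_iff.2 hy.2)) hsub
        · right
          intro y hy
          rw [Finset.mem_inter, Finset.mem_insert, Finset.mem_singleton] at hy
          rcases hy.1 with rfl | rfl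
          · exact absurd hy.2 haJ
          · simp
      rcases hor with hor | hor
      · exact hxa (convexHull_min (by exact_mod_cast hor) (convex_singleton a) h1)
      · exact hxb (convexHull_min (by exact_mod_cast hor) (convex_singleton b) h1)
  have hclosed : IsClosed (⋃ J ∈ T.elems.erase K, hull J) :=
    Set.Finite.isClosed_biUnion (Finset.finite_toSet _) fun J _ => (isCompact_hull J).isClosed
  have hnot : x ∉ ⋃ J ∈ T.elems.erase K, hull J := by
    simp only [Set.mem_iUnion, not_exists]
    intro J hJm
    rw [Finset.mem_erase] at hJm
    exact hJ J hJm.2 hJm.1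
  have hnhds : hull K ∈ nhds x := by
    filter_upwards [hclosed.isOpen_compl.mem_nhds hnot, (isOpen_domain T).mem_nhds hdom]
      with y hy1 hy2
    have hy3 := interior_subset hy2
    simp only [Set.mem_iUnion] at hy3
    obtain ⟨J, hJm, hyJ⟩ := hy3
    by_cases hJK : J = K
    · exact hJK ▸ hyJ
    · exact absurd (Set.mem_biUnion (Finset.mem_coe.2 (Finset.mem_erase.2 ⟨hJK, hJm⟩)) hyJ) hy1
  exact h.hull_notMem_nhds hx hnhds

/-- In a shape regular mesh, the number of elements that share a vertex is bounded. -/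
theorem TriMesh.card_vertex_le {T : TriMesh} {M : ℝ} (hM0 : 0 < M)
    (hM : ∀ K ∈ T.elems, Metric.diam (hull K) ^ 2 ≤ M * volume.real (hull K)) (i : Plane)
    (P : Finset (Finset Plane)) (hP : ∀ K ∈ P, K ∈ T.elems ∧ i ∈ K) :
    (P.card : ℝ) ≤ Real.pi * M := by
  have hpi := Real.pi_pos
  rcases P.eq_empty_or_nonempty with rfl | hne
  · simp only [Finset.card_empty, Nat.cast_zero]
    positivity
  have hdiam : ∀ K ∈ P, 0 < Metric.diam (hull K) := by
    intro K hK
    obtain ⟨a, b, c, h⟩ := T.exists_isTri (hP K hK).1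
    exact (norm_pos_iff.2 (sub_ne_zero.2 h.ab.symm)).trans_le h.norm_sub_le_diam
  obtain ⟨K₀, hK₀, hmin⟩ := P.exists_min_image (fun K => Metric.diam (hull K)) hne
  set r := Metric.diam (hull K₀) with hr
  have hr0 : 0 < r := hdiam K₀ hK₀
  -- Each element is shrunk towards `i` to the smallest diameter `r`. The copies stay in their
  -- elements, so they overlap in null sets; they have area at least `r² / M` and lie in a disk of
  -- area `π r²`.
  set S : Finset Plane → Set Plane := fun K =>
    AffineMap.homothety i (r / Metric.diam (hull K)) '' hull K with hS
  have hi : ∀ K ∈ P, i ∈ hull K := fun K hK => subset_convexHull ℝ _ (hP K hK).2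
  have hsub : ∀ K ∈ P, S K ⊆ hull K := by
    rintro K hK _ ⟨x, hx, rfl⟩
    rw [AffineMap.homothety_eq_lineMap]
    have h1 : r / Metric.diam (hull K) ∈ Set.Icc (0 : ℝ) 1 :=
      ⟨by positivity, (div_le_one (hdiam K hK)).2 (hmin K hK)⟩
    exact (convex_convexHull ℝ _).segment_subset (hi K hK) hx
      (segment_eq_image_lineMap ℝ i x ▸ Set.mem_image_of_mem _ h1)
  have hball : ∀ K ∈ P, S K ⊆ Metric.closedBall i r := by
    rintro K hK _ ⟨x, hx, rfl⟩
    have h0 := hdiam K hK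
    have h1 : dist i x ≤ Metric.diam (hull K) :=
      Metric.dist_le_diam_of_mem (isCompact_hull K).isBounded (hi K hK) hx
    rw [Metric.mem_closedBall, dist_homothety_center, Real.norm_of_nonneg (by positivity)]
    calc r / Metric.diam (hull K) * dist i x ≤ r / Metric.diam (hull K) * Metric.diam (hull K) := by
          gcongr
      _ = r := div_mul_cancel₀ _ h0.ne'
  have hcompact : ∀ K, IsCompact (S K) := fun K =>
    (isCompact_hull K).image (AffineMap.homothety_continuous i _)
  have hvol : ∀ K ∈ P, ENNReal.ofReal (r ^ 2 / M) ≤ volume (S K) := by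
    intro K hK
    have h0 := hdiam K hK
    have hlt := (isCompact_hull K).measure_lt_top (μ := (volume : Measure Plane))
    rw [hS]
    simp only [Measure.addHaar_image_homothety, finrank_euclideanSpace, Fintype.card_fin]
    rw [← ENNReal.ofReal_toReal hlt.ne, ← ENNReal.ofReal_mul (by positivity)]
    apply ENNReal.ofReal_le_ofReal
    have h1 := hM K (hP K hK).1
    rw [measureReal_def] at h1
    rw [abs_of_nonneg (by positivity), div_pow, div_mul_eq_mul_div, div_le_div_iff₀ hM0 (by positivity)]
    nlinarith [sq_nonneg r]
  have hsum : ∑ K ∈ P, volume (S K) ≤ volume (Metric.closedBall i r) := by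
    rw [← measure_biUnion_finset₀ (s := P) (f := S)]
    · exact measure_mono (Set.iUnion₂_subset hball)
    · intro K hK J hJ hKJ
      exact measure_mono_null (Set.inter_subset_inter (hsub K hK) (hsub J hJ))
        (T.volume_inter (hP K hK).1 (hP J hJ).1 hKJ)
    · exact fun K _ => (hcompact K).isClosed.measurableSet.nullMeasurableSet
  have h1 : (P.card : ENNReal) * ENNReal.ofReal (r ^ 2 / M) ≤ ENNReal.ofReal (r ^ 2 * Real.pi) := by
    calc (P.card : ENNReal) * ENNReal.ofReal (r ^ 2 / M)
        = ∑ K ∈ P, ENNReal.ofReal (r ^ 2 / M) := by simp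
      _ ≤ ∑ K ∈ P, volume (S K) := Finset.sum_le_sum hvol
      _ ≤ volume (Metric.closedBall i r) := hsum
      _ = ENNReal.ofReal (r ^ 2 * Real.pi) := by
        rw [EuclideanSpace.volume_closedBall_fin_two, ENNReal.ofReal_mul (by positivity),
          ENNReal.ofReal_pow hr0.le]
  rw [← ENNReal.ofReal_natCast, ← ENNReal.ofReal_mul (by positivity),
    ENNReal.ofReal_le_ofReal_iff (by positivity)] at h1
  have h2 : 0 < r ^ 2 := by positivity
  rw [← mul_div_assoc, div_le_iff₀ hM0] at h1
  nlinarith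

/-! ### Square integrable fields and diffusion tensors -/

theorem integrable_inner_of_memLp {μ : Measure Plane} {F G : Plane → Plane} (hF : MemLp F 2 μ)
    (hG : MemLp G 2 μ) : Integrable (fun x => ⟪F x, G x⟫) μ := by
  have h1 := (memLp_two_iff_integrable_sq_norm hF.1).1 hF
  have h2 := (memLp_two_iff_integrable_sq_norm hG.1).1 hG
  refine (h1.add h2).mono' (hF.1.inner hG.1) (Filter.Eventually.of_forall fun x => ?_)
  refine (norm_inner_le_norm _ _).trans ?_
  simp only [Pi.add_apply]
  nlinarith [sq_nonneg (‖F x‖ - ‖G x‖), sq_nonneg ‖F x‖, sq_nonneg ‖G x‖]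

theorem memLp_hull_of_continuous {E : Type*} [NormedAddCommGroup E]
    [SecondCountableTopologyEither Plane E] (K : Finset Plane) {F : Plane → E}
    (hF : Continuous F) : MemLp F 2 (volume.restrict (hull K)) := by
  have : IsFiniteMeasure (volume.restrict (hull K)) :=
    ⟨by rw [Measure.restrict_apply_univ]; exact (isCompact_hull K).measure_lt_top⟩
  obtain ⟨C, hC⟩ := (isCompact_hull K).exists_bound_of_continuousOn hF.continuousOn
  refine MemLp.of_bound hF.aestronglyMeasurable C ?_
  exact (ae_restrict_mem (measurableSet_hull K)).mono fun x hx => hC x hx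

theorem memLp_domain {E : Type*} [NormedAddCommGroup E] {T : TriMesh} {F : Plane → E}
    (h : ∀ K ∈ T.elems, MemLp F 2 (volume.restrict (hull K))) :
    MemLp F 2 (volume.restrict T.domain) := by
  rw [Measure.restrict_congr_set (domain_ae_eq T)]
  have hm : AEStronglyMeasurable F (volume.restrict (⋃ K : T.elems, hull (K : Finset Plane))) :=
    aestronglyMeasurable_iUnion_iff.2 fun K => (h K K.2).1
  rw [memLp_two_iff_integrable_sq_norm hm]
  exact integrableOn_finite_iUnion.2 fun K =>
    (memLp_two_iff_integrable_sq_norm (h K K.2).1).1 (h K K.2)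

/-- Evaluate the nonnegative quadratic form at `ξ - m⁻¹ L ξ` and bound its term in `L ξ` by the
upper estimate. This gives the sharp constant `m` without spectral theory. -/
theorem norm_sq_le_of_symm {L : Plane →L[ℝ] Plane} {m : ℝ} (hm : 0 < m)
    (hs : ∀ ξ η : Plane, ⟪L ξ, η⟫ = ⟪ξ, L η⟫) (h0 : ∀ ξ : Plane, 0 ≤ ⟪L ξ, ξ⟫)
    (h1 : ∀ ξ : Plane, ⟪L ξ, ξ⟫ ≤ m * ‖ξ‖ ^ 2) (ξ : Plane) : ‖L ξ‖ ^ 2 ≤ m * ⟪L ξ, ξ⟫ := by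
  have h2 := h0 (ξ - m⁻¹ • L ξ)
  have h3 := h1 (L ξ)
  have e : ⟪L (ξ - m⁻¹ • L ξ), ξ - m⁻¹ • L ξ⟫ =
      ⟪L ξ, ξ⟫ - 2 * m⁻¹ * ‖L ξ‖ ^ 2 + m⁻¹ ^ 2 * ⟪L (L ξ), L ξ⟫ := by
    rw [map_sub, map_smul]
    simp only [inner_sub_left, inner_sub_right, real_inner_smul_left, real_inner_smul_right]
    rw [hs (L ξ) ξ, real_inner_self_eq_norm_sq]
    ring
  rw [e] at h2
  have h4 : m⁻¹ ^ 2 * ⟪L (L ξ), L ξ⟫ ≤ m⁻¹ * ‖L ξ‖ ^ 2 := by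
    calc m⁻¹ ^ 2 * ⟪L (L ξ), L ξ⟫ ≤ m⁻¹ ^ 2 * (m * ‖L ξ‖ ^ 2) := by gcongr
      _ = _ := by field_simp
  have h5 : m⁻¹ * ‖L ξ‖ ^ 2 ≤ ⟪L ξ, ξ⟫ := by linarith
  rwa [inv_mul_le_iff₀ hm] at h5

namespace IsDiffusionTensor

variable {U : Set Plane} {aMin aMax : ℝ} {A : Plane → Plane →L[ℝ] Plane}

theorem mono {S : Set Plane} (h : IsDiffusionTensor U aMin aMax A)
    (hS : volume.restrict S ≤ volume.restrict U) : IsDiffusionTensor S aMin aMax A :=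
  ⟨h.meas.mono_measure hS, ae_mono hS h.symm, ae_mono hS h.lower, ae_mono hS h.upper⟩

theorem ae_nonneg (h : IsDiffusionTensor U aMin aMax A) (h0 : 0 < aMin) :
    ∀ᵐ x ∂(volume.restrict U), ∀ ξ : Plane, 0 ≤ ⟪A x ξ, ξ⟫ := by
  filter_upwards [h.lower] with x hx ξ
  exact (by positivity : 0 ≤ aMin * ‖ξ‖ ^ 2).trans (hx ξ)

theorem ae_norm_sq_le (h : IsDiffusionTensor U aMin aMax A) (h0 : 0 < aMin) (h1 : aMin ≤ aMax) :
    ∀ᵐ x ∂(volume.restrict U), ∀ ξ : Plane, ‖A x ξ‖ ^ 2 ≤ aMax * ⟪A x ξ, ξ⟫ := by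
  filter_upwards [h.ae_nonneg h0, h.symm, h.upper] with x hx hs hu ξ
  exact norm_sq_le_of_symm (h0.trans_le h1) hs hx hu ξ

theorem memLp (h : IsDiffusionTensor U aMin aMax A) (h0 : 0 < aMin) (h1 : aMin ≤ aMax)
    {G : Plane → Plane} (hG : MemLp G 2 (volume.restrict U)) :
    MemLp (fun x => A x (G x)) 2 (volume.restrict U) := by
  have hm : AEStronglyMeasurable (fun x => A x (G x)) (volume.restrict U) :=
    (isBoundedBilinearMap_apply (𝕜 := ℝ) (E := Plane) (F := Plane)).continuous.comp_aestronglyMeasurable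
      (h.meas.prodMk hG.1)
  have hmax : 0 < aMax := h0.trans_le h1
  refine hG.of_le_mul (c := aMax) hm ?_
  filter_upwards [h.ae_norm_sq_le h0 h1, h.upper] with x h2 h3
  refine le_of_sq_le_sq ?_ (by positivity)
  calc ‖A x (G x)‖ ^ 2 ≤ aMax * ⟪A x (G x), G x⟫ := h2 _
    _ ≤ aMax * (aMax * ‖G x‖ ^ 2) := by gcongr; exact h3 _
    _ = _ := by ring

theorem ae_inverse (h : IsDiffusionTensor U aMin aMax A) (h0 : 0 < aMin) :
    ∀ᵐ x ∂(volume.restrict U), ∀ p : Plane, 0 ≤ ⟪(A x).inverse p, p⟫ ∧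
      ⟪(A x).inverse p, p⟫ ≤ aMin⁻¹ * ‖p‖ ^ 2 := by
  filter_upwards [h.lower] with x hx p
  -- Coercivity gives invertibility in finite dimension, so `inverse` is the true inverse and not
  -- its default value `0`.
  have hinj : Function.Injective (A x) := by
    rw [injective_iff_map_eq_zero]
    intro ξ hξ
    have := hx ξ
    rw [hξ, inner_zero_left] at this
    have h2 : ‖ξ‖ ^ 2 = 0 := le_antisymm (by nlinarith) (by positivity)
    simpa using h2
  let E : Plane ≃L[ℝ] Plane :=
    (LinearEquiv.ofInjectiveEndo (A x : Plane →ₗ[ℝ] Plane) hinj).toContinuousLinearEquiv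
  have hE : (E : Plane →L[ℝ] Plane) = A x := by ext1 ξ; rfl
  rw [← hE, ContinuousLinearMap.inverse_equiv]
  set ξ := E.symm p with hξ
  have hp : A x ξ = p := by rw [← hE]; simp [hξ]
  have h2 := hx ξ
  have h3 : ((E.symm : Plane →L[ℝ] Plane) p) = ξ := rfl
  rw [h3, real_inner_comm]
  rw [hp] at h2
  refine ⟨(by positivity : 0 ≤ aMin * ‖ξ‖ ^ 2).trans h2, ?_⟩
  have h4 : ⟪p, ξ⟫ ≤ ‖p‖ * ‖ξ‖ := real_inner_le_norm p ξ
  have h5 : aMin * ‖ξ‖ ≤ ‖p‖ := by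
    by_contra! hlt
    have : 0 < ‖ξ‖ := by
      by_contra! h0'
      have : ‖ξ‖ = 0 := le_antisymm h0' (norm_nonneg _)
      rw [this, mul_zero] at hlt
      exact absurd hlt (not_lt.2 (norm_nonneg _))
    nlinarith
  have h6 : ‖ξ‖ ≤ aMin⁻¹ * ‖p‖ := by rwa [le_inv_mul_iff₀ h0]
  calc ⟪p, ξ⟫ ≤ ‖p‖ * ‖ξ‖ := h4
    _ ≤ ‖p‖ * (aMin⁻¹ * ‖p‖) := by gcongr
    _ = _ := by ring

end IsDiffusionTensor

/-! ### Broken test functions -/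

theorem integral_domain_sum_indicator {T : TriMesh} {F : Finset Plane → Plane → ℝ}
    (hF : ∀ K ∈ T.elems, IntegrableOn (F K) (hull K)) :
    ∫ x in T.domain, ∑ K ∈ T.elems, (hull K).indicator (F K) x =
      ∑ K ∈ T.elems, ∫ x in hull K, F K x := by
  rw [integral_finsetSum]
  · exact Finset.sum_congr rfl fun K hK => integral_domain_indicator hK _
  · intro K hK
    exact ((integrable_indicator_iff (measurableSet_hull K)).2 (hF K hK)).integrableOn

/-- The function equal to `w K` on each element `K`. -/
noncomputable def brokenVal (T : TriMesh) (w : Finset Plane → Plane → ℝ) (x : Plane) : ℝ :=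
  -- Where elements touch, several terms add up; this happens on a null set only.
  ∑ K ∈ T.elems, (hull K).indicator (w K) x

/-- The field equal to the gradient of `w K` on each element `K`. -/
noncomputable def brokenGrad (T : TriMesh) (w : Finset Plane → Plane → ℝ) (x : Plane) : Plane :=
  ∑ K ∈ T.elems, (hull K).indicator (gradient (w K)) x

theorem continuous_gradient {w : Plane → ℝ} (hw : ContDiff ℝ ∞ w) : Continuous (gradient w) := by
  unfold gradient
  exact (InnerProductSpace.toDual ℝ Plane).symm.continuous.comp (hw.continuous_fderiv (by simp))

section Broken

variable {T : TriMesh} {w : Finset Plane → Plane → ℝ}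

theorem memLp_brokenVal (hw : ∀ K, ContDiff ℝ ∞ (w K)) :
    MemLp (brokenVal T w) 2 (volume.restrict T.domain) := by
  unfold brokenVal
  refine memLp_finsetSum _ fun K hK => ?_
  refine MemLp.restrict _ ?_
  exact (memLp_indicator_iff_restrict (measurableSet_hull K)).2
    (memLp_hull_of_continuous K (hw K).continuous)

theorem memLp_brokenGrad (hw : ∀ K, ContDiff ℝ ∞ (w K)) :
    MemLp (brokenGrad T w) 2 (volume.restrict T.domain) := by
  unfold brokenGrad
  refine memLp_finsetSum _ fun K hK => ?_
  refine MemLp.restrict _ ?_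
  exact (memLp_indicator_iff_restrict (measurableSet_hull K)).2
    (memLp_hull_of_continuous K (continuous_gradient (hw K)))

theorem integral_inner_brokenGrad (hw : ∀ K, ContDiff ℝ ∞ (w K))
    {G : Plane → Plane}
    (hG : ∀ K ∈ T.elems, MemLp G 2 (volume.restrict (hull K))) :
    ∫ x in T.domain, ⟪G x, brokenGrad T w x⟫ =
      ∑ K ∈ T.elems, ∫ x in hull K, ⟪G x, gradient (w K) x⟫ := by
  rw [← integral_domain_sum_indicator]
  · congr 1
    ext x
    rw [brokenGrad, inner_sum]
    refine Finset.sum_congr rfl fun K _ => ?_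
    by_cases hx : x ∈ hull K <;> simp [hx]
  · exact fun K hK => integrable_inner_of_memLp (hG K hK)
      (memLp_hull_of_continuous K (continuous_gradient (hw K)))

theorem integral_mul_brokenVal {F : Plane → ℝ}
    (hF : ∀ K ∈ T.elems, IntegrableOn (fun x => F x * w K x) (hull K)) :
    ∫ x in T.domain, F x * brokenVal T w x = ∑ K ∈ T.elems, ∫ x in hull K, F x * w K x := by
  rw [← integral_domain_sum_indicator hF]
  congr 1
  ext x
  rw [brokenVal, Finset.mul_sum]
  refine Finset.sum_congr rfl fun K _ => ?_
  by_cases hx : x ∈ hull K <;> simp [hx]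

theorem integral_broken_green (hw : ∀ K, ContDiff ℝ ∞ (w K))
    {ψ : Plane → ℝ} (hψ : ContDiff ℝ ∞ ψ) (z : Plane) :
    ∫ x in T.domain, (brokenVal T w x * fderiv ℝ ψ x z + ⟪brokenGrad T w x, z⟫ * ψ x) =
      ∑ K ∈ T.elems, ∑ e ∈ edgesOf K,
        ∫ x, w K x * ψ x * ⟪z, outerNormal K e⟫ ∂(edgeMeasure e) := by
  have hd : ∀ K x, fderiv ℝ (fun y => w K y * ψ y) x z =
      w K x * fderiv ℝ ψ x z + ⟪gradient (w K) x, z⟫ * ψ x := by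
    intro K x
    rw [fderiv_fun_mul ((hw K).differentiable (by simp) x) (hψ.differentiable (by simp) x),
      inner_gradient_left]
    simp
    ring
  have hs : ∀ x, brokenVal T w x * fderiv ℝ ψ x z + ⟪brokenGrad T w x, z⟫ * ψ x =
      ∑ K ∈ T.elems, (hull K).indicator (fun y => fderiv ℝ (fun y => w K y * ψ y) y z) x := by
    intro x
    rw [brokenVal, brokenGrad, sum_inner, Finset.sum_mul, Finset.sum_mul, ← Finset.sum_add_distrib]
    refine Finset.sum_congr rfl fun K _ => ?_
    by_cases hx : x ∈ hull K <;> simp [hx, hd]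
  have hc : ∀ K, ContDiff ℝ ∞ fun y => w K y * ψ y := fun K => (hw K).mul hψ
  simp only [hs]
  rw [integral_domain_sum_indicator]
  · refine Finset.sum_congr rfl fun K hK => ?_
    obtain ⟨a, b, c, h⟩ := T.exists_isTri hK
    exact h.integral_fderiv ((hc K).of_le (by simp)) z
  · intro K _
    have := (hc K).continuous_fderiv (by simp)
    exact (Continuous.continuousOn (by fun_prop)).integrableOn_compact (isCompact_hull K)

/-- A function that is smooth on each element and satisfies Green's formula with the trace `t`
belongs to `H¹(Ω)`. -/
theorem exists_H1_of_broken (hw : ∀ K, ContDiff ℝ ∞ (w K))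
    {t : Plane → ℝ}
    (ht : ∀ e ∈ T.boundaryEdges, MemLp t 2 (edgeMeasure e))
    (hG : ∀ ψ : Plane → ℝ, ContDiff ℝ ∞ ψ → ∀ z : Plane,
      ∑ K ∈ T.elems, ∑ e ∈ edgesOf K,
        ∫ x, w K x * ψ x * ⟪z, outerNormal K e⟫ ∂(edgeMeasure e) =
      ∑ e ∈ T.boundaryEdges, ∑ K ∈ T.adj e,
        ∫ x, t x * ψ x * ⟪z, outerNormal K e⟫ ∂(edgeMeasure e)) :
    ∃ v : H1 T.domain, v.val = brokenVal T w ∧ v.grad = brokenGrad T w ∧ IsTrace T v t := by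
  have hweak : HasWeakGradient T.domain (brokenVal T w) (brokenGrad T w) := by
    intro ψ hψ hcs hsupp z
    have h1 := integral_broken_green (T := T) hw hψ z
    rw [hG ψ hψ z] at h1
    -- The test function is supported in the open domain, which almost every boundary point avoids,
    -- so Green's formula reduces to the definition of the weak gradient.
    have h2 : ∑ e ∈ T.boundaryEdges, ∑ K ∈ T.adj e,
        ∫ x, t x * ψ x * ⟪z, outerNormal K e⟫ ∂(edgeMeasure e) = 0 := by
      refine Finset.sum_eq_zero fun e he => Finset.sum_eq_zero fun K _ => ?_
      rw [integral_eq_zero_of_ae]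
      filter_upwards [TriMesh.ae_notMem_domain he] with x hx
      rw [image_eq_zero_of_notMem_tsupport fun h => hx (hsupp h)]
      simp
    have hdψ : Continuous fun x => fderiv ℝ ψ x z := by
      have := hψ.continuous_fderiv (by simp)
      fun_prop
    have hL1 : ∀ {F : Plane → ℝ}, Continuous F → MemLp F 2 (volume.restrict T.domain) :=
      fun hF => memLp_domain fun K _ => memLp_hull_of_continuous K hF
    rw [h2, integral_add] at h1
    · linarith
    · exact (memLp_brokenVal hw).integrable_mul (hL1 hdψ)
    · exact ((memLp_brokenGrad hw).inner_const z).integrable_mul (hL1 hψ.continuous)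
  refine ⟨⟨brokenVal T w, brokenGrad T w, memLp_brokenVal hw, memLp_brokenGrad hw, hweak⟩, rfl, rfl,
    ht, fun ψ hψ z => ?_⟩
  rw [← hG ψ hψ z]
  exact integral_broken_green hw hψ z

end Broken

/-! ### Residual bounds -/

/-- The data of the diffusion problem and of its approximation, with the regularity of the mesh
expressed by areas. -/
structure IsSetting (T : TriMesh) (ΓD : Finset (Finset Plane)) (aMin aMax M : ℝ)
    (A : Plane → Plane →L[ℝ] Plane) (f g : Plane → ℝ) (u : H1 T.domain) (uh : Plane → ℝ)
    (qn : Finset Plane → Finset Plane → ℝ) : Prop where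
  aMin_pos : 0 < aMin
  aMin_le : aMin ≤ aMax
  area : ∀ K ∈ T.elems, Metric.diam (hull K) ^ 2 ≤ M * volume.real (hull K)
  subset : ΓD ⊆ T.boundaryEdges
  tensor : IsDiffusionTensor T.domain aMin aMax A
  weak : IsWeakSolution T ΓD A f g u
  affine : ∀ K ∈ T.elems, ∃ l : Plane →ᵃ[ℝ] ℝ, ∀ x ∈ hull K, uh x = l x
  flux : ∀ K ∈ T.elems, HasNormalTrace K (feFlux A uh) (fun _ => 0) (fun e _ => qn K e)
  const : IsElementwiseConstant T f
  edgewise : IsEdgewiseAffine (T.neumannEdges ΓD) g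

/-- The energy of the error on the element `K`. -/
noncomputable def elemError (A : Plane → Plane →L[ℝ] Plane) (G : Plane → Plane) (uh : Plane → ℝ)
    (K : Finset Plane) : ℝ :=
  ∫ x in hull K, ⟪A x (G x - gradient uh x), G x - gradient uh x⟫

theorem ae_gradient_eq {K : Finset Plane} {uh : Plane → ℝ} {l : Plane →ᵃ[ℝ] ℝ}
    (h : ∀ x ∈ hull K, uh x = l x) :
    ∃ z : Plane, ∀ᵐ x ∂(volume.restrict (hull K)), gradient uh x = z := by
  have h0 : volume (frontier (hull K)) = 0 := (convex_convexHull ℝ _).addHaar_frontier volume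
  refine ⟨(InnerProductSpace.toDual ℝ Plane).symm l.linear.toContinuousLinearMap, ?_⟩
  filter_upwards [ae_restrict_of_ae (measure_eq_zero_iff_ae_notMem.1 h0),
    ae_restrict_mem (measurableSet_hull K)] with x hx hxK
  have hi : x ∈ interior (hull K) := by
    by_contra hn
    exact hx ⟨subset_closure hxK, hn⟩
  have he : uh =ᶠ[nhds x] fun y => l y := by
    filter_upwards [mem_interior_iff_mem_nhds.1 hi] with y hy using h y hy
  have hd : HasFDerivAt (fun y => l y) l.linear.toContinuousLinearMap x := by
    refine ((l.linear.toContinuousLinearMap.hasFDerivAt (x := x)).add_const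
      (l 0)).congr_of_eventuallyEq (Filter.Eventually.of_forall fun y => ?_)
    have := l.linearMap_vsub y 0
    simp only [vsub_eq_sub, sub_zero] at this
    simp [this]
  rw [gradient, he.fderiv_eq, hd.fderiv]

/-- Cauchy–Schwarz, obtained from Young's inequality with a free parameter `t`. -/
theorem abs_integral_inner_le {S : Set Plane} {F G : Plane → Plane} {B Q : ℝ} (hB : 0 ≤ B)
    (hS : MeasurableSet S) (hfin : volume S ≠ ⊤) (hF : MemLp F 2 (volume.restrict S))
    (hG : ∀ x ∈ S, ‖G x‖ ≤ B) (hQ : ∫ x in S, ‖F x‖ ^ 2 ≤ Q ^ 2) (hQ0 : 0 ≤ Q) :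
    |∫ x in S, ⟪F x, G x⟫| ≤ B * √(volume.real S) * Q := by
  have hintg : IntegrableOn (fun x => ‖F x‖ ^ 2) S := (memLp_two_iff_integrable_sq_norm hF.1).1 hF
  have key : ∀ t : ℝ, 0 < t →
      |∫ x in S, ⟪F x, G x⟫| ≤ t / 2 * Q ^ 2 + (2 * t)⁻¹ * (B ^ 2 * volume.real S) := by
    intro t ht
    have hbi : IntegrableOn (fun x => t / 2 * ‖F x‖ ^ 2 + (2 * t)⁻¹ * B ^ 2) S :=
      (hintg.const_mul _).add (integrableOn_const hfin)
    calc |∫ x in S, ⟪F x, G x⟫| ≤ ∫ x in S, (t / 2 * ‖F x‖ ^ 2 + (2 * t)⁻¹ * B ^ 2) := by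
          rw [← Real.norm_eq_abs]
          refine norm_integral_le_of_norm_le hbi ?_
          filter_upwards [ae_restrict_mem hS] with x hx
          refine (norm_inner_le_norm _ _).trans ?_
          have h1 := hG x hx
          have h2 : ‖F x‖ * ‖G x‖ ≤ ‖F x‖ * B := by gcongr
          refine h2.trans ?_
          rw [← sub_nonneg]
          have : t / 2 * ‖F x‖ ^ 2 + (2 * t)⁻¹ * B ^ 2 - ‖F x‖ * B =
              (2 * t)⁻¹ * (t * ‖F x‖ - B) ^ 2 := by field_simp; ring
          rw [this]; positivity
      _ = t / 2 * (∫ x in S, ‖F x‖ ^ 2) + (2 * t)⁻¹ * (B ^ 2 * volume.real S) := by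
          rw [integral_add (hintg.const_mul _) (integrableOn_const hfin), integral_const_mul,
            setIntegral_const, smul_eq_mul]
          ring
      _ ≤ _ := by gcongr
  set Z := B * √(volume.real S) with hZ
  have hZ0 : 0 ≤ Z := by positivity
  have hZ2 : B ^ 2 * volume.real S = Z ^ 2 := by
    rw [hZ, mul_pow, Real.sq_sqrt measureReal_nonneg]
  rw [hZ2] at key
  refine le_of_forall_pos_le_add fun ε hε => ?_
  have hlim : Filter.Tendsto (fun δ : ℝ => (Z + δ) * (Q + δ)) (nhdsWithin 0 (Set.Ioi 0))
      (nhds (Z * Q)) := by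
    have : Filter.Tendsto (fun δ : ℝ => (Z + δ) * (Q + δ)) (nhds 0) (nhds ((Z + 0) * (Q + 0))) :=
      Continuous.tendsto (by fun_prop) _
    rw [add_zero, add_zero] at this
    exact this.mono_left nhdsWithin_le_nhds
  obtain ⟨δ, hδ1, hδ0⟩ :=
    ((hlim.eventually_lt_const (lt_add_of_pos_right (Z * Q) hε)).and self_mem_nhdsWithin).exists
  have hδ0 : (0 : ℝ) < δ := hδ0
  refine (key ((Z + δ) / (Q + δ)) (by positivity)).trans (le_trans ?_ hδ1.le)
  have h1 : (Z + δ) / (Q + δ) / 2 * Q ^ 2 ≤ (Z + δ) / (Q + δ) / 2 * (Q + δ) ^ 2 := by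
    gcongr; linarith
  have h2 : (2 * ((Z + δ) / (Q + δ)))⁻¹ * Z ^ 2 ≤ (2 * ((Z + δ) / (Q + δ)))⁻¹ * (Z + δ) ^ 2 := by
    gcongr; linarith
  have h3 : (Z + δ) / (Q + δ) / 2 * (Q + δ) ^ 2 + (2 * ((Z + δ) / (Q + δ)))⁻¹ * (Z + δ) ^ 2 =
      (Z + δ) * (Q + δ) := by
    field_simp
    ring
  linarith

namespace IsSetting

variable {T : TriMesh} {ΓD : Finset (Finset Plane)} {aMin aMax M : ℝ}
  {A : Plane → Plane →L[ℝ] Plane} {f g : Plane → ℝ} {u : H1 T.domain} {uh : Plane → ℝ}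
  {qn : Finset Plane → Finset Plane → ℝ} {K : Finset Plane}

theorem tensorK (S : IsSetting T ΓD aMin aMax M A f g u uh qn) (hK : K ∈ T.elems) :
    IsDiffusionTensor (hull K) aMin aMax A :=
  S.tensor.mono (restrict_hull_le hK)

theorem memLp_gradient (S : IsSetting T ΓD aMin aMax M A f g u uh qn) (hK : K ∈ T.elems) :
    MemLp (gradient uh) 2 (volume.restrict (hull K)) := by
  obtain ⟨l, hl⟩ := S.affine K hK
  obtain ⟨z, hz⟩ := ae_gradient_eq hl
  exact (memLp_hull_of_continuous K (continuous_const (y := z))).ae_eq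
    (hz.mono fun x hx => hx.symm)

theorem memLp_feFlux (S : IsSetting T ΓD aMin aMax M A f g u uh qn) (hK : K ∈ T.elems) :
    MemLp (feFlux A uh) 2 (volume.restrict (hull K)) :=
  (S.tensorK hK).memLp S.aMin_pos S.aMin_le (S.memLp_gradient hK)

theorem memLp_grad (_S : IsSetting T ΓD aMin aMax M A f g u uh qn) (hK : K ∈ T.elems) :
    MemLp u.grad 2 (volume.restrict (hull K)) :=
  u.memLp_grad.mono_measure (restrict_hull_le hK)

theorem memLp_error (S : IsSetting T ΓD aMin aMax M A f g u uh qn) (hK : K ∈ T.elems) :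
    MemLp (fun x => u.grad x - gradient uh x) 2 (volume.restrict (hull K)) :=
  (S.memLp_grad hK).sub (S.memLp_gradient hK)

theorem integrableOn_error (S : IsSetting T ΓD aMin aMax M A f g u uh qn) (hK : K ∈ T.elems) :
    IntegrableOn (fun x => ⟪A x (u.grad x - gradient uh x), u.grad x - gradient uh x⟫) (hull K) :=
  integrable_inner_of_memLp ((S.tensorK hK).memLp S.aMin_pos S.aMin_le (S.memLp_error hK))
    (S.memLp_error hK)

theorem elemError_nonneg (S : IsSetting T ΓD aMin aMax M A f g u uh qn) (hK : K ∈ T.elems) :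
    0 ≤ elemError A u.grad uh K := by
  refine integral_nonneg_of_ae ?_
  filter_upwards [(S.tensorK hK).ae_nonneg S.aMin_pos] with x hx
  exact hx _

theorem energyErrorSq_eq (S : IsSetting T ΓD aMin aMax M A f g u uh qn) :
    energyErrorSq T A u uh = ∑ K ∈ T.elems, elemError A u.grad uh K := by
  apply integral_domain
  refine IntegrableOn.congr_set_ae ?_ (domain_ae_eq T)
  exact integrableOn_finite_iUnion.2 fun K => S.integrableOn_error K.2

theorem aMax_pos (S : IsSetting T ΓD aMin aMax M A f g u uh qn) : 0 < aMax :=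
  S.aMin_pos.trans_le S.aMin_le

theorem M_pos (S : IsSetting T ΓD aMin aMax M A f g u uh qn) (hK : K ∈ T.elems) : 0 < M := by
  obtain ⟨a, b, c, h⟩ := T.exists_isTri hK
  have := h.two_le_of_diam_sq_le (S.area K hK)
  linarith

/-- The factor `|K|^(-1/2)` in the gradient bound cancels the factor `|K|^(1/2)` of Cauchy–Schwarz,
so no power of the mesh size remains; `13 = 26 / 2`. -/
theorem abs_integral_error_le (S : IsSetting T ΓD aMin aMax M A f g u uh qn) (hK : K ∈ T.elems)
    {w : Plane → ℝ}
    (hw : ∀ x ∈ hull K, ‖gradient w x‖ ≤ 26 * √(M / (4 * volume.real (hull K)))) :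
    |∫ x in hull K, ⟪A x (u.grad x - gradient uh x), gradient w x⟫| ≤
      13 * √(aMax * M) * √(elemError A u.grad uh K) := by
  have hmem := (S.tensorK hK).memLp S.aMin_pos S.aMin_le (S.memLp_error hK)
  have h0 := S.elemError_nonneg hK
  have hm := S.aMax_pos
  have hM := S.M_pos hK
  obtain ⟨a, b, c, h⟩ := T.exists_isTri hK
  have hv := h.volume_pos
  have hQ : ∫ x in hull K, ‖A x (u.grad x - gradient uh x)‖ ^ 2 ≤
      (√(aMax * elemError A u.grad uh K)) ^ 2 := by
    rw [Real.sq_sqrt (by positivity), elemError, ← integral_const_mul]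
    refine integral_mono_ae ((memLp_two_iff_integrable_sq_norm hmem.1).1 hmem)
      ((S.integrableOn_error hK).const_mul _) ?_
    filter_upwards [(S.tensorK hK).ae_norm_sq_le S.aMin_pos S.aMin_le] with x hx
    exact hx _
  refine (abs_integral_inner_le (by positivity) (measurableSet_hull K)
    (isCompact_hull K).measure_lt_top.ne hmem hw hQ (Real.sqrt_nonneg _)).trans (le_of_eq ?_)
  have e1 : √(M / (4 * volume.real (hull K))) * √(volume.real (hull K)) = √M / 2 := by
    rw [← Real.sqrt_mul (by positivity), div_mul_eq_mul_div, mul_div_mul_right _ _ hv.ne',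
      Real.sqrt_div hM.le, show (4 : ℝ) = 2 ^ 2 by norm_num, Real.sqrt_sq (by norm_num)]
  rw [Real.sqrt_mul hm.le, Real.sqrt_mul hm.le, mul_assoc 26, e1]
  ring

theorem integral_feFlux (S : IsSetting T ΓD aMin aMax M A f g u uh qn) (hK : K ∈ T.elems)
    {w : Plane → ℝ} (hw : ContDiff ℝ ∞ w) :
    ∫ x in hull K, ⟪feFlux A uh x, gradient w x⟫ =
      ∑ e ∈ edgesOf K, ∫ x, w x * qn K e ∂(edgeMeasure e) := by
  have := S.flux K hK w hw
  simp only [zero_mul, add_zero] at this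
  rw [this]
  exact Finset.sum_congr rfl fun e _ => by simp only [mul_comm]

/-- The equation for `u` is tested with the piecewise function, and `A∇u_h` is integrated by parts
on each element. It is divergence-free, so only the constant edge fluxes `qn` remain. -/
theorem residual_eq (S : IsSetting T ΓD aMin aMax M A f g u uh qn)
    {w : Finset Plane → Plane → ℝ} (hw : ∀ K, ContDiff ℝ ∞ (w K)) {t : Plane → ℝ}
    (ht : ∀ e ∈ T.boundaryEdges, MemLp t 2 (edgeMeasure e))
    (hD : ∀ e ∈ ΓD, ∀ᵐ x ∂(edgeMeasure e), t x = 0)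
    (hG : ∀ ψ : Plane → ℝ, ContDiff ℝ ∞ ψ → ∀ z : Plane,
      ∑ K ∈ T.elems, ∑ e ∈ edgesOf K,
        ∫ x, w K x * ψ x * ⟪z, outerNormal K e⟫ ∂(edgeMeasure e) =
      ∑ e ∈ T.boundaryEdges, ∑ K ∈ T.adj e,
        ∫ x, t x * ψ x * ⟪z, outerNormal K e⟫ ∂(edgeMeasure e)) :
    ∑ K ∈ T.elems, ∫ x in hull K, ⟪A x (u.grad x - gradient uh x), gradient (w K) x⟫ =
      (∑ K ∈ T.elems, ∫ x in hull K, f x * w K x) +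
        (∑ e ∈ T.neumannEdges ΓD, ∫ x, g x * t x ∂(edgeMeasure e)) -
        ∑ K ∈ T.elems, ∑ e ∈ edgesOf K, ∫ x, w K x * qn K e ∂(edgeMeasure e) := by
  obtain ⟨v, hv1, hv2, hv3⟩ := exists_H1_of_broken hw ht hG
  have h1 := S.weak.2 v t ⟨hv3, hD⟩
  have hAu : ∀ K ∈ T.elems, MemLp (fun x => A x (u.grad x)) 2 (volume.restrict (hull K)) :=
    fun K hK => (S.tensorK hK).memLp S.aMin_pos S.aMin_le (S.memLp_grad hK)
  rw [hv1, hv2, integral_inner_brokenGrad hw hAu, integral_mul_brokenVal] at h1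
  · rw [← h1, ← Finset.sum_sub_distrib]
    refine Finset.sum_congr rfl fun K hK => ?_
    have hgr := memLp_hull_of_continuous K (continuous_gradient (hw K))
    rw [← S.integral_feFlux hK (hw K), ← integral_sub
      (integrable_inner_of_memLp (hAu K hK) hgr)
      (integrable_inner_of_memLp (S.memLp_feFlux hK) hgr)]
    congr 1
    ext x
    rw [map_sub, inner_sub_left, feFlux]
  · intro K hK
    obtain ⟨k, hk⟩ := S.const K hK
    have : IntegrableOn (fun x => k * w K x) (hull K) :=
      (Continuous.continuousOn (continuous_const.mul (hw K).continuous)).integrableOn_compact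
        (isCompact_hull K)
    exact this.congr (hk.mono fun x hx => by simp only [hx])

end IsSetting

/-! ### Residual estimates with element and edge bubbles -/

namespace IsTri

variable {K : Finset Plane} {a b c : Plane}

open Classical in
theorem edgeBubble_eq_zero (h : IsTri K a b c) {e : Finset Plane} (he : e ∈ edgesOf K)
    (hne : e ≠ {a, b}) {x : Plane} (hx : x ∈ hull e) : edgeBubble K a b x = 0 := by
  rw [h.edgesOf_eq] at he
  simp only [Finset.mem_insert, Finset.mem_singleton] at he
  rcases he with rfl | rfl | rfl
  · exact absurd rfl hne
  · simp [edgeBubble, h.rotate.shape_edge hx]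
  · simp [edgeBubble, h.flip.shape_edge hx]

theorem triBubble_eq_zero (h : IsTri K a b c) {e : Finset Plane} (he : e ∈ edgesOf K)
    {x : Plane} (hx : x ∈ hull e) : triBubble K a b c x = 0 := by
  classical
  rw [h.edgesOf_eq] at he
  simp only [Finset.mem_insert, Finset.mem_singleton] at he
  rcases he with rfl | rfl | rfl
  · simp [triBubble, h.shape_edge hx]
  · simp [triBubble, h.rotate.shape_edge hx]
  · simp [triBubble, h.flip.shape_edge hx]

open Classical in
theorem shape_eq_on_edge {J : Finset Plane} {d : Plane} (h : IsTri K a b c) (h' : IsTri J a b d)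
    {x : Plane} (hx : x ∈ hull {a, b}) : shape K a x = shape J a x := by
  obtain ⟨s, _, rfl⟩ := (mem_hull_pair_iff c).1 hx
  have : baryPoint a b c s 0 = baryPoint a b d s 0 := by simp [baryPoint]
  rw [h.shape_a_bary, this, h'.shape_a_bary]

open Classical in
theorem edgeBubble_eq_on_edge {J : Finset Plane} {d : Plane} (h : IsTri K a b c)
    (h' : IsTri J a b d) {x : Plane} (hx : x ∈ hull {a, b}) :
    edgeBubble K a b x = edgeBubble J a b x := by
  have hx' : x ∈ hull {b, a} := by rwa [Finset.pair_comm]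
  rw [edgeBubble, edgeBubble, h.shape_eq_on_edge h' hx, h.swap.shape_eq_on_edge h'.swap hx']

end IsTri

open Classical in
/-- The test function of the edge `{a, b}`. -/
noncomputable def edgeTest (T : TriMesh) (a b : Plane) (K : Finset Plane) : Plane → ℝ :=
  if K ∈ T.adj {a, b} then edgeBubble K a b else 0

theorem contDiff_edgeTest (T : TriMesh) (a b : Plane) (K : Finset Plane) :
    ContDiff ℝ ∞ (edgeTest T a b K) := by
  unfold edgeTest
  split_ifs
  · exact contDiff_edgeBubble K a b
  · exact contDiff_const

open Classical in
theorem sum_adj {T : TriMesh} {e : Finset Plane} (F : Finset Plane → ℝ) :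
    ∑ K ∈ T.elems, (if K ∈ T.adj e then F K else 0) = ∑ K ∈ T.adj e, F K := by
  rw [← Finset.sum_filter]
  congr 1
  ext K
  rw [Finset.mem_filter, TriMesh.mem_adj]
  tauto

open Classical in
theorem sum_edgeTest {T : TriMesh} {a b : Plane} (hab : a ≠ b)
    (Φ : Finset Plane → Finset Plane → Plane → ℝ) :
    ∑ K ∈ T.elems, ∑ e ∈ edgesOf K, ∫ x, edgeTest T a b K x * Φ K e x ∂(edgeMeasure e) =
      ∑ K ∈ T.adj {a, b}, ∫ x, edgeBubble K a b x * Φ K {a, b} x ∂(edgeMeasure {a, b}) := by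
  rw [← sum_adj]
  refine Finset.sum_congr rfl fun K hK => ?_
  split_ifs with hadj
  · obtain ⟨c, h⟩ := T.exists_isTri_of_mem_adj hab hadj
    rw [Finset.sum_eq_single {a, b}]
    · simp only [edgeTest, if_pos hadj]
    · intro e he hne
      refine integral_edge_eq_zero fun x hx => ?_
      rw [edgeTest, if_pos hadj, h.edgeBubble_eq_zero he hne hx, zero_mul]
    · exact fun hn => absurd h.mem_edgesOf hn
  · refine Finset.sum_eq_zero fun e _ => ?_
    simp [edgeTest, hadj]

namespace IsSetting

variable {T : TriMesh} {ΓD : Finset (Finset Plane)} {aMin aMax M : ℝ}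
  {A : Plane → Plane →L[ℝ] Plane} {f g : Plane → ℝ} {u : H1 T.domain} {uh : Plane → ℝ}
  {qn : Finset Plane → Finset Plane → ℝ} {K : Finset Plane}

/-- Tested with the bubble of `K`, which vanishes on all edges, the residual equation has only the
source term `k |K| / 60`; hence `780 = 60 * 13`. -/
theorem volume_mul_abs_le (S : IsSetting T ΓD aMin aMax M A f g u uh qn) (hK : K ∈ T.elems)
    {k : ℝ} (hk : ∀ᵐ x ∂(volume.restrict (hull K)), f x = k) :
    |k| * volume.real (hull K) ≤ 780 * √(aMax * M) * √(elemError A u.grad uh K) := by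
  classical
  obtain ⟨a, b, c, h⟩ := T.exists_isTri hK
  have hv := h.volume_pos
  set w : Finset Plane → Plane → ℝ := fun J => if J = K then triBubble K a b c else 0 with hw
  have hwK : w K = triBubble K a b c := by simp [hw]
  have hwJ : ∀ J, J ≠ K → w J = 0 := fun J hJ => by simp [hw, hJ]
  have hws : ∀ J, ContDiff ℝ ∞ (w J) := by
    intro J
    by_cases hJ : J = K
    · rw [hJ, hwK]; exact contDiff_triBubble K a b c
    · rw [hwJ J hJ]; exact contDiff_const
  have hedge : ∀ J, ∀ e ∈ edgesOf J, ∀ x ∈ hull e, w J x = 0 := by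
    intro J e he x hx
    by_cases hJ : J = K
    · subst hJ
      rw [hwK]; exact h.triBubble_eq_zero he hx
    · rw [hwJ J hJ]; rfl
  have hres := S.residual_eq hws (t := fun _ => 0) (fun e _ => MemLp.zero')
    (fun e _ => Filter.Eventually.of_forall fun _ => rfl) (by
      intro ψ _ z
      simp only [zero_mul, integral_zero, Finset.sum_const_zero]
      refine Finset.sum_eq_zero fun J _ => Finset.sum_eq_zero fun e he => ?_
      exact integral_edge_eq_zero fun x hx => by rw [hedge J e he x hx]; ring)
  have h3 : ∑ J ∈ T.elems, ∑ e ∈ edgesOf J, ∫ x, w J x * qn J e ∂(edgeMeasure e) = 0 :=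
    Finset.sum_eq_zero fun J _ => Finset.sum_eq_zero fun e he =>
      integral_edge_eq_zero fun x hx => by rw [hedge J e he x hx]; ring
  have h1 : ∑ J ∈ T.elems, ∫ x in hull J, ⟪A x (u.grad x - gradient uh x), gradient (w J) x⟫ =
      ∫ x in hull K, ⟪A x (u.grad x - gradient uh x), gradient (triBubble K a b c) x⟫ := by
    rw [Finset.sum_eq_single_of_mem K hK, hwK]
    intro J _ hJ
    rw [hwJ J hJ]
    simp [gradient]
  have h2 : ∑ J ∈ T.elems, ∫ x in hull J, f x * w J x = k * (volume.real (hull K) / 60) := by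
    rw [Finset.sum_eq_single_of_mem K hK, hwK, ← h.integral_triBubble, ← integral_const_mul]
    · exact integral_congr_ae (hk.mono fun x hx => by simp only [hx])
    · intro J _ hJ
      rw [hwJ J hJ]
      simp
  rw [h1, h2, h3] at hres
  simp only [mul_zero, integral_zero, Finset.sum_const_zero, add_zero, sub_zero] at hres
  have hM := S.area K hK
  have hb := S.abs_integral_error_le hK (w := triBubble K a b c) fun x hx =>
    h.norm_gradient_triBubble_le (h.rotate.norm_shapeGrad_le hM)
      (h.flip.norm_shapeGrad_le hM) (h.norm_shapeGrad_le hM) hx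
  rw [hres, abs_mul, abs_of_pos (by positivity : 0 < volume.real (hull K) / 60)] at hb
  linarith

open Classical in
-- The error term costs `13`, and the source term `8 * 780` since the edge bubble is at most `8`; in
-- sum `6253`.
theorem abs_integral_edgeBubble_le (S : IsSetting T ΓD aMin aMax M A f g u uh qn) {a b : Plane}
    (hab : a ≠ b) (hK : K ∈ T.adj {a, b}) :
    |(∫ x in hull K, ⟪A x (u.grad x - gradient uh x), gradient (edgeBubble K a b) x⟫) -
      ∫ x in hull K, f x * edgeBubble K a b x| ≤
      6253 * √(aMax * M) * √(elemError A u.grad uh K) := by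
  obtain ⟨c, h⟩ := T.exists_isTri_of_mem_adj hab hK
  have hK' := (TriMesh.mem_adj.1 hK).1
  have hM := S.area K hK'
  have hb := S.abs_integral_error_le hK' (w := edgeBubble K a b) fun x hx =>
    h.norm_gradient_edgeBubble_le (h.rotate.norm_shapeGrad_le hM)
      (h.flip.norm_shapeGrad_le hM) hx
  obtain ⟨k, hk⟩ := S.const K hK'
  have h2 := S.volume_mul_abs_le hK' hk
  have h3 : |∫ x in hull K, f x * edgeBubble K a b x| ≤ |k| * 8 * volume.real (hull K) := by
    rw [← Real.norm_eq_abs]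
    refine norm_setIntegral_le_of_norm_le_const_ae (isCompact_hull K).measure_lt_top ?_
    filter_upwards [hk, ae_restrict_mem (measurableSet_hull K)] with x hx hxK
    rw [hx, norm_mul, Real.norm_eq_abs, Real.norm_eq_abs]
    have := h.abs_edgeBubble_le hxK
    gcongr
  refine (abs_sub _ _).trans ?_
  linarith

open Classical in
-- Common core of the jump and Neumann estimates: the test function is the edge bubble on the
-- elements containing the edge, extended by zero, and `hG` says that it lies in `H¹` with trace
-- `t`.
theorem residual_edge (S : IsSetting T ΓD aMin aMax M A f g u uh qn) {a b : Plane} (hab : a ≠ b)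
    {t : Plane → ℝ} (ht : ∀ e ∈ T.boundaryEdges, MemLp t 2 (edgeMeasure e))
    (hD : ∀ e ∈ ΓD, ∀ᵐ x ∂(edgeMeasure e), t x = 0)
    (hG : ∀ ψ : Plane → ℝ, ContDiff ℝ ∞ ψ → ∀ z : Plane,
      ∑ K ∈ T.adj {a, b},
        ∫ x, edgeBubble K a b x * (ψ x * ⟪z, outerNormal K {a, b}⟫) ∂(edgeMeasure {a, b}) =
      ∑ e ∈ T.boundaryEdges, ∑ K ∈ T.adj e,
        ∫ x, t x * ψ x * ⟪z, outerNormal K e⟫ ∂(edgeMeasure e)) :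
    |(∑ e ∈ T.neumannEdges ΓD, ∫ x, g x * t x ∂(edgeMeasure e)) -
      (∑ K ∈ T.adj {a, b}, qn K {a, b}) * (‖b - a‖ / 2)| ≤
      ∑ K ∈ T.adj {a, b}, 6253 * √(aMax * M) * √(elemError A u.grad uh K) := by
  have hres := S.residual_eq (contDiff_edgeTest T a b) ht hD (by
    intro ψ hψ z
    rw [← hG ψ hψ z, ← sum_edgeTest hab fun K e x => ψ x * ⟪z, outerNormal K e⟫]
    simp only [mul_assoc])
  rw [sum_edgeTest hab fun K e x => qn K e] at hres
  have h1 : ∀ K ∈ T.adj {a, b}, ∫ x, edgeBubble K a b x * qn K {a, b} ∂(edgeMeasure {a, b}) =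
      qn K {a, b} * (‖b - a‖ / 2) := by
    intro K hK
    obtain ⟨c, h⟩ := T.exists_isTri_of_mem_adj hab hK
    rw [integral_mul_const, h.integral_edge_edgeBubble, mul_comm]
  have h2 : ∑ K ∈ T.elems, ∫ x in hull K, f x * edgeTest T a b K x =
      ∑ K ∈ T.adj {a, b}, ∫ x in hull K, f x * edgeBubble K a b x := by
    rw [← sum_adj]
    refine Finset.sum_congr rfl fun K _ => ?_
    by_cases hK : K ∈ T.adj {a, b} <;> simp [edgeTest, hK]
  have h3 : ∑ K ∈ T.elems, ∫ x in hull K,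
        ⟪A x (u.grad x - gradient uh x), gradient (edgeTest T a b K) x⟫ =
      ∑ K ∈ T.adj {a, b}, ∫ x in hull K,
        ⟪A x (u.grad x - gradient uh x), gradient (edgeBubble K a b) x⟫ := by
    rw [← sum_adj]
    refine Finset.sum_congr rfl fun K _ => ?_
    by_cases hK : K ∈ T.adj {a, b} <;> simp [edgeTest, hK, gradient]
  rw [Finset.sum_congr rfl h1, ← Finset.sum_mul, h2, h3] at hres
  have h4 : (∑ e ∈ T.neumannEdges ΓD, ∫ x, g x * t x ∂(edgeMeasure e)) -
      (∑ K ∈ T.adj {a, b}, qn K {a, b}) * (‖b - a‖ / 2) =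
      ∑ K ∈ T.adj {a, b}, ((∫ x in hull K,
        ⟪A x (u.grad x - gradient uh x), gradient (edgeBubble K a b) x⟫) -
        ∫ x in hull K, f x * edgeBubble K a b x) := by
    rw [Finset.sum_sub_distrib, hres]; ring
  rw [h4]
  exact (Finset.abs_sum_le_sum_abs _ _).trans
    (Finset.sum_le_sum fun K hK => S.abs_integral_edgeBubble_le hab hK)

open Classical in
/-- The jump of the normal flux on an interior edge is bounded by the error. -/
theorem abs_jump_le (S : IsSetting T ΓD aMin aMax M A f g u uh qn) {a b : Plane} (hab : a ≠ b)
    (hcard : (T.adj {a, b}).card = 2) :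
    |(∑ K ∈ T.adj {a, b}, qn K {a, b}) * (‖b - a‖ / 2)| ≤
      ∑ K ∈ T.adj {a, b}, 6253 * √(aMax * M) * √(elemError A u.grad uh K) := by
  have := S.residual_edge hab (t := fun _ => 0) (fun e _ => MemLp.zero')
    (fun e _ => Filter.Eventually.of_forall fun _ => rfl) (by
      intro ψ _ z
      simp only [zero_mul, integral_zero, Finset.sum_const_zero]
      obtain ⟨K, J, hKJ, hadj⟩ := Finset.card_eq_two.1 hcard
      have hK : K ∈ T.adj {a, b} := by rw [hadj]; simp
      have hJ : J ∈ T.adj {a, b} := by rw [hadj]; simp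
      obtain ⟨c, h⟩ := T.exists_isTri_of_mem_adj hab hK
      obtain ⟨d, h'⟩ := T.exists_isTri_of_mem_adj hab hJ
      -- The two bubbles agree on the edge and the normals are opposite, so the contributions cancel
      -- and the trace is zero.
      rw [hadj, Finset.sum_pair hKJ, TriMesh.outerNormal_neg hK hJ hKJ]
      have : ∫ x, edgeBubble J a b x * (ψ x * ⟪z, -outerNormal K {a, b}⟫) ∂(edgeMeasure {a, b}) =
          -∫ x, edgeBubble K a b x * (ψ x * ⟪z, outerNormal K {a, b}⟫) ∂(edgeMeasure {a, b}) := by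
        rw [← integral_neg]
        refine integral_congr_ae ?_
        filter_upwards [ae_edgeMeasure_mem {a, b}] with x hx
        rw [h.edgeBubble_eq_on_edge h' hx, inner_neg_right]
        ring
      rw [this, add_neg_cancel])
  simpa using this

open Classical in
/-- The residual on a Neumann edge is bounded by the error. -/
theorem abs_neumann_le (S : IsSetting T ΓD aMin aMax M A f g u uh qn) {a b : Plane} (hab : a ≠ b)
    (he : {a, b} ∈ T.neumannEdges ΓD) (hK : K ∈ T.adj {a, b}) :
    |(∫ x, g x * shape K a x ∂(edgeMeasure {a, b})) - qn K {a, b} * (‖b - a‖ / 2)| ≤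
      6253 * √(aMax * M) * √(elemError A u.grad uh K) := by
  have hN := he
  rw [TriMesh.neumannEdges, Finset.mem_sdiff] at he
  have hedges : ∀ e ∈ T.boundaryEdges, e ∈ T.edges := fun e he => (TriMesh.mem_boundaryEdges.1 he).1
  have hadj : T.adj {a, b} = {K} := by
    obtain ⟨J, hJ⟩ := Finset.card_eq_one.1 (TriMesh.mem_boundaryEdges.1 he.1).2
    rw [hJ, Finset.mem_singleton] at hK
    rw [hJ, hK]
  obtain ⟨c, h⟩ := T.exists_isTri_of_mem_adj hab hK
  -- The trace of the test function: the bubble on this edge, and almost everywhere zero on the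
  -- other boundary edges.
  set t : Plane → ℝ := (hull {a, b}).indicator (edgeBubble K a b) with ht
  have ht0 : ∀ e ∈ T.boundaryEdges, e ≠ {a, b} → ∀ᵐ x ∂(edgeMeasure e), t x = 0 := by
    intro e he' hne
    filter_upwards [TriMesh.ae_notMem_hull (hedges _ he.1) (hedges e he') hne.symm] with x hx
    rw [ht, Set.indicator_of_notMem hx]
  have hte : ∀ᵐ x ∂(edgeMeasure {a, b}), t x = edgeBubble K a b x := by
    filter_upwards [ae_edgeMeasure_mem {a, b}] with x hx
    rw [ht, Set.indicator_of_mem hx]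
  have hmem : MemLp (edgeBubble K a b) 2 (edgeMeasure {a, b}) := by
    have := isFiniteMeasure_edgeMeasure_pair hab
    refine MemLp.of_bound (contDiff_edgeBubble K a b).continuous.aestronglyMeasurable 8 ?_
    filter_upwards [ae_edgeMeasure_mem {a, b}] with x hx
    refine h.abs_edgeBubble_le (convexHull_mono ?_ hx)
    exact Finset.coe_subset.2 (Finset.mem_powersetCard.1 h.mem_edgesOf).1
  have := S.residual_edge hab (t := t) (by
      intro e he'
      by_cases hne : e = {a, b}
      · subst hne
        exact hmem.ae_eq (hte.mono fun x hx => hx.symm)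
      · exact (MemLp.zero' (ε := ℝ)).ae_eq ((ht0 e he' hne).mono fun x hx => hx.symm)) (by
      intro e heD
      refine ht0 e (S.subset heD) ?_
      rintro rfl
      exact he.2 heD) (by
      intro ψ _ z
      rw [Finset.sum_eq_single_of_mem _ he.1]
      · refine Finset.sum_congr rfl fun J hJ => ?_
        rw [hadj, Finset.mem_singleton] at hJ
        subst hJ
        refine integral_congr_ae (hte.mono fun x hx => ?_)
        simp only [hx]; ring
      · intro e he' hne
        refine Finset.sum_eq_zero fun J _ => ?_
        refine integral_eq_zero_of_ae ((ht0 e he' hne).mono fun x hx => ?_)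
        simp [hx])
  obtain ⟨l, hl⟩ := S.edgewise _ hN
  have hg : ∑ e ∈ T.neumannEdges ΓD, ∫ x, g x * t x ∂(edgeMeasure e) =
      ∫ x, g x * shape K a x ∂(edgeMeasure {a, b}) := by
    rw [Finset.sum_eq_single_of_mem _ hN]
    · have e1 : ∫ x, g x * t x ∂(edgeMeasure {a, b}) =
          ∫ x, l x * edgeBubble K a b x ∂(edgeMeasure {a, b}) := by
        refine integral_congr_ae ?_
        filter_upwards [hl, hte] with x h1 h2
        rw [h1, h2]
      -- Since `g` is affine on the edge, the bubble may be exchanged for the hat function, giving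
      -- exactly the moment prescribed in the nodal system.
      rw [e1, h.integral_edge_affine_edgeBubble]
      exact integral_congr_ae (hl.mono fun x hx => by simp only [hx])
    · intro e he' hne
      have hb : e ∈ T.boundaryEdges := by
        rw [TriMesh.neumannEdges, Finset.mem_sdiff] at he'
        exact he'.1
      refine integral_eq_zero_of_ae ((ht0 e hb hne).mono fun x hx => ?_)
      simp [hx]
  rw [hg, hadj, Finset.sum_singleton, Finset.sum_singleton] at this
  exact this

end IsSetting

/-! ### The nodal problems -/

/-- The linear map from the unknowns to the subset sums has a linear right inverse on its range; `C`
is the norm of that inverse. -/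
theorem exists_bounded_solution_fin (m : ℕ) (𝒮 : Set (Finset (Fin m))) :
    ∃ C : ℝ, 0 ≤ C ∧ ∀ (x : Fin m → ℝ) (B : ℝ), 0 ≤ B → (∀ s ∈ 𝒮, |∑ p ∈ s, x p| ≤ B) →
      ∃ x' : Fin m → ℝ, (∀ s ∈ 𝒮, ∑ p ∈ s, x' p = ∑ p ∈ s, x p) ∧ ∀ p, |x' p| ≤ C * B := by
  classical
  let Φ : (Fin m → ℝ) →ₗ[ℝ] (𝒮 → ℝ) :=
    { toFun := fun x s => ∑ p ∈ (s : Finset (Fin m)), x p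
      map_add' := fun x y => by ext s; simp [Finset.sum_add_distrib]
      map_smul' := fun k x => by ext s; simp [Finset.mul_sum] }
  obtain ⟨G, hG⟩ := Φ.rangeRestrict.exists_rightInverse_of_surjective
    (LinearMap.range_rangeRestrict Φ)
  refine ⟨‖G.toContinuousLinearMap‖, ContinuousLinearMap.opNorm_nonneg _, fun x B hB hx => ?_⟩
  refine ⟨G (Φ.rangeRestrict x), fun s hs => ?_, fun p => ?_⟩
  · have h1 : Φ.rangeRestrict (G (Φ.rangeRestrict x)) = Φ.rangeRestrict x :=
      LinearMap.congr_fun hG _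
    have h2 := congrArg (fun z : LinearMap.range Φ => (z : 𝒮 → ℝ) ⟨s, hs⟩) h1
    exact h2
  · have h1 : ‖G.toContinuousLinearMap (Φ.rangeRestrict x)‖ ≤
        ‖G.toContinuousLinearMap‖ * ‖Φ.rangeRestrict x‖ := ContinuousLinearMap.le_opNorm _ _
    have h2 : ‖Φ.rangeRestrict x‖ ≤ B := by
      refine (pi_norm_le_iff_of_nonneg hB).2 fun s => ?_
      exact hx s s.2
    have h3 : ‖(G (Φ.rangeRestrict x)) p‖ ≤ ‖G (Φ.rangeRestrict x)‖ := norm_le_pi_norm _ p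
    exact h3.trans (h1.trans (by gcongr))

/-- A solvable system of equations whose left-hand sides are sums over subsets of a set of at most
`n` unknowns has a solution that is bounded by the right-hand sides, with a constant that depends
only on `n`. -/
theorem exists_bounded_solution (n : ℕ) :
    ∃ C : ℝ, 0 ≤ C ∧ ∀ {α : Type} (D : Finset α), D.card ≤ n → ∀ 𝒮 : Set (Finset α),
      (∀ s ∈ 𝒮, s ⊆ D) → ∀ (x : α → ℝ) (B : ℝ), 0 ≤ B → (∀ s ∈ 𝒮, |∑ p ∈ s, x p| ≤ B) →
      ∃ x' : α → ℝ, (∀ s ∈ 𝒮, ∑ p ∈ s, x' p = ∑ p ∈ s, x p) ∧ ∀ p ∈ D, |x' p| ≤ C * B := by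
  classical
  choose c hc0 hc using exists_bounded_solution_fin
  -- There are finitely many systems on at most `n` numbered unknowns; the sum of their constants
  -- dominates each of them.
  refine ⟨∑ m ∈ Finset.range (n + 1), ∑ 𝒮 : Set (Finset (Fin m)), c m 𝒮,
    Finset.sum_nonneg fun m _ => Finset.sum_nonneg fun 𝒮 _ => hc0 m 𝒮, ?_⟩
  intro α D hD 𝒮 h𝒮 x B hB hx
  set m := D.card with hm
  let ε : D ≃ Fin m := D.equivFin
  let ι : Fin m ↪ α := ⟨fun k => (ε.symm k : α), fun k l hkl => ε.symm.injective (Subtype.ext hkl)⟩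
  let 𝒯 : Set (Finset (Fin m)) := {s | s.map ι ∈ 𝒮}
  have hle : c m 𝒯 ≤ ∑ m ∈ Finset.range (n + 1), ∑ 𝒮 : Set (Finset (Fin m)), c m 𝒮 :=
    (Finset.single_le_sum (f := fun 𝒮 => c m 𝒮) (fun 𝒮 _ => hc0 m 𝒮) (Finset.mem_univ 𝒯)).trans
      (Finset.single_le_sum (f := fun m => ∑ 𝒮 : Set (Finset (Fin m)), c m 𝒮)
        (fun m _ => Finset.sum_nonneg fun 𝒮 _ => hc0 m 𝒮) (Finset.mem_range.2 (by omega)))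
  obtain ⟨y, hy1, hy2⟩ := hc m 𝒯 (fun k => x (ι k)) B hB (by
    intro s hs
    have := hx _ hs
    rwa [Finset.sum_map] at this)
  let x' : α → ℝ := fun p => if h : p ∈ D then y (ε ⟨p, h⟩) else 0
  have hx'ι : ∀ k, x' (ι k) = y k := by
    intro k
    have hk : ι k ∈ D := (ε.symm k).2
    simp only [x', dif_pos hk]
    congr 1
    exact ε.apply_symm_apply k
  refine ⟨x', fun s hs => ?_, fun p hp => ?_⟩
  · have hmap : (Finset.univ.filter fun k => ι k ∈ s).map ι = s := by
      ext p
      simp only [Finset.mem_map, Finset.mem_filter, Finset.mem_univ, true_and]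
      constructor
      · rintro ⟨k, hk, rfl⟩; exact hk
      · intro hp
        have hpD := h𝒮 s hs hp
        have : ι (ε ⟨p, hpD⟩) = p := congrArg Subtype.val (ε.symm_apply_apply ⟨p, hpD⟩)
        exact ⟨ε ⟨p, hpD⟩, by rwa [this], this⟩
    have h1 := hy1 (Finset.univ.filter fun k => ι k ∈ s) (by
      show Finset.map ι _ ∈ 𝒮
      rwa [hmap])
    rw [← hmap, Finset.sum_map, Finset.sum_map, ← h1]
    exact Finset.sum_congr rfl fun k _ => hx'ι k
  · simp only [x', dif_pos hp]
    exact (hy2 _).trans (by gcongr)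

/-! ### Comparability of lengths around a vertex -/

section Patch

variable {T : TriMesh} {i : Plane} {M : ℝ}

/-- The elements that have the vertex `i`. -/
abbrev Patch (T : TriMesh) (i : Plane) : Type := {K : Finset Plane // K ∈ T.elems ∧ i ∈ K}

noncomputable instance : Fintype (Patch T i) := by
  classical
  exact Fintype.ofFinset (T.elems.filter fun K => i ∈ K) (p := {K | K ∈ T.elems ∧ i ∈ K})
    (fun K => by simp)

/-- Two elements of the patch of `i` are adjacent if they share an edge that contains `i`. -/
def patchGraph (T : TriMesh) (i : Plane) : SimpleGraph (Patch T i) where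
  Adj K J := K ≠ J ∧ ∃ e, e ∈ edgesOf K.1 ∧ e ∈ edgesOf J.1 ∧ i ∈ e
  symm := ⟨fun _ _ ⟨h1, e, h2, h3, h4⟩ => ⟨h1.symm, e, h3, h2, h4⟩⟩
  loopless := ⟨fun _ h => h.1 rfl⟩

theorem edgeLength_le_diam {K e : Finset Plane} (hK : K ∈ T.elems) (he : e ∈ edgesOf K) :
    edgeLength e ≤ Metric.diam (hull K) := by
  classical
  obtain ⟨a, b, ha, hb, hab, rfl⟩ := exists_pair_of_mem_edgesOf he
  obtain ⟨c, h⟩ := exists_isTri_of_pair (T.card_eq K hK) (T.indep K hK) ha hb hab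
  rw [edgeLength_pair]
  exact h.norm_sub_le_diam

theorem edgeLength_pos {K e : Finset Plane} (he : e ∈ edgesOf K) : 0 < edgeLength e := by
  classical
  obtain ⟨a, b, ha, hb, hab, rfl⟩ := exists_pair_of_mem_edgesOf he
  rw [edgeLength_pair]
  exact norm_pos_iff.2 (sub_ne_zero.2 hab.symm)

theorem diam_le_edgeLength
    (hM : ∀ K ∈ T.elems, Metric.diam (hull K) ^ 2 ≤ M * volume.real (hull K))
    {K e : Finset Plane} (hK : K ∈ T.elems) (he : e ∈ edgesOf K) :
    Metric.diam (hull K) ≤ M / 2 * edgeLength e := by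
  classical
  obtain ⟨a, b, ha, hb, hab, rfl⟩ := exists_pair_of_mem_edgesOf he
  obtain ⟨c, h⟩ := exists_isTri_of_pair (T.card_eq K hK) (T.indep K hK) ha hb hab
  rw [edgeLength_pair]
  exact h.diam_le (hM K hK)

/-- Consecutive elements share an edge, whose length is at most the diameter of one and at least `2
/ M` times that of the other; each step costs a factor `M / 2`. -/
theorem diam_le_of_walk (hM2 : 2 ≤ M)
    (hM : ∀ K ∈ T.elems, Metric.diam (hull K) ^ 2 ≤ M * volume.real (hull K))
    {K J : Patch T i} (p : (patchGraph T i).Walk K J) :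
    Metric.diam (hull K.1) ≤ (M / 2) ^ p.length * Metric.diam (hull J.1) := by
  induction p with
  | nil => simp
  | @cons K I J hadj p ih =>
    obtain ⟨e, he1, he2, _⟩ := hadj.2
    rw [SimpleGraph.Walk.length_cons, pow_succ']
    have h1 := diam_le_edgeLength hM K.2.1 he1
    have h2 := edgeLength_le_diam I.2.1 he2
    calc Metric.diam (hull K.1) ≤ M / 2 * edgeLength e := h1
      _ ≤ M / 2 * ((M / 2) ^ p.length * Metric.diam (hull J.1)) := by
        gcongr; exact h2.trans ih
      _ = _ := by ring

/-- In a connected component of a patch, the lengths of the edges are comparable. -/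
theorem edgeLength_le_of_reachable (hM2 : 2 ≤ M)
    (hM : ∀ K ∈ T.elems, Metric.diam (hull K) ^ 2 ≤ M * volume.real (hull K)) {N : ℕ}
    (hN : Fintype.card (Patch T i) ≤ N) {K J : Patch T i} (h : (patchGraph T i).Reachable K J)
    {e e' : Finset Plane} (he : e ∈ edgesOf K.1) (he' : e' ∈ edgesOf J.1) :
    edgeLength e ≤ (M / 2) ^ (N + 1) * edgeLength e' := by
  classical
  obtain ⟨p⟩ := h
  have h1 := diam_le_of_walk hM2 hM p.bypass
  -- A path visits each element of the patch at most once.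
  have h2 : p.bypass.length ≤ N := (p.bypass_isPath.length_lt.le).trans hN
  have h3 : (1 : ℝ) ≤ M / 2 := by linarith
  calc edgeLength e ≤ Metric.diam (hull K.1) := edgeLength_le_diam K.2.1 he
    _ ≤ (M / 2) ^ p.bypass.length * Metric.diam (hull J.1) := h1
    _ ≤ (M / 2) ^ N * (M / 2 * edgeLength e') := by
      gcongr
      · exact diam_le_edgeLength hM J.2.1 he'
    _ = _ := by ring

end Patch

open Classical in
set_option maxHeartbeats 1000000 in
/-- The solution of the nodal problem is bounded by its data. -/
theorem exists_nodal_bound (M : ℝ) (hM2 : 2 ≤ M) (N : ℕ) : ∃ C : ℝ, 0 ≤ C ∧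
    ∀ (T : TriMesh) (ΓD : Finset (Finset Plane)) (A : Plane → Plane →L[ℝ] Plane)
      (f g uh : Plane → ℝ) (qn b : Finset Plane → Finset Plane → ℝ) (i : Plane) (B : ℝ),
      (∀ K ∈ T.elems, Metric.diam (hull K) ^ 2 ≤ M * volume.real (hull K)) →
      Fintype.card (Patch T i) ≤ N → 0 ≤ B →
      IsNodalSolution T ΓD A f g uh i b →
      (∀ b', IsNodalSolution T ΓD A f g uh i b' → nodalCost T qn i b ≤ nodalCost T qn i b') →
      (∀ e, i ∈ e → ∀ K ∈ T.adj e, ∀ J ∈ T.adj e, K ≠ J →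
        meanFlux T qn i J e = -meanFlux T qn i K e) →
      (∀ e ∈ T.neumannEdges ΓD, i ∈ e → ∀ K ∈ T.adj e, |b K e - meanFlux T qn i K e| ≤ B) →
      (∀ K ∈ T.elems, i ∈ K → |∑ e ∈ edgesOf K with i ∈ e, (b K e - meanFlux T qn i K e)| ≤ B) →
      ∀ K ∈ T.elems, ∀ e ∈ edgesOf K, i ∈ e → |b K e - meanFlux T qn i K e| ≤ C * B := by
  obtain ⟨C, hC0, hC⟩ := exists_bounded_solution (N * 3)
  refine ⟨√(2 * (N * 3 : ℕ)) * C * (M / 2) ^ (N + 1), by positivity, ?_⟩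
  intro T ΓD A f g uh qn b i B hM hN hB hsol hmin hanti hneu hpro K₀ hK₀ e₀ he₀ hi₀
  have hiK : ∀ {K e : Finset Plane}, e ∈ edgesOf K → i ∈ e → i ∈ K := fun he hi =>
    (Finset.mem_powersetCard.1 he).1 hi
  set k₀ : Patch T i := ⟨K₀, hK₀, hiK he₀ hi₀⟩ with hk₀
  -- Only the component of `K₀` is modified: elements that merely touch at `i`, with no chain of
  -- shared edges between them, may have very different sizes. `D` collects its unknowns, one for
  -- each element and each edge at `i`.
  set S : Finset (Patch T i) := Finset.univ.filter fun K => (patchGraph T i).Reachable k₀ K with hS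
  have hmemS : ∀ K, K ∈ S ↔ (patchGraph T i).Reachable k₀ K := fun K => by simp [hS]
  set D : Finset (Finset Plane × Finset Plane) :=
    S.biUnion fun K => ((edgesOf K.1).filter fun e => i ∈ e).image fun e => (K.1, e) with hD
  have hmemD : ∀ K e, (K, e) ∈ D ↔ ∃ k ∈ S, k.1 = K ∧ e ∈ edgesOf K ∧ i ∈ e := by
    intro K e
    simp only [hD, Finset.mem_biUnion, Finset.mem_image, Finset.mem_filter, Prod.mk.injEq]
    constructor
    · rintro ⟨k, hk, e', ⟨h1, h2⟩, h3, rfl⟩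
      exact ⟨k, hk, h3, h3 ▸ h1, h2⟩
    · rintro ⟨k, hk, rfl, h1, h2⟩
      exact ⟨k, hk, e, ⟨h1, h2⟩, rfl, rfl⟩
  have hDcard : D.card ≤ N * 3 := by
    calc D.card ≤ S.card * 3 := by
          refine Finset.card_biUnion_le_card_mul _ _ _ fun K _ => ?_
          refine Finset.card_image_le.trans ((Finset.card_filter_le _ _).trans ?_)
          rw [edgesOf, Finset.card_powersetCard, T.card_eq K.1 K.2.1]
          decide
      _ ≤ N * 3 := by
          gcongr
          exact (Finset.card_le_univ S).trans hN
  have hclosed : ∀ {K J e}, K ∈ T.adj e → J ∈ T.adj e → i ∈ e → (K, e) ∈ D → (J, e) ∈ D := by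
    intro K J e hK hJ hi hKD
    obtain ⟨k, hk, hkK, heK, _⟩ := (hmemD K e).1 hKD
    obtain ⟨hJ1, hJ2⟩ := TriMesh.mem_adj.1 hJ
    refine (hmemD J e).2 ⟨⟨J, hJ1, hiK hJ2 hi⟩, ?_, rfl, hJ2, hi⟩
    rw [hmemS] at hk ⊢
    by_cases hkJ : k = ⟨J, hJ1, hiK hJ2 hi⟩
    · rwa [← hkJ]
    · refine hk.trans (SimpleGraph.Adj.reachable ⟨hkJ, e, ?_, hJ2, hi⟩)
      rwa [hkK]
  obtain ⟨x, hx⟩ : ∃ x : Finset Plane × Finset Plane → ℝ,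
      ∀ K e, x (K, e) = b K e - meanFlux T qn i K e :=
    ⟨fun p => b p.1 p.2 - meanFlux T qn i p.1 p.2, fun _ _ => rfl⟩
  -- All constraints on `b - b^m` are sums over sets of unknowns: opposite values on interior edges,
  -- values on Neumann edges, prolongation on elements. Those of the component form a closed
  -- subsystem, by `hclosed`.
  set 𝒮 : Set (Finset (Finset Plane × Finset Plane)) := {s |
    (∃ e K J, K ≠ J ∧ K ∈ T.adj e ∧ J ∈ T.adj e ∧ i ∈ e ∧ (K, e) ∈ D ∧ s = {(K, e), (J, e)}) ∨
    (∃ e K, e ∈ T.neumannEdges ΓD ∧ K ∈ T.adj e ∧ i ∈ e ∧ (K, e) ∈ D ∧ s = {(K, e)}) ∨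
    (∃ k ∈ S, s = ((edgesOf k.1).filter fun e => i ∈ e).image fun e => (k.1, e))} with h𝒮
  have hsumK : ∀ (K : Finset Plane) (y : Finset Plane × Finset Plane → ℝ),
      ∑ p ∈ ((edgesOf K).filter fun e => i ∈ e).image (fun e => (K, e)), y p =
        ∑ e ∈ edgesOf K with i ∈ e, y (K, e) := fun K y =>
    Finset.sum_image fun e _ e' _ h => (Prod.mk.injEq _ _ _ _ ▸ h).2
  have hsumP : ∀ (K J e : Finset Plane) (y : Finset Plane × Finset Plane → ℝ), K ≠ J →
      ∑ p ∈ ({(K, e), (J, e)} : Finset _), y p = y (K, e) + y (J, e) := fun K J e y hne =>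
    Finset.sum_pair fun h => hne (Prod.mk.injEq _ _ _ _ ▸ h).1
  have hadjE : ∀ {K e}, K ∈ T.adj e → e ∈ T.edges := fun {K e} h =>
    TriMesh.mem_edges.2 ⟨K, TriMesh.mem_adj.1 h⟩
  obtain ⟨x', hx'1, hx'2⟩ := hC D hDcard 𝒮 (by
      rintro s (⟨e, K, J, hne, hK, hJ, hi, hKD, rfl⟩ | ⟨e, K, he, hK, hi, hKD, rfl⟩ | ⟨k, hk, rfl⟩)
      · exact Finset.insert_subset hKD (Finset.singleton_subset_iff.2 (hclosed hK hJ hi hKD))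
      · exact Finset.singleton_subset_iff.2 hKD
      · rw [hD]
        exact Finset.subset_biUnion_of_mem (fun K : Patch T i =>
          ((edgesOf K.1).filter fun e => i ∈ e).image fun e => (K.1, e)) hk) x B hB (by
      rintro s (⟨e, K, J, hne, hK, hJ, hi, hKD, rfl⟩ | ⟨e, K, he, hK, hi, hKD, rfl⟩ | ⟨k, hk, rfl⟩)
      · rw [hsumP K J e x hne]
        have h1 := hsol.opposite e (hadjE hK) hi K hK J hJ hne
        have h2 := hanti e hi K hK J hJ hne
        have : x (K, e) + x (J, e) = 0 := by simp only [hx, h1, h2]; ring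
        rw [this, abs_zero]; exact hB
      · rw [Finset.sum_singleton]
        rw [hx]
        exact hneu e he hi K hK
      · rw [hsumK]
        simp only [hx]
        exact hpro k.1 k.2.1 k.2.2)
  -- The competitor: the bounded solution in the component, `b` elsewhere.
  obtain ⟨b', hb'⟩ : ∃ b' : Finset Plane → Finset Plane → ℝ, ∀ K e, b' K e =
    if (K, e) ∈ D then meanFlux T qn i K e + x' (K, e) else b K e := ⟨_, fun _ _ => rfl⟩
  have hb'1 : ∀ {K e}, (K, e) ∈ D → b' K e = meanFlux T qn i K e + x' (K, e) :=
    fun h => by rw [hb', if_pos h]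
  have hb'2 : ∀ {K e}, (K, e) ∉ D → b' K e = b K e := fun h => by rw [hb', if_neg h]
  have hsol' : IsNodalSolution T ΓD A f g uh i b' := by
    refine ⟨?_, ?_, ?_⟩
    · intro e he hi K hK J hJ hne
      by_cases hKD : (K, e) ∈ D
      · have hJD := hclosed hK hJ hi hKD
        have h1 := hx'1 _ (Or.inl ⟨e, K, J, hne, hK, hJ, hi, hKD, rfl⟩)
        rw [hsumP K J e x hne, hsumP K J e x' hne] at h1
        have h2 := hsol.opposite e he hi K hK J hJ hne
        have h3 := hanti e hi K hK J hJ hne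
        rw [hb'1 hKD, hb'1 hJD, h3]
        simp only [hx, h2, h3] at h1
        linarith
      · have hJD : (J, e) ∉ D := fun h => hKD (hclosed hJ hK hi h)
        rw [hb'2 hKD, hb'2 hJD]
        exact hsol.opposite e he hi K hK J hJ hne
    · intro e he hi K hK
      rw [← hsol.neumann e he hi K hK]
      by_cases hKD : (K, e) ∈ D
      · have h1 := hx'1 _ (Or.inr (Or.inl ⟨e, K, he, hK, hi, hKD, rfl⟩))
        rw [Finset.sum_singleton, Finset.sum_singleton] at h1
        rw [hb'1 hKD, h1]
        simp only [hx]; ring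
      · exact hb'2 hKD
    · intro K hK hi
      rw [← hsol.prolongation K hK hi]
      by_cases hk : (⟨K, hK, hi⟩ : Patch T i) ∈ S
      · have h1 := hx'1 _ (Or.inr (Or.inr ⟨_, hk, rfl⟩))
        rw [hsumK, hsumK] at h1
        simp only [hx, Finset.sum_sub_distrib] at h1
        have h2 : ∑ e ∈ edgesOf K with i ∈ e, b' K e =
            ∑ e ∈ edgesOf K with i ∈ e, (meanFlux T qn i K e + x' (K, e)) := by
          refine Finset.sum_congr rfl fun e he => ?_
          rw [Finset.mem_filter] at he
          exact hb'1 ((hmemD K e).2 ⟨_, hk, rfl, he.1, he.2⟩)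
        rw [h2, Finset.sum_add_distrib, h1]
        ring
      · refine Finset.sum_congr rfl fun e he => hb'2 fun hD' => ?_
        obtain ⟨k, hkS, hkK, _⟩ := (hmemD K e).1 hD'
        have : k = ⟨K, hK, hi⟩ := Subtype.ext hkK
        exact hk (this ▸ hkS)
  obtain ⟨F, hF⟩ : ∃ F : (Finset Plane → Finset Plane → ℝ) → Finset Plane → ℝ, ∀ b e, F b e =
    ((T.adj e).card : ℝ)⁻¹ * ∑ K ∈ T.adj e,
      (b K e - meanFlux T qn i K e) ^ 2 / edgeLength e ^ 2 := ⟨_, fun _ _ => rfl⟩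
  have hcost : ∑ e ∈ T.edges with i ∈ e, F b e ≤ ∑ e ∈ T.edges with i ∈ e, F b' e := by
    simp only [hF]
    exact hmin b' hsol'
  set Es : Finset (Finset Plane) := (T.edges.filter fun e => i ∈ e).filter
    fun e => ∃ K ∈ T.adj e, (K, e) ∈ D with hEs
  -- Outside the component the two costs coincide and cancel, so minimality localizes to `Es`.
  have hcost2 : ∑ e ∈ Es, F b e ≤ ∑ e ∈ Es, F b' e := by
    rw [← Finset.sum_filter_add_sum_filter_not (T.edges.filter fun e => i ∈ e)
      (fun e => ∃ K ∈ T.adj e, (K, e) ∈ D) (F b), ← Finset.sum_filter_add_sum_filter_not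
      (T.edges.filter fun e => i ∈ e) (fun e => ∃ K ∈ T.adj e, (K, e) ∈ D) (F b')] at hcost
    have heq : ∑ e ∈ (T.edges.filter fun e => i ∈ e) with ¬ ∃ K ∈ T.adj e, (K, e) ∈ D, F b e =
        ∑ e ∈ (T.edges.filter fun e => i ∈ e) with ¬ ∃ K ∈ T.adj e, (K, e) ∈ D, F b' e := by
      refine Finset.sum_congr rfl fun e he => ?_
      have hn := (Finset.mem_filter.1 he).2
      rw [hF, hF]
      congr 1
      refine Finset.sum_congr rfl fun K hK => ?_
      rw [hb'2 fun h => hn ⟨K, hK, h⟩]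
    rw [heq] at hcost
    exact le_of_add_le_add_right hcost
  have hk₀S : k₀ ∈ S := (hmemS _).2 (SimpleGraph.Reachable.refl _)
  have hD₀ : (K₀, e₀) ∈ D := (hmemD _ _).2 ⟨k₀, hk₀S, rfl, he₀, hi₀⟩
  have hadj₀ : K₀ ∈ T.adj e₀ := TriMesh.mem_adj.2 ⟨hK₀, he₀⟩
  have he₀Es : e₀ ∈ Es := by
    simp only [hEs, Finset.mem_filter]
    exact ⟨⟨hadjE hadj₀, hi₀⟩, K₀, hadj₀, hD₀⟩
  have hl₀ := edgeLength_pos he₀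
  set Λ : ℝ := (M / 2) ^ (N + 1) with hΛ
  have hEsCard : Es.card ≤ N * 3 := by
    refine le_trans ?_ hDcard
    refine (Finset.card_le_card (t := D.image Prod.snd) fun e he => ?_).trans Finset.card_image_le
    obtain ⟨K, _, hKD⟩ := (Finset.mem_filter.1 he).2
    exact Finset.mem_image.2 ⟨(K, e), hKD, rfl⟩
  -- Comparability of lengths within the component replaces each weight by that of `e₀`, so that
  -- this weight cancels at the end.
  have hFb' : ∀ e ∈ Es, F b' e ≤ (C * B) ^ 2 * Λ ^ 2 / edgeLength e₀ ^ 2 := by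
    intro e he
    obtain ⟨he1, K, hK, hKD⟩ := Finset.mem_filter.1 he
    have hi := (Finset.mem_filter.1 he1).2
    have hcard : 0 < (T.adj e).card := Finset.card_pos.2 ⟨K, hK⟩
    have hcard' : (0 : ℝ) < (T.adj e).card := by exact_mod_cast hcard
    have hterm : ∀ J ∈ T.adj e, (b' J e - meanFlux T qn i J e) ^ 2 / edgeLength e ^ 2 ≤
        (C * B) ^ 2 * Λ ^ 2 / edgeLength e₀ ^ 2 := by
      intro J hJ
      have hJD := hclosed hK hJ hi hKD
      obtain ⟨k, hkS, hkJ, heJ, _⟩ := (hmemD J e).1 hJD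
      have hl := edgeLength_pos heJ
      rw [hb'1 hJD, add_sub_cancel_left, div_le_div_iff₀ (by positivity) (by positivity)]
      have h1 : x' (J, e) ^ 2 ≤ (C * B) ^ 2 := sq_le_sq' (abs_le.1 (hx'2 _ hJD)).1
        (abs_le.1 (hx'2 _ hJD)).2
      have h2 : edgeLength e₀ ≤ Λ * edgeLength e :=
        edgeLength_le_of_reachable hM2 hM hN ((hmemS k).1 hkS) he₀ (hkJ ▸ heJ)
      calc x' (J, e) ^ 2 * edgeLength e₀ ^ 2 ≤ (C * B) ^ 2 * (Λ * edgeLength e) ^ 2 := by gcongr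
        _ = _ := by ring
    calc F b' e ≤ ((T.adj e).card : ℝ)⁻¹ * ∑ K ∈ T.adj e,
          (C * B) ^ 2 * Λ ^ 2 / edgeLength e₀ ^ 2 := by
          rw [hF]
          exact mul_le_mul_of_nonneg_left (Finset.sum_le_sum hterm) (by positivity)
      _ = _ := by rw [Finset.sum_const, nsmul_eq_mul, inv_mul_cancel_left₀ hcard'.ne']
  -- The factor `1 / 2` is the average over at most two elements; with the `3 N` terms of the
  -- competitor it produces `√(2 * (3 N))`.
  have hFb : 1 / 2 * (x (K₀, e₀) ^ 2 / edgeLength e₀ ^ 2) ≤ ∑ e ∈ Es, F b e := by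
    have hFnn : ∀ e ∈ Es, 0 ≤ F b e := fun e _ => by rw [hF]; positivity
    refine le_trans ?_ (Finset.single_le_sum hFnn he₀Es)
    have hcard : 0 < (T.adj e₀).card := Finset.card_pos.2 ⟨K₀, hadj₀⟩
    have hcard' : (0 : ℝ) < (T.adj e₀).card := by exact_mod_cast hcard
    have hcard2 : ((T.adj e₀).card : ℝ) ≤ 2 := by exact_mod_cast T.card_adj_le e₀
    have h1 : (1 / 2 : ℝ) ≤ ((T.adj e₀).card : ℝ)⁻¹ := by
      rw [one_div]; exact inv_anti₀ hcard' hcard2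
    rw [hF, hx]
    refine mul_le_mul h1 ?_ (by positivity) (by positivity)
    exact Finset.single_le_sum
      (f := fun K => (b K e₀ - meanFlux T qn i K e₀) ^ 2 / edgeLength e₀ ^ 2)
      (fun K _ => by positivity) hadj₀
  have hfin : x (K₀, e₀) ^ 2 ≤ (√(2 * (N * 3 : ℕ)) * C * Λ * B) ^ 2 := by
    have h1 : ∑ e ∈ Es, F b' e ≤ (N * 3 : ℕ) * ((C * B) ^ 2 * Λ ^ 2 / edgeLength e₀ ^ 2) := by
      calc ∑ e ∈ Es, F b' e ≤ Es.card • ((C * B) ^ 2 * Λ ^ 2 / edgeLength e₀ ^ 2) :=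
            Finset.sum_le_card_nsmul _ _ _ hFb'
        _ ≤ _ := by
            rw [nsmul_eq_mul]
            gcongr
    have h2 := (hFb.trans hcost2).trans h1
    rw [mul_pow, mul_pow, mul_pow, Real.sq_sqrt (by positivity)]
    have h3 : 1 / 2 * (x (K₀, e₀) ^ 2 / edgeLength e₀ ^ 2) =
      (1 / 2 * x (K₀, e₀) ^ 2) / edgeLength e₀ ^ 2 := by ring
    rw [h3, ← mul_div_assoc, div_le_div_iff_of_pos_right (by positivity)] at h2
    nlinarith
  have := abs_le_of_sq_le_sq hfin (by positivity)
  rwa [hx] at this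

/-! ### From the nodal problems to the tractions -/

open Classical in
theorem exists_pair_of_mem {K e : Finset Plane} {i : Plane} (he : e ∈ edgesOf K) (hi : i ∈ e) :
    ∃ j, i ≠ j ∧ e = {i, j} := by
  obtain ⟨a, b, _, _, hab, rfl⟩ := exists_pair_of_mem_edgesOf he
  rcases Finset.mem_insert.1 hi with rfl | hi
  · exact ⟨b, hab, rfl⟩
  · rw [Finset.mem_singleton] at hi
    subst hi
    exact ⟨a, hab.symm, Finset.pair_comm _ _⟩

theorem TriMesh.integral_edge_shape {T : TriMesh} {K e : Finset Plane} {i : Plane}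
    (hK : K ∈ T.adj e) (hi : i ∈ e) :
    ∫ x, shape K i x ∂(edgeMeasure e) = edgeLength e / 2 := by
  classical
  obtain ⟨j, hij, rfl⟩ := exists_pair_of_mem (TriMesh.mem_adj.1 hK).2 hi
  obtain ⟨c, h⟩ := T.exists_isTri_of_mem_adj hij hK
  rw [h.integral_edge_shape, edgeLength_pair]

theorem TriMesh.shape_eq_zero {T : TriMesh} {K e : Finset Plane} {i x : Plane}
    (hK : K ∈ T.adj e) (hi : i ∉ e) (hx : x ∈ hull e) : shape K i x = 0 := by
  have he := (Finset.mem_powersetCard.1 (TriMesh.mem_adj.1 hK).2).1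
  refine convexHull_min (t := {x | shape K i x = 0}) (fun y hy => ?_)
    (convex_shape_eq_zero K i) hx
  have hyi : y ≠ i := fun h => hi (h ▸ hy)
  show shape K i y = 0
  rw [shape_apply (T.indep K (TriMesh.mem_adj.1 hK).1) i (he hy), if_neg hyi]

/-- The energy of the error on the patch of the vertex `i`. -/
noncomputable def patchError (T : TriMesh) (A : Plane → Plane →L[ℝ] Plane) (G : Plane → Plane)
    (uh : Plane → ℝ) (i : Plane) : ℝ :=
  open Classical in ∑ K ∈ T.elems with i ∈ K, elemError A G uh K

theorem meanFlux_eq {T : TriMesh} {qn : Finset Plane → Finset Plane → ℝ} {K e : Finset Plane}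
    {i : Plane} (hK : K ∈ T.adj e) (hi : i ∈ e) : meanFlux T qn i K e = edgeLength e / 2 *
      (((T.adj e).card : ℝ)⁻¹ *
        ∑ J ∈ T.adj e, open Classical in if J = K then qn J e else -qn J e) := by
  rw [meanFlux, integral_mul_const, TriMesh.integral_edge_shape hK hi]

theorem meanFlux_boundary {T : TriMesh} {qn : Finset Plane → Finset Plane → ℝ}
    {K e : Finset Plane} {i : Plane} (hK : K ∈ T.adj e) (hi : i ∈ e) (hcard : (T.adj e).card = 1) :
    meanFlux T qn i K e = qn K e * (edgeLength e / 2) := by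
  obtain ⟨J, hJ⟩ := Finset.card_eq_one.1 hcard
  have : J = K := by rw [hJ, Finset.mem_singleton] at hK; exact hK.symm
  subst this
  rw [meanFlux_eq hK hi, hJ]
  simp
  ring

theorem TriMesh.adj_eq_pair {T : TriMesh} {K J e : Finset Plane} (hK : K ∈ T.adj e)
    (hJ : J ∈ T.adj e) (hne : K ≠ J) : T.adj e = (open Classical in {K, J}) := by
  classical
  symm
  have : ({K, J} : Finset (Finset Plane)) = T.adj e := Finset.eq_of_subset_of_card_le
    (Finset.insert_subset hK (Finset.singleton_subset_iff.2 hJ))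
    (by rw [Finset.card_pair hne]; exact T.card_adj_le e)
  convert this

theorem meanFlux_interior {T : TriMesh} {qn : Finset Plane → Finset Plane → ℝ}
    {K J e : Finset Plane} {i : Plane} (hK : K ∈ T.adj e) (hJ : J ∈ T.adj e) (hne : K ≠ J)
    (hi : i ∈ e) : meanFlux T qn i K e = edgeLength e / 4 * (qn K e - qn J e) := by
  classical
  rw [meanFlux_eq hK hi, TriMesh.adj_eq_pair hK hJ hne, Finset.card_pair hne, Finset.sum_pair hne]
  simp [hne.symm]
  ring

namespace IsSetting

variable {T : TriMesh} {ΓD : Finset (Finset Plane)} {aMin aMax M : ℝ}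
  {A : Plane → Plane →L[ℝ] Plane} {f g : Plane → ℝ} {u : H1 T.domain} {uh : Plane → ℝ}
  {qn : Finset Plane → Finset Plane → ℝ} {K e : Finset Plane} {i : Plane}

theorem patchError_nonneg (S : IsSetting T ΓD aMin aMax M A f g u uh qn) (i : Plane) :
    0 ≤ patchError T A u.grad uh i := by
  classical
  exact Finset.sum_nonneg fun K hK => S.elemError_nonneg (Finset.mem_filter.1 hK).1

theorem sqrt_elemError_le (S : IsSetting T ΓD aMin aMax M A f g u uh qn) (hK : K ∈ T.elems)
    (hi : i ∈ K) : √(elemError A u.grad uh K) ≤ √(patchError T A u.grad uh i) := by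
  classical
  apply Real.sqrt_le_sqrt
  exact Finset.single_le_sum (f := fun K => elemError A u.grad uh K)
    (fun K hK => S.elemError_nonneg (Finset.mem_filter.1 hK).1) (Finset.mem_filter.2 ⟨hK, hi⟩)

/-- The difference is half of the jump term on an interior edge, and zero on a boundary edge. -/
theorem abs_sub_meanFlux_le (S : IsSetting T ΓD aMin aMax M A f g u uh qn) (hK : K ∈ T.adj e)
    (hi : i ∈ e) : |qn K e * (edgeLength e / 2) - meanFlux T qn i K e| ≤
      6253 * (√(aMax * M) * √(patchError T A u.grad uh i)) := by
  classical
  have hB : 0 ≤ 6253 * (√(aMax * M) * √(patchError T A u.grad uh i)) := by positivity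
  by_cases hJ : ∃ J ∈ T.adj e, K ≠ J
  · obtain ⟨J, hJ, hne⟩ := hJ
    have hadj := TriMesh.adj_eq_pair hK hJ hne
    obtain ⟨j, hij, rfl⟩ := exists_pair_of_mem (TriMesh.mem_adj.1 hK).2 hi
    have h1 := S.abs_jump_le hij (by rw [hadj, Finset.card_pair hne])
    rw [hadj, Finset.sum_pair hne, Finset.sum_pair hne, ← edgeLength_pair] at h1
    have hmem : ∀ {L}, L ∈ T.adj {i, j} → √(elemError A u.grad uh L) ≤
        √(patchError T A u.grad uh i) := fun hL =>
      S.sqrt_elemError_le (TriMesh.mem_adj.1 hL).1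
        ((Finset.mem_powersetCard.1 (TriMesh.mem_adj.1 hL).2).1 (by simp))
    have h2 := mul_le_mul_of_nonneg_left (hmem hK) (Real.sqrt_nonneg (aMax * M))
    have h3 := mul_le_mul_of_nonneg_left (hmem hJ) (Real.sqrt_nonneg (aMax * M))
    rw [meanFlux_interior hK hJ hne hi]
    have : qn K {i, j} * (edgeLength {i, j} / 2) -
        edgeLength {i, j} / 4 * (qn K {i, j} - qn J {i, j}) =
        1 / 2 * ((qn K {i, j} + qn J {i, j}) * (edgeLength {i, j} / 2)) := by ring
    rw [this, abs_mul, abs_of_pos (by norm_num : (0 : ℝ) < 1 / 2)]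
    linarith
  · push Not at hJ
    have hcard : (T.adj e).card = 1 :=
      Finset.card_eq_one.2 ⟨K, Finset.eq_singleton_iff_unique_mem.2
        ⟨hK, fun J hJ' => (hJ J hJ').symm⟩⟩
    rw [meanFlux_boundary hK hi hcard, sub_self, abs_zero]
    exact hB

open Classical in
-- The divergence-free flux `q_h`, integrated by parts against `φ_i`, yields exactly its edge
-- moments. In the prolongation condition only the source remains, and `φ_i` has mean `1 / 3`.
theorem sum_nodal_sub (S : IsSetting T ΓD aMin aMax M A f g u uh qn) (hK : K ∈ T.elems)
    (hi : i ∈ K) {k : ℝ} (hk : ∀ᵐ x ∂(volume.restrict (hull K)), f x = k)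
    {b : Finset Plane → Finset Plane → ℝ} (hb : IsNodalSolution T ΓD A f g uh i b) :
    ∑ e ∈ edgesOf K with i ∈ e, (b K e - qn K e * (edgeLength e / 2)) =
      -(k * (volume.real (hull K) / 3)) := by
  obtain ⟨a', b', c', h⟩ : ∃ a b c, IsTri K a b c := T.exists_isTri hK
  obtain ⟨j, l, h⟩ : ∃ j l, IsTri K i j l := by
    rcases (h.mem i).1 hi with rfl | rfl | rfl
    exacts [⟨_, _, h⟩, ⟨_, _, h.rotate⟩, ⟨_, _, h.rotate.rotate⟩]
  have h1 : ∫ x in hull K, ⟪feFlux A uh x, shapeGrad K i⟫ =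
      ∑ e ∈ edgesOf K with i ∈ e, qn K e * (edgeLength e / 2) := by
    have := S.integral_feFlux hK (contDiff_shape K i)
    simp only [gradient_shape] at this
    rw [this, Finset.sum_filter]
    refine Finset.sum_congr rfl fun e he => ?_
    have hadj : K ∈ T.adj e := TriMesh.mem_adj.2 ⟨hK, he⟩
    split_ifs with hie
    · rw [integral_mul_const, TriMesh.integral_edge_shape hadj hie, mul_comm]
    · exact integral_edge_eq_zero fun x hx => by
        rw [TriMesh.shape_eq_zero hadj hie hx, zero_mul]
  have hae : (fun x => f x * shape K i x) =ᵐ[volume.restrict (hull K)]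
      fun x => k * shape K i x := hk.mono fun x hx => by simp only [hx]
  have hintg : IntegrableOn (fun x => k * shape K i x) (hull K) :=
    (Continuous.continuousOn (continuous_const.mul (continuous_shape K i))).integrableOn_compact
      (isCompact_hull K)
  have h2 : nodalLoad A f uh K i = (∑ e ∈ edgesOf K with i ∈ e, qn K e * (edgeLength e / 2)) -
      k * (volume.real (hull K) / 3) := by
    rw [nodalLoad, integral_sub, h1, integral_congr_ae hae, integral_const_mul, h.integral_shape]
    · exact integrable_inner_of_memLp (S.memLp_feFlux hK)
        (memLp_hull_of_continuous K continuous_const)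
    · exact hintg.congr hae.symm
  rw [Finset.sum_sub_distrib, hb.prolongation K hK hi, h2]
  ring

end IsSetting

open Classical in
/-- The equilibrated tractions are close to the normal fluxes of the finite element solution. -/
theorem exists_traction_bound (M : ℝ) (hM2 : 2 ≤ M) (N : ℕ) : ∃ C : ℝ, 0 ≤ C ∧
    ∀ {T : TriMesh} {ΓD : Finset (Finset Plane)} {aMin aMax : ℝ} {A : Plane → Plane →L[ℝ] Plane}
      {f g : Plane → ℝ} {u : H1 T.domain} {uh : Plane → ℝ} {qn : Finset Plane → Finset Plane → ℝ}
      {i : Plane} {b : Finset Plane → Finset Plane → ℝ},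
      IsSetting T ΓD aMin aMax M A f g u uh qn → Fintype.card (Patch T i) ≤ N →
      IsNodalSolution T ΓD A f g uh i b →
      (∀ b', IsNodalSolution T ΓD A f g uh i b' → nodalCost T qn i b ≤ nodalCost T qn i b') →
      ∀ K ∈ T.elems, ∀ e ∈ edgesOf K, i ∈ e → |b K e - qn K e * (edgeLength e / 2)| ≤
        C * (√(aMax * M) * √(patchError T A u.grad uh i)) := by
  obtain ⟨C, hC0, hC⟩ := exists_nodal_bound M hM2 N
  refine ⟨C * 20000 + 6253, by positivity, ?_⟩
  intro T ΓD aMin aMax A f g u uh qn i b S hN hb hmin K hK e he hi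
  set η := √(aMax * M) * √(patchError T A u.grad uh i) with hη
  have hη0 : 0 ≤ η := by positivity
  have herr : ∀ {K : Finset Plane}, K ∈ T.elems → i ∈ K →
      √(aMax * M) * √(elemError A u.grad uh K) ≤ η := fun hK hi =>
    mul_le_mul_of_nonneg_left (S.sqrt_elemError_le hK hi) (Real.sqrt_nonneg _)
  -- The Neumann data are bounded by `6253 η`, the prolongation data by `780 / 3 + 3 * 6253 = 19019`
  -- times `η`.
  have key := hC T ΓD A f g uh qn b i (20000 * η) S.area hN (by positivity) hb hmin
    (by
      intro e hi K hK J hJ hne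
      rw [meanFlux_interior hK hJ hne hi, meanFlux_interior hJ hK hne.symm hi]
      ring)
    (by
      intro e he hi K hK
      have he' := he
      rw [TriMesh.neumannEdges, Finset.mem_sdiff] at he'
      rw [meanFlux_boundary hK hi (TriMesh.mem_boundaryEdges.1 he'.1).2, hb.neumann e he hi K hK]
      have hK' := TriMesh.mem_adj.1 hK
      have h2 := herr hK'.1 ((Finset.mem_powersetCard.1 hK'.2).1 hi)
      obtain ⟨j, hij, rfl⟩ := exists_pair_of_mem hK'.2 hi
      have h1 := S.abs_neumann_le hij he hK
      rw [edgeLength_pair]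
      linarith)
    (by
      intro K hK hi
      obtain ⟨k, hk⟩ := S.const K hK
      have h1 := S.sum_nodal_sub hK hi hk hb
      have h2 := S.volume_mul_abs_le hK hk
      have h3 := herr hK hi
      have h4 : ∑ e ∈ edgesOf K with i ∈ e, (b K e - meanFlux T qn i K e) =
          -(k * (volume.real (hull K) / 3)) +
          ∑ e ∈ edgesOf K with i ∈ e, (qn K e * (edgeLength e / 2) - meanFlux T qn i K e) := by
        rw [← h1, ← Finset.sum_add_distrib]
        exact Finset.sum_congr rfl fun e _ => by ring
      have h5 : |∑ e ∈ edgesOf K with i ∈ e,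
          (qn K e * (edgeLength e / 2) - meanFlux T qn i K e)| ≤ 3 * (6253 * η) := by
        refine (Finset.abs_sum_le_sum_abs _ _).trans ?_
        refine (Finset.sum_le_card_nsmul _ _ (6253 * η) fun e he => ?_).trans ?_
        · rw [Finset.mem_filter] at he
          exact S.abs_sub_meanFlux_le (TriMesh.mem_adj.2 ⟨hK, he.1⟩) he.2
        · rw [nsmul_eq_mul]
          have hc : (({e ∈ edgesOf K | i ∈ e} : Finset _).card : ℝ) ≤ 3 := by
            have : ({e ∈ edgesOf K | i ∈ e} : Finset _).card ≤ 3 := by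
              refine (Finset.card_filter_le _ _).trans ?_
              rw [edgesOf, Finset.card_powersetCard, T.card_eq K hK]
              decide
            exact_mod_cast this
          gcongr
      rw [h4]
      refine (abs_add_le _ _).trans ?_
      rw [abs_neg, abs_mul, abs_of_nonneg (by positivity : 0 ≤ volume.real (hull K) / 3)]
      linarith)
    K hK e he hi
  have h2 := S.abs_sub_meanFlux_le (TriMesh.mem_adj.2 ⟨hK, he⟩) hi
  have h3 : b K e - qn K e * (edgeLength e / 2) = (b K e - meanFlux T qn i K e) -
    (qn K e * (edgeLength e / 2) - meanFlux T qn i K e) := by ring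
  rw [h3]
  refine (abs_sub _ _).trans ?_
  rw [← hη] at h2
  linarith

/-! ### A local equilibrated field -/

/-- The vertex of the triangle `K` opposite to the edge `e`. -/
noncomputable def oppVertex (K e : Finset Plane) : Plane := open Classical in ∑ z ∈ K \ e, z

open Classical in
theorem IsTri.oppVertex_eq {K : Finset Plane} {a b c : Plane} (h : IsTri K a b c) :
    oppVertex K {a, b} = c := by
  have hs : K \ {a, b} = {c} := by
    ext x
    simp only [Finset.mem_sdiff, h.mem, Finset.mem_insert, Finset.mem_singleton]
    have h1 := h.ac.symm
    have h2 := h.bc.symm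
    constructor
    · tauto
    · rintro rfl; tauto
  rw [oppVertex, hs, Finset.sum_singleton]

/-- The affine field on `K` whose normal component on each edge `e` is
`∑_{i ∈ e} κ i e φ_i / |e|`. -/
noncomputable def edgeField (K : Finset Plane) (κ : Plane → Finset Plane → ℝ) (x : Plane) : Plane :=
  ∑ e ∈ edgesOf K, ∑ i ∈ e,
    (κ i e / (2 * volume.real (hull K)) * shape K i x) • (i - oppVertex K e)

theorem continuous_edgeField (K : Finset Plane) (κ : Plane → Finset Plane → ℝ) :
    Continuous (edgeField K κ) := by
  unfold edgeField
  refine continuous_finsetSum _ fun e _ => continuous_finsetSum _ fun i _ => ?_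
  exact (continuous_const.mul (continuous_shape K i)).smul continuous_const

/-- Let `c` be the vertex opposite to `e = {i, j}`. The field `φ_i (i - c)` has divergence `1`,
vanishes on `{j, c}` and is tangent to `{i, c}`; its only normal trace is on `e`, where it equals
`φ_i` times the height `2 |K| / |e|`. -/
theorem TriMesh.integral_edgeField {T : TriMesh} {K e : Finset Plane} (hK : K ∈ T.adj e) {i : Plane}
    (hi : i ∈ e) {ψ : Plane → ℝ} (hψ : ContDiff ℝ ∞ ψ) :
    ∫ x in hull K, (shape K i x * fderiv ℝ ψ x (i - oppVertex K e) + ψ x) =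
      2 * volume.real (hull K) * ((edgeLength e)⁻¹ * ∫ x, shape K i x * ψ x ∂(edgeMeasure e)) := by
  classical
  obtain ⟨j, hij, rfl⟩ := exists_pair_of_mem (TriMesh.mem_adj.1 hK).2 hi
  obtain ⟨c, h⟩ := T.exists_isTri_of_mem_adj hij hK
  have hs := contDiff_shape K i
  have hd : ∀ x, fderiv ℝ (fun y => shape K i y * ψ y) x (i - c) =
      shape K i x * fderiv ℝ ψ x (i - c) + ψ x := by
    intro x
    rw [fderiv_fun_mul (hs.differentiable (by simp) x) (hψ.differentiable (by simp) x)]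
    have h1 : fderiv ℝ (fun y => shape K i y) x (i - c) = 1 := by
      rw [← inner_gradient_left, gradient_shape, inner_shapeGrad, h.shape_aa, h.shape_ac, sub_zero]
    simp [h1]
  rw [h.oppVertex_eq]
  simp only [← hd]
  have h' : IsTri K c j i := h.rotate.swap
  have h0 : ∫ x, shape K i x * ψ x ∂(edgeMeasure {c, j}) = 0 :=
    integral_edge_eq_zero fun x hx => by rw [h'.shape_edge hx, zero_mul]
  rw [h'.integral_fderiv_direction (F := fun y => shape K i y * ψ y)
    ((hs.mul hψ).of_le (by simp)), h0, Finset.pair_comm j i, edgeLength_pair, norm_sub_rev]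
  ring

open Classical in
theorem edgeField_normalTrace {T : TriMesh} {K : Finset Plane} (hK : K ∈ T.elems)
    (κ : Plane → Finset Plane → ℝ) {ψ : Plane → ℝ} (hψ : ContDiff ℝ ∞ ψ) :
    ∫ x in hull K, (⟪edgeField K κ x, gradient ψ x⟫ +
        (∑ e ∈ edgesOf K, ∑ i ∈ e, κ i e / (2 * volume.real (hull K))) * ψ x) =
      ∑ e ∈ edgesOf K, ∫ x, (∑ i ∈ e, κ i e / edgeLength e * shape K i x) * ψ x
        ∂(edgeMeasure e) := by
  obtain ⟨a, b, c, h⟩ := T.exists_isTri hK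
  have hv := h.volume_pos
  have hcd := hψ.continuous_fderiv (by simp)
  have hc := hψ.continuous
  have e1 : ∀ x, ⟪edgeField K κ x, gradient ψ x⟫ +
      (∑ e ∈ edgesOf K, ∑ i ∈ e, κ i e / (2 * volume.real (hull K))) * ψ x =
      ∑ e ∈ edgesOf K, ∑ i ∈ e, κ i e / (2 * volume.real (hull K)) *
        (shape K i x * fderiv ℝ ψ x (i - oppVertex K e) + ψ x) := by
    intro x
    rw [real_inner_comm, inner_gradient_left, edgeField, map_sum, Finset.sum_mul,
      ← Finset.sum_add_distrib]
    refine Finset.sum_congr rfl fun e _ => ?_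
    rw [map_sum, Finset.sum_mul, ← Finset.sum_add_distrib]
    refine Finset.sum_congr rfl fun i _ => ?_
    rw [map_smul, smul_eq_mul]
    ring
  simp only [e1]
  have hintg : ∀ e i, IntegrableOn (fun x => κ i e / (2 * volume.real (hull K)) *
      (shape K i x * fderiv ℝ ψ x (i - oppVertex K e) + ψ x)) (hull K) := by
    intro e i
    have := continuous_shape K i
    exact (Continuous.continuousOn (by fun_prop)).integrableOn_compact (isCompact_hull K)
  rw [integral_finsetSum _ fun e _ => integrable_finsetSum _ fun i _ => hintg e i]
  refine Finset.sum_congr rfl fun e he => ?_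
  rw [integral_finsetSum _ fun i _ => hintg e i]
  have hadj : K ∈ T.adj e := TriMesh.mem_adj.2 ⟨hK, he⟩
  simp only [Finset.sum_mul]
  rw [integral_finsetSum]
  · refine Finset.sum_congr rfl fun i hi => ?_
    rw [integral_const_mul, TriMesh.integral_edgeField hadj hi hψ]
    simp only [mul_assoc]
    rw [integral_const_mul]
    field_simp
  · intro i _
    have := continuous_shape K i
    exact integrable_edgeMeasure he (by fun_prop)

/-- Three edges with two endpoints each: six terms of size at most `Y * diam / (2 |K|)`. -/
theorem norm_edgeField_le {T : TriMesh} {K : Finset Plane} (hK : K ∈ T.elems)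
    {κ : Plane → Finset Plane → ℝ} {Y : ℝ} (hκ : ∀ e ∈ edgesOf K, ∀ i ∈ e, |κ i e| ≤ Y)
    {x : Plane} (hx : x ∈ hull K) :
    ‖edgeField K κ x‖ ≤ 3 * Y * Metric.diam (hull K) / volume.real (hull K) := by
  classical
  obtain ⟨a, b, c, h⟩ := T.exists_isTri hK
  have hv := h.volume_pos
  have hterm : ∀ e ∈ edgesOf K, ∀ i ∈ e,
      ‖(κ i e / (2 * volume.real (hull K)) * shape K i x) • (i - oppVertex K e)‖ ≤
        Y / (2 * volume.real (hull K)) * Metric.diam (hull K) := by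
    intro e he i hi
    have hY := hκ e he i hi
    obtain ⟨j, hij, rfl⟩ := exists_pair_of_mem he hi
    obtain ⟨c, h⟩ := T.exists_isTri_of_mem_adj hij (TriMesh.mem_adj.2 ⟨hK, he⟩)
    obtain ⟨h0, h1⟩ := h.shape_mem_Icc hx
    have h2 := h.rotate.rotate.norm_sub_le_diam
    rw [norm_smul, h.oppVertex_eq, Real.norm_eq_abs, abs_mul, abs_div, abs_of_nonneg h0,
      abs_of_pos (by positivity : 0 < 2 * volume.real (hull K))]
    calc |κ i {i, j}| / (2 * volume.real (hull K)) * shape K i x * ‖i - c‖ ≤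
        Y / (2 * volume.real (hull K)) * 1 * Metric.diam (hull K) := by
          have : 0 ≤ Y := (abs_nonneg _).trans hY
          gcongr
      _ = _ := by ring
  have hcard : ∀ e ∈ edgesOf K, e.card = 2 := fun e he => (Finset.mem_powersetCard.1 he).2
  have hcard3 : (edgesOf K).card = 3 := by
    rw [edgesOf, Finset.card_powersetCard, T.card_eq K hK]
    decide
  calc ‖edgeField K κ x‖ ≤ ∑ e ∈ edgesOf K, ∑ i ∈ e,
        Y / (2 * volume.real (hull K)) * Metric.diam (hull K) :=
        norm_sum_le_of_le _ fun e he => norm_sum_le_of_le _ fun i hi => hterm e he i hi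
    _ = ∑ e ∈ edgesOf K, 2 • (Y / (2 * volume.real (hull K)) * Metric.diam (hull K)) :=
        Finset.sum_congr rfl fun e he => by rw [Finset.sum_const, hcard e he]
    _ = _ := by
        rw [Finset.sum_const, hcard3]
        simp only [nsmul_eq_mul, Nat.cast_ofNat]
        field_simp

theorem integral_norm_sq_edgeField_le {T : TriMesh} {K : Finset Plane} (hK : K ∈ T.elems) {M : ℝ}
    (hM : Metric.diam (hull K) ^ 2 ≤ M * volume.real (hull K))
    {κ : Plane → Finset Plane → ℝ} {Y : ℝ} (hκ : ∀ e ∈ edgesOf K, ∀ i ∈ e, |κ i e| ≤ Y) :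
    ∫ x in hull K, ‖edgeField K κ x‖ ^ 2 ≤ 9 * M * Y ^ 2 := by
  obtain ⟨a, b, c, h⟩ := T.exists_isTri hK
  have hv := h.volume_pos
  have hfin := (isCompact_hull K).measure_lt_top (μ := (volume : Measure Plane))
  calc ∫ x in hull K, ‖edgeField K κ x‖ ^ 2
      ≤ ∫ x in hull K, (3 * Y * Metric.diam (hull K) / volume.real (hull K)) ^ 2 := by
        refine setIntegral_mono_on ?_ (integrableOn_const hfin.ne) (measurableSet_hull K)
          fun x hx => pow_le_pow_left₀ (norm_nonneg _) (norm_edgeField_le hK hκ hx) 2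
        have := continuous_edgeField K κ
        exact (Continuous.continuousOn (by fun_prop)).integrableOn_compact (isCompact_hull K)
    _ = 9 * Y ^ 2 * (Metric.diam (hull K) ^ 2 / volume.real (hull K)) := by
        rw [setIntegral_const, smul_eq_mul]
        field_simp
        ring
    _ ≤ 9 * Y ^ 2 * M := by
        gcongr
        rwa [div_le_iff₀ hv]
    _ = _ := by ring

open Classical in
theorem card_patch (T : TriMesh) (i : Plane) :
    Fintype.card (Patch T i) = (T.elems.filter fun K => i ∈ K).card :=
  Fintype.card_of_subtype _ fun K => by rw [Finset.mem_filter]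

theorem coe_sum_smul_affineMap {ι : Type*} (s : Finset ι) (k : ι → ℝ) (l : ι → Plane →ᵃ[ℝ] ℝ)
    (x : Plane) : (∑ j ∈ s, k j • l j) x = ∑ j ∈ s, k j * l j x := by
  classical
  induction s using Finset.induction_on with
  | empty => simp
  | insert j s hj ih => simp [Finset.sum_insert hj, ih]

theorem TriMesh.notMem_interior {T : TriMesh} {K e : Finset Plane} (hK : K ∈ T.adj e) {x : Plane}
    (hx : x ∈ hull e) : x ∉ interior (hull K) := by
  classical
  obtain ⟨a, b, _, _, hab, rfl⟩ := exists_pair_of_mem_edgesOf (TriMesh.mem_adj.1 hK).2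
  obtain ⟨c, h⟩ := T.exists_isTri_of_mem_adj hab hK
  exact fun hi => h.hull_notMem_nhds hx (mem_interior_iff_mem_nhds.1 hi)

open Classical in
/-- An affine function on an edge is determined by its products with the shape functions. -/
theorem TriMesh.affine_eq_of_integral {T : TriMesh} {K e : Finset Plane} (hK : K ∈ T.adj e)
    (l : Plane →ᵃ[ℝ] ℝ) (q : ℝ) {b : Plane → ℝ}
    (hb : ∀ i ∈ e, ∫ x, l x * shape K i x ∂(edgeMeasure e) = b i) {x : Plane} (hx : x ∈ hull e) :
    l x = q + ∑ i ∈ e, (6 * (b i - q * (edgeLength e / 2)) -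
      2 * ∑ j ∈ e, (b j - q * (edgeLength e / 2))) / edgeLength e * shape K i x := by
  obtain ⟨a, a', _, _, hab, rfl⟩ := exists_pair_of_mem_edgesOf (TriMesh.mem_adj.1 hK).2
  obtain ⟨c, h⟩ := T.exists_isTri_of_mem_adj hab hK
  have h1 := hb a (by simp)
  have h2 := hb a' (by simp)
  have hL : 0 < edgeLength {a, a'} := edgeLength_pos h.mem_edgesOf
  rw [h.integral_edge_affine_shape, ← edgeLength_pair] at h1
  rw [Finset.pair_comm, h.swap.integral_edge_affine_shape, ← edgeLength_pair,
    Finset.pair_comm] at h2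
  obtain ⟨s, _, rfl⟩ := (mem_hull_pair_iff c).1 hx
  -- The mass matrix of the edge is `|e| / 6` times `(2 1; 1 2)`. Its inverse sends moments `b` to
  -- the nodal values `(6 b_i - 2 ∑ b_j) / |e|`, applied here after subtracting the moments of the
  -- constant `q`.
  rw [affine_baryPoint, Finset.sum_pair hab, Finset.sum_pair hab, h.shape_a_bary, h.shape_b_bary,
    ← h1, ← h2]
  field_simp
  ring

namespace IsSetting

variable {T : TriMesh} {ΓD : Finset (Finset Plane)} {aMin aMax M : ℝ}
  {A : Plane → Plane →L[ℝ] Plane} {f g : Plane → ℝ} {u : H1 T.domain} {uh : Plane → ℝ}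
  {qn : Finset Plane → Finset Plane → ℝ} {K : Finset Plane}

open Classical in
/-- The finite element flux, corrected by an affine field, is admissible. -/
theorem isAdmissibleFlux (S : IsSetting T ΓD aMin aMax M A f g u uh qn) (hK : K ∈ T.elems)
    {b : Plane → Finset Plane → Finset Plane → ℝ}
    (hb : ∀ i ∈ K, IsNodalSolution T ΓD A f g uh i (b i))
    {ghat : Finset Plane → Plane → ℝ}
    (hg : ∀ e ∈ edgesOf K, ∃ l : Plane →ᵃ[ℝ] ℝ, (∀ᵐ x ∂(edgeMeasure e), ghat e x = l x) ∧
      ∀ i ∈ e, ∫ x, l x * shape K i x ∂(edgeMeasure e) = b i K e) :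
    IsAdmissibleFlux f ghat K (fun x => feFlux A uh x + edgeField K (fun i e =>
      6 * (b i K e - qn K e * (edgeLength e / 2)) -
        2 * ∑ j ∈ e, (b j K e - qn K e * (edgeLength e / 2))) x) := by
  set y : Plane → Finset Plane → ℝ := fun i e => b i K e - qn K e * (edgeLength e / 2) with hy
  set κ : Plane → Finset Plane → ℝ := fun i e => 6 * y i e - 2 * ∑ j ∈ e, y j e with hκ
  obtain ⟨a₁, a₂, a₃, h⟩ := T.exists_isTri hK
  have hv := h.volume_pos
  obtain ⟨k, hk⟩ := S.const K hK
  have hq := S.memLp_feFlux hK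
  have hr : MemLp (edgeField K κ) 2 (volume.restrict (hull K)) :=
    memLp_hull_of_continuous K (continuous_edgeField K κ)
  have hmem : MemLp (fun x => feFlux A uh x + edgeField K κ x) 2 (volume.restrict (hull K)) :=
    hq.add hr
  -- The divergence of the correction. Each of the three vertices contributes `-k |K| / 3` to the
  -- sum of the `y i e`, and passing from `y` to `κ` doubles the sum over an edge.
  have hsum : ∑ e ∈ edgesOf K, ∑ i ∈ e, κ i e / (2 * volume.real (hull K)) = -k := by
    have h1 : ∑ e ∈ edgesOf K, ∑ i ∈ e, y i e = -(k * volume.real (hull K)) := by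
      have hswap : ∑ e ∈ edgesOf K, ∑ i ∈ e, y i e =
          ∑ i ∈ K, ∑ e ∈ edgesOf K with i ∈ e, y i e := by
        refine Finset.sum_comm' fun e i => ?_
        rw [Finset.mem_filter]
        constructor
        · exact fun ⟨h1, h2⟩ => ⟨⟨h1, h2⟩, (Finset.mem_powersetCard.1 h1).1 h2⟩
        · exact fun ⟨⟨h1, h2⟩, _⟩ => ⟨h1, h2⟩
      rw [hswap, Finset.sum_congr rfl fun i hi => S.sum_nodal_sub hK hi hk (hb i hi),
        Finset.sum_const, T.card_eq K hK]
      simp only [nsmul_eq_mul, Nat.cast_ofNat]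
      ring
    have h2 : ∀ e ∈ edgesOf K, ∑ i ∈ e, κ i e / (2 * volume.real (hull K)) =
        (volume.real (hull K))⁻¹ * ∑ i ∈ e, y i e := by
      intro e he
      rw [← Finset.sum_div]
      simp only [hκ]
      rw [Finset.sum_sub_distrib, Finset.sum_const, (Finset.mem_powersetCard.1 he).2,
        ← Finset.mul_sum]
      simp only [nsmul_eq_mul, Nat.cast_ofNat]
      field_simp
      ring
    rw [Finset.sum_congr rfl h2, ← Finset.mul_sum, h1]
    field_simp
  have htrace : HasNormalTrace K (fun x => feFlux A uh x + edgeField K κ x) (fun x => -f x)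
      ghat := by
    intro ψ hψ
    have h1 := S.flux K hK ψ hψ
    have h2 := edgeField_normalTrace hK κ hψ
    rw [hsum] at h2
    simp only [zero_mul, add_zero] at h1
    have hgr := memLp_hull_of_continuous K (continuous_gradient hψ)
    have hi1 := integrable_inner_of_memLp hq hgr
    have hi2 : IntegrableOn (fun x => ⟪edgeField K κ x, gradient ψ x⟫ + -k * ψ x) (hull K) := by
      have c1 := continuous_edgeField K κ
      have c2 := continuous_gradient hψ
      have c3 := hψ.continuous
      exact (Continuous.continuousOn (by fun_prop)).integrableOn_compact (isCompact_hull K)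
    have hL : ∫ x in hull K, (⟪feFlux A uh x + edgeField K κ x, gradient ψ x⟫ + -f x * ψ x) =
        (∫ x in hull K, ⟪feFlux A uh x, gradient ψ x⟫) +
          ∫ x in hull K, (⟪edgeField K κ x, gradient ψ x⟫ + -k * ψ x) := by
      rw [← integral_add hi1 hi2]
      refine integral_congr_ae (hk.mono fun x hx => ?_)
      simp only [hx, inner_add_left]
      ring
    rw [hL, h1, h2, ← Finset.sum_add_distrib]
    refine Finset.sum_congr rfl fun e he => ?_
    obtain ⟨l, hl, hlb⟩ := hg e he
    have hadj : K ∈ T.adj e := TriMesh.mem_adj.2 ⟨hK, he⟩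
    have c3 := hψ.continuous
    rw [← integral_add (integrable_edgeMeasure he (by fun_prop)) (integrable_edgeMeasure he ?_)]
    · refine integral_congr_ae ?_
      filter_upwards [hl, ae_edgeMeasure_mem e] with x hx hxe
      rw [hx, TriMesh.affine_eq_of_integral hadj l (qn K e) hlb hxe]
      ring
    · refine Continuous.mul (continuous_finsetSum _ fun i _ => ?_) c3
      exact continuous_const.mul (continuous_shape K i)
  refine ⟨hmem, ?_, htrace⟩
  intro ψ hψ _ hsupp
  have h1 := htrace ψ hψ
  have h2 : ∑ e ∈ edgesOf K, ∫ x, ghat e x * ψ x ∂(edgeMeasure e) = 0 := by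
    refine Finset.sum_eq_zero fun e he => integral_edge_eq_zero fun x hx => ?_
    have hn := TriMesh.notMem_interior (TriMesh.mem_adj.2 ⟨hK, he⟩) hx
    rw [image_eq_zero_of_notMem_tsupport fun h => hn (hsupp h), mul_zero]
  rw [h2, integral_add] at h1
  · linarith
  · exact integrable_inner_of_memLp hmem (memLp_hull_of_continuous K (continuous_gradient hψ))
  · have : IntegrableOn (fun x => -k * ψ x) (hull K) :=
      (Continuous.continuousOn (continuous_const.mul hψ.continuous)).integrableOn_compact
        (isCompact_hull K)
    exact this.congr (hk.mono fun x hx => by simp only [hx])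

/-! ### Energy of the correction and summation over patches -/

theorem creSq_le (S : IsSetting T ΓD aMin aMax M A f g u uh qn) (qhat : Plane → Plane) :
    creSq T A uh qhat ≤ 1 / 2 * ∑ K ∈ T.elems,
      fluxNormSq A (hull K) (fun x => qhat x - feFlux A uh x) := by
  rw [creSq]
  refine mul_le_mul_of_nonneg_left ?_ (by norm_num)
  unfold fluxNormSq
  by_cases hintg : IntegrableOn (fun x => ⟪(A x).inverse (qhat x - feFlux A uh x),
      qhat x - feFlux A uh x⟫) T.domain
  · exact (integral_domain hintg).le
  -- A non-integrable energy density has integral `0` by default, and the right-hand side is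
  -- nonnegative.
  · rw [integral_undef hintg]
    refine Finset.sum_nonneg fun K hK => integral_nonneg_of_ae ?_
    filter_upwards [(S.tensorK hK).ae_inverse S.aMin_pos] with x hx
    exact (hx _).1

theorem fluxNormSq_edgeField_le (S : IsSetting T ΓD aMin aMax M A f g u uh qn) (hK : K ∈ T.elems)
    {κ : Plane → Finset Plane → ℝ} {Y : ℝ} (hκ : ∀ e ∈ edgesOf K, ∀ i ∈ e, |κ i e| ≤ Y) :
    fluxNormSq A (hull K) (fun x => feFlux A uh x + edgeField K κ x - feFlux A uh x) ≤
      aMin⁻¹ * (9 * M * Y ^ 2) := by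
  have h0 := S.aMin_pos
  refine le_trans ?_ (mul_le_mul_of_nonneg_left
    (integral_norm_sq_edgeField_le hK (S.area K hK) hκ) (by positivity))
  rw [fluxNormSq, ← integral_const_mul]
  simp only [add_sub_cancel_left]
  have hc := continuous_edgeField K κ
  refine integral_mono_of_nonneg ?_
    ((Continuous.continuousOn (by fun_prop)).integrableOn_compact (isCompact_hull K)) ?_
  · filter_upwards [(S.tensorK hK).ae_inverse S.aMin_pos] with x hx
    exact (hx _).1
  · filter_upwards [(S.tensorK hK).ae_inverse S.aMin_pos] with x hx
    exact (hx _).2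

/-- Double counting: the error of `J` enters through each of its three vertices, once for each of
the at most `N` elements around that vertex. -/
theorem sum_patchError_le (S : IsSetting T ΓD aMin aMax M A f g u uh qn) {N : ℕ}
    (hN : ∀ i, Fintype.card (Patch T i) ≤ N) :
    ∑ K ∈ T.elems, ∑ i ∈ K, patchError T A u.grad uh i ≤
      3 * N * ∑ K ∈ T.elems, elemError A u.grad uh K := by
  classical
  have hcard : ∀ i, (T.elems.filter fun K => i ∈ K).card ≤ N := fun i => card_patch T i ▸ hN i
  have h1 : ∀ K ∈ T.elems, ∑ i ∈ K, patchError T A u.grad uh i =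
      ∑ J ∈ T.elems, ∑ i ∈ J, if i ∈ K then elemError A u.grad uh J else 0 := by
    intro K _
    simp only [patchError]
    rw [← Finset.sum_comm' (s := T.elems) (t := fun J => K.filter fun i => i ∈ J)
      (f := fun J _ => elemError A u.grad uh J)]
    · refine Finset.sum_congr rfl fun J _ => ?_
      rw [← Finset.sum_filter]
      congr 1
      ext i
      simp only [Finset.mem_filter]
      tauto
    · intro J i
      simp only [Finset.mem_filter]
      tauto
  rw [Finset.sum_congr rfl h1, Finset.sum_comm, Finset.mul_sum]
  refine Finset.sum_le_sum fun J hJ => ?_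
  rw [Finset.sum_comm]
  have h0 := S.elemError_nonneg hJ
  calc ∑ i ∈ J, ∑ K ∈ T.elems, (if i ∈ K then elemError A u.grad uh J else 0)
      ≤ ∑ i ∈ J, N * elemError A u.grad uh J := by
        refine Finset.sum_le_sum fun i _ => ?_
        rw [← Finset.sum_filter, Finset.sum_const, nsmul_eq_mul]
        have : ((T.elems.filter fun K => i ∈ K).card : ℝ) ≤ N := by exact_mod_cast hcard i
        gcongr
    _ = _ := by
        rw [Finset.sum_const, T.card_eq J hJ]
        simp only [nsmul_eq_mul, Nat.cast_ofNat]
        ring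

end IsSetting

end HybridFlux

/-! ### Proof of the theorem -/

theorem theorem1 (γ₀ aMin aMax : ℝ) (haMin : 0 < aMin) (haMax : aMin ≤ aMax) :
    ∃ C : ℝ, ∀ (T : TriMesh) (ΓD : Finset (Finset Plane)) (A : Plane → Plane →L[ℝ] Plane)
      (f g : Plane → ℝ) (u : H1 T.domain) (uh : Plane → ℝ)
      (qn : Finset Plane → Finset Plane → ℝ) (qhat : Plane → Plane),
      T.IsRegular γ₀ →
      ΓD.Nonempty → ΓD ⊆ T.boundaryEdges →
      IsDiffusionTensor T.domain aMin aMax A →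
      IsWeakSolution T ΓD A f g u →
      IsFESolution T ΓD A f g uh →
      -- `div (A∇u_h) = 0` on each triangle
      (∀ K ∈ T.elems, HasWeakDiv K (feFlux A uh) (fun _ => 0)) →
      -- the normal flux of `q_h` from each triangle is constant on each edge, with value `qn K e`
      (∀ K ∈ T.elems, HasNormalTrace K (feFlux A uh) (fun _ => 0) (fun e _ => qn K e)) →
      IsElementwiseConstant T f →
      IsEdgewiseAffine (T.neumannEdges ΓD) g →
      IsHybridFlux T ΓD A f g uh qn qhat →
      creSq T A uh qhat ≤ C * energyErrorSq T A u uh := by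
  classical
  -- The lower bound `2` makes `M / 2 ≥ 1`, so that its powers grow with the length of a chain of
  -- elements.
  set M := max (areaConst γ₀) 2 with hM
  have hM2 : 2 ≤ M := le_max_right _ _
  set N := ⌈Real.pi * M⌉₊ with hN
  obtain ⟨c, hc0, hc⟩ := exists_traction_bound M hM2 N
  refine ⟨1 / 2 * (aMin⁻¹ * (9 * M * (10 * c) ^ 2) * (aMax * M) * (3 * N)), ?_⟩
  intro T ΓD A f g u uh qn qhat hreg _ hsub hA hu huh _ hflux hf hg hq
  have hmax : 0 < aMax := haMin.trans_le haMax
  have S : IsSetting T ΓD aMin aMax M A f g u uh qn :=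
    { aMin_pos := haMin
      aMin_le := haMax
      area := fun K hK => (hreg.diam_sq_le hK).trans
        (mul_le_mul_of_nonneg_right (le_max_left _ _) measureReal_nonneg)
      subset := hsub
      tensor := hA
      weak := hu
      affine := huh.1.1
      flux := hflux
      const := hf
      edgewise := hg }
  have hcard : ∀ i, Fintype.card (Patch T i) ≤ N := by
    intro i
    have h1 := TriMesh.card_vertex_le (by linarith) S.area i (T.elems.filter fun K => i ∈ K)
      fun K hK => Finset.mem_filter.1 hK
    have h2 := Nat.le_ceil (Real.pi * M)
    rw [card_patch]
    exact_mod_cast h1.trans h2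
  obtain ⟨ghat, ⟨b, hb, hgN, hgE⟩, hqhat⟩ := hq
  have hlocal : ∀ K ∈ T.elems, fluxNormSq A (hull K) (fun x => qhat x - feFlux A uh x) ≤
      aMin⁻¹ * (9 * M * (10 * c) ^ 2) * (aMax * M) * ∑ i ∈ K, patchError T A u.grad uh i := by
    intro K hK
    have hE : 0 ≤ ∑ i ∈ K, patchError T A u.grad uh i :=
      Finset.sum_nonneg fun i _ => S.patchError_nonneg i
    have hadm := S.isAdmissibleFlux hK (b := b) (ghat := ghat K) (fun i hi => (hb K hK i hi).1) (by
      intro e he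
      have hadj : K ∈ T.adj e := TriMesh.mem_adj.2 ⟨hK, he⟩
      by_cases heN : e ∈ T.neumannEdges ΓD
      · obtain ⟨l, hl⟩ := hg e heN
        refine ⟨l, ?_, fun i hi => ?_⟩
        · filter_upwards [hl, ae_edgeMeasure_mem e] with x h1 h2
          rw [hgN e heN K hadj x h2, h1]
        · have hiK := (Finset.mem_powersetCard.1 he).1 hi
          rw [(hb K hK i hiK).1.neumann e heN hi K hadj]
          exact integral_congr_ae (hl.mono fun x hx => by simp only [hx])
      · obtain ⟨⟨k, hk⟩, h2⟩ := hgE e (TriMesh.mem_edges.2 ⟨K, hK, he⟩) heN K hadj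
        have hl : ∀ᵐ x ∂(edgeMeasure e), ghat K e x = (∑ j ∈ e, k j • shape K j) x := by
          filter_upwards [ae_edgeMeasure_mem e] with x hx
          rw [hk x hx, coe_sum_smul_affineMap]
        refine ⟨∑ j ∈ e, k j • shape K j, hl, fun i hi => ?_⟩
        rw [← h2 i hi]
        exact integral_congr_ae (hl.mono fun x hx => by simp only [hx]))
    -- Minimality of `qhat` on `K` against the corrected finite element flux.
    refine ((hqhat K hK).2 _ hadm).trans ?_
    have hy : ∀ e ∈ edgesOf K, ∀ i ∈ e, |b i K e - qn K e * (edgeLength e / 2)| ≤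
        c * (√(aMax * M) * √(∑ i ∈ K, patchError T A u.grad uh i)) := by
      intro e he i hi
      have hiK := (Finset.mem_powersetCard.1 he).1 hi
      refine (hc S (hcard i) (hb K hK i hiK).1 (hb K hK i hiK).2 K hK e he hi).trans ?_
      gcongr
      exact Finset.single_le_sum (f := fun i => patchError T A u.grad uh i)
        (fun i _ => S.patchError_nonneg i) hiK
    set Y := c * (√(aMax * M) * √(∑ i ∈ K, patchError T A u.grad uh i)) with hY
    -- The coefficients `6 y_i - 2 ∑ y_j`, with two endpoints per edge, are at most `6 Y + 2 * (2
    -- Y)`.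
    refine (S.fluxNormSq_edgeField_le hK (Y := 10 * Y) ?_).trans (le_of_eq ?_)
    · intro e he i hi
      have h1 := hy e he i hi
      have h2 : |∑ j ∈ e, (b j K e - qn K e * (edgeLength e / 2))| ≤ 2 * Y := by
        refine (Finset.abs_sum_le_sum_abs _ _).trans
          ((Finset.sum_le_card_nsmul _ _ Y (hy e he)).trans (le_of_eq ?_))
        rw [(Finset.mem_powersetCard.1 he).2]
        simp
      refine (abs_sub _ _).trans ?_
      rw [abs_mul, abs_mul, abs_of_pos (by norm_num : (0 : ℝ) < 6),
        abs_of_pos (by norm_num : (0 : ℝ) < 2)]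
      linarith
    · rw [hY, mul_pow, mul_pow, mul_pow, Real.sq_sqrt (by positivity), Real.sq_sqrt hE]
      ring
  calc creSq T A uh qhat ≤ 1 / 2 * ∑ K ∈ T.elems,
        fluxNormSq A (hull K) (fun x => qhat x - feFlux A uh x) := S.creSq_le qhat
    _ ≤ 1 / 2 * ∑ K ∈ T.elems, aMin⁻¹ * (9 * M * (10 * c) ^ 2) * (aMax * M) *
          ∑ i ∈ K, patchError T A u.grad uh i := by
        gcongr with K hK
        exact hlocal K hK
    _ = 1 / 2 * (aMin⁻¹ * (9 * M * (10 * c) ^ 2) * (aMax * M) *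
          ∑ K ∈ T.elems, ∑ i ∈ K, patchError T A u.grad uh i) := by rw [← Finset.mul_sum]
    _ ≤ 1 / 2 * (aMin⁻¹ * (9 * M * (10 * c) ^ 2) * (aMax * M) *
          (3 * N * ∑ K ∈ T.elems, elemError A u.grad uh K)) := by
        gcongr
        exact S.sum_patchError_le hcard
    _ = _ := by rw [S.energyErrorSq_eq]; ring
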